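/- **Theorem 1 (Convergence rate of the GNTK).** Let $G=(V,E)$ be a finite undirected simple graph with $n=|V|$ nodes, let $\mathcal N(u)$ be the set of neighbours of $u$, let $h_u\in\mathbb R^d$ ($u\in V$) be node features, let $R\ge 0$ be an integer, let $\phi$ be either the ReLU $\phi(x)=\max\{0,x\}$ (with $\phi'=\mathbf 1_{(0,\infty)}$) or $\phi=\tanh$, and let $\sigma_w,\sigma_b\in\mathbb R$ be at the edge of chaos: there is $q^*>0$ with $$\sigma_w^2\,\mathbb E[\phi(\sqrt{q^*}z)^2]+\sigma_b^2=q^*,\qquad \sigma_w^2\,\mathbb E[\phi'(\sqrt{q^*}z)^2]=1,\qquad z\sim\mathcal N(0,1).$$ (For ReLU this means $\sigma_w^2=2$, $\sigma_b=0$.) For a kernel $S:V\times V\to\mathbb R$ put $$(\mathcal A S)(u,u')=\frac1{|\mathcal N(u)|+1}\,\frac1{|\mathcal N(u')|+1}\sum_{v\in\mathcal N(u)\cup\{u\}}\ \sum_{v'\in\mathcal N(u')\cup\{u'\}}S(v,v'),$$ and let $\mathcal A(G)\in\mathbb R^{n^2\times n^2}$ be the matrix of this map on vectorized kernels. For $l\ge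 0$ and $0\le r\le R$ define the Gaussian process kernels $\Sigma^{(l)}_{(r)}$ and the graph neural tangent kernels $\Theta^{(l)}_{(r)}$ by $\Sigma^{(0)}_{(0)}(u,u')=\Theta^{(0)}_{(0)}(u,u')=\langle h_u,h_{u'}\rangle$; $\Sigma^{(l)}_{(0)}=\mathcal A\,\Sigma^{(l-1)}_{(R)}$ and $\Theta^{(l)}_{(0)}=\mathcal A\,\Theta^{(l-1)}_{(R)}$ for $l\ge1$; and, for $1\le r\le R$, $$\Sigma^{(l)}_{(r)}(u,u')=\sigma_w^2\,\mathbb E[\phi(z_1)\phi(z_2)]+\sigma_b^2,\qquad \dot\Sigma^{(l)}_{(r)}(u,u')=\sigma_w^2\,\mathbb E[\phi'(z_1)\phi'(z_2)],$$ $$\Theta^{(l)}_{(r)}(u,u')=\Theta^{(l)}_{(r-1)}(u,u')\,\dot\Sigma^{(l)}_{(r)}(u,u')+\Sigma^{(l)}_{(r)}(u,u'),$$ where $(z_1,z_2)$ is a centred Gaussian vector whose covariance matrix is the restriction of $\Sigma^{(l)}_{(r-1)}$ to $(u,u')$. Suppose that the transition matrix $\mathcal A(G)$ is irreducible and aperiodic,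 and let $\vec\pi(G)\in\mathbb R^{n^2}$ be a stationary distribution of it, i.e. a probability vector with $\vec\pi(G)^T\mathcal A(G)=\vec\pi(G)^T$. Then there are constants $0<\alpha<1$ and $C>0$, a vector $\vec v\in\mathbb R^{n^2}$ and, for each $0\le r\le R$, a vector $\vec v'=\vec v'_{(r)}\in\mathbb R^{n^2}$, all independent of $l,u,u'$, such that for all $0\le r\le R$, all $l\ge0$ and all $u,u'\in V$ $$\Big|\Theta^{(l)}_{(r)}(u,u')-\vec\pi(G)^T\big(Rl\,\vec v+\vec v'_{(r)}\big)\Big|\le C\alpha^l .$$ In particular, all entries of the GNTK matrix approach the same value at an exponential rate in the depth: $$\big|\Theta^{(l)}_{(r)}(u,u')-\Theta^{(l)}_{(r)}(w,w')\big|\le 2C\alpha^l\qquad\text{for all } u,u',w,w'\in V.$$ -/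

import Mathlib

open MeasureTheory ProbabilityTheory
open scoped Matrix Kronecker

noncomputable section

namespace GNTK

/-- The ReLU activation. Its `deriv` is the indicator of `(0, ∞)` (the value at the kink is `0`). -/
def relu (x : ℝ) : ℝ := max 0 x

/-- The centred Gaussian law on `ℝ²` whose covariance matrix is the restriction of the kernel `S`
to the pair `u, u'`. -/
def pairGaussian {V : Type*} (S : V → V → ℝ) (u u' : V) : Measure (EuclideanSpace ℝ (Fin 2)) :=
  multivariateGaussian 0 !![S u u, S u u'; S u' u, S u' u']

/-- Covariance of the next layer: `σ_w² 𝔼[φ(z₁) φ(z₂)] + σ_b²`. -/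
def covStep {V : Type*} (φ : ℝ → ℝ) (σw σb : ℝ) (S : V → V → ℝ) (u u' : V) : ℝ :=
  σw ^ 2 * ∫ z, φ (z 0) * φ (z 1) ∂(pairGaussian S u u') + σb ^ 2

/-- Derivative covariance of the next layer: `σ_w² 𝔼[φ'(z₁) φ'(z₂)]`. -/
def covDotStep {V : Type*} (φ : ℝ → ℝ) (σw : ℝ) (S : V → V → ℝ) (u u' : V) : ℝ :=
  σw ^ 2 * ∫ z, deriv φ (z 0) * deriv φ (z 1) ∂(pairGaussian S u u')

section Graph

variable {V : Type*} [Fintype V] [DecidableEq V] (G : SimpleGraph V) [DecidableRel G.Adj]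

/-- Mean aggregation of a kernel over the closed neighbourhoods `N(u) ∪ {u}`, `N(u') ∪ {u'}`. -/
def aggregate (S : V → V → ℝ) (u u' : V) : ℝ :=
  1 / ((G.degree u : ℝ) + 1) * (1 / ((G.degree u' : ℝ) + 1)) *
    ∑ v ∈ insert u (G.neighborFinset u), ∑ v' ∈ insert u' (G.neighborFinset u'), S v v'

/-- Averaging over the closed neighbourhood, as a matrix on the nodes. -/
def avgMatrix : Matrix V V ℝ :=
  Matrix.of fun u v => if v = u ∨ G.Adj u v then 1 / ((G.degree u : ℝ) + 1) else 0

/-- The aggregation operator `𝒜(G)` on vectorized kernels, with rows and columns indexed by pairs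
of nodes. -/
def aggMatrix : Matrix (V × V) (V × V) ℝ := avgMatrix G ⊗ₖ avgMatrix G

/-- The Gaussian process kernel `Σ^{(l)}_{(r)}` of the infinitely wide GCN with node features `h`
and `R` layers in each propagation unit. -/
def gpk {d : ℕ} (h : V → EuclideanSpace ℝ (Fin d)) (φ : ℝ → ℝ) (σw σb : ℝ) (R : ℕ) :
    ℕ → ℕ → V → V → ℝ
  | 0, 0 => fun u u' => inner ℝ (h u) (h u')
  | l + 1, 0 => aggregate G (gpk h φ σw σb R l R)
  | l, r + 1 => covStep φ σw σb (gpk h φ σw σb R l r)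

/-- The graph neural tangent kernel `Θ^{(l)}_{(r)}`. -/
def gntk {d : ℕ} (h : V → EuclideanSpace ℝ (Fin d)) (φ : ℝ → ℝ) (σw σb : ℝ) (R : ℕ) :
    ℕ → ℕ → V → V → ℝ
  | 0, 0 => fun u u' => inner ℝ (h u) (h u')
  | l + 1, 0 => aggregate G (gntk h φ σw σb R l R)
  | l, r + 1 => fun u u' =>
      gntk h φ σw σb R l r u u' * covDotStep φ σw (gpk G h φ σw σb R l r) u u'
        + gpk G h φ σw σb R l (r + 1) u u'

/-- Aggregation of a kernel is multiplication of the vectorized kernel by `𝒜(G)`. -/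
theorem aggMatrix_mulVec (S : V → V → ℝ) (p : V × V) :
    (aggMatrix G *ᵥ fun q => S q.1 q.2) p = aggregate G S p.1 p.2 := by
  obtain ⟨u, u'⟩ := p
  have key : ∀ (w : V) (f : V → ℝ), ∑ v, avgMatrix G w v * f v =
      1 / ((G.degree w : ℝ) + 1) * ∑ v ∈ insert w (G.neighborFinset w), f v := by
    intro w f
    rw [Finset.mul_sum, ← Finset.sum_subset (Finset.subset_univ (insert w (G.neighborFinset w)))]
    · refine Finset.sum_congr rfl fun v hv => ?_
      have : v = w ∨ G.Adj w v := by simpa using hv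
      simp [avgMatrix, this]
    · intro v _ hv
      have : ¬(v = w ∨ G.Adj w v) := by simpa using hv
      simp only [avgMatrix, Matrix.of_apply, if_neg this, zero_mul]
  simp only [Matrix.mulVec, dotProduct, aggMatrix, Matrix.kroneckerMap_apply, Fintype.sum_prod_type,
    aggregate]
  simp only [mul_assoc, ← Finset.mul_sum, key]

end Graph

/-- Aperiodicity of a transition matrix: for every state, the possible return times have greatest
common divisor `1`. -/
def IsAperiodic {ι : Type*} [Fintype ι] [DecidableEq ι] (A : Matrix ι ι ℝ) : Prop :=
  ∀ i, ∀ k : ℕ, (∀ m : ℕ, 1 ≤ m → 0 < (A ^ m) i i → k ∣ m) → k = 1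

/-- `p` is a stationary probability vector of the (row-stochastic) transition matrix `A`. -/
def IsStationaryDistribution {ι : Type*} [Fintype ι] (A : Matrix ι ι ℝ) (p : ι → ℝ) : Prop :=
  (∀ i, 0 ≤ p i) ∧ ∑ i, p i = 1 ∧ p ᵥ* A = p

/-- `(σ_w, σ_b)` lies on the edge of chaos of the activation `φ`: the variance recursion has a
nondegenerate fixed point `q`, at which `σ_w² 𝔼[φ'(√q z)²] = 1`. -/
def EdgeOfChaos (φ : ℝ → ℝ) (σw σb : ℝ) : Prop :=
  ∃ q : ℝ, 0 < q ∧
    σw ^ 2 * ∫ z, φ (√q * z) ^ 2 ∂(gaussianReal 0 1) + σb ^ 2 = q ∧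
    σw ^ 2 * ∫ z, deriv φ (√q * z) ^ 2 ∂(gaussianReal 0 1) = 1

end GNTK

end

/-! The aggregation matrix A is row stochastic, and its diagonal is positive because every closed
neighbourhood contains its centre. Irreducibility therefore makes some power of A bounded below by a
`δ > 0`, so A mixes geometrically.

Suppose that the covariances converge exponentially to a constant `c` and the derivative covariances
to `1`. Then each layer changes Θ by the addition of `c`, up to the error Θ(Σ̇ - 1) + (Σ - c). An a
priori bound Θ = O(l + 1) makes this error exponentially small, so Θ at `r = 0` minus `R l c` is a
Markov average with decaying forcing and converges to a constant `κ`. The constant vectors `v = c`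
and `v' r = κ + r c` then work (`exists_linear_growth`, `gntk_linear_growth`). What remains is the
convergence of the covariances.

ReLU (σ_w² = 2, σ_b = 0): a layer never lowers an entry and never exceeds the largest variance. The
kernels are thus superharmonic for A while their maxima decrease, so their oscillation decays
geometrically (`exists_squeeze_of_superharmonic`). Nonzero features give a positive limit, hence Σ̇
→ 1; zero features give a zero tangent kernel.

tanh: sublinearity of `x ↦ 𝔼[tanh² (√x z)]` makes the variance map contract towards the critical
variance `q` with factor `1 - σ_b²/q < 1`, which controls all entries from above. From below,
Gaussian integration by parts along a rotation gives `pairExp_tanh_gap`: at slope one, a layer does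
not increase the deficit of a nonnegative covariance below `q`, except for an exponentially small
error (`TanhCritical.le_cov`). Diagonal deficits really contract, and mixing spreads this gain to
all pairs (`expDecay_gpk_tanh`). Covariances are eventually nonnegative by comparison with a second
copy of the network sharing only the biases: the cross-covariances start at `0`, stay nonnegative
and grow past a fixed level, and positive semidefiniteness of the joint kernel transfers this to Σ
(`exists_gpk_tanh_nonneg`). -/

namespace GNTK

/-! ### Gaussian pairs -/

/-- The law of `(p x + q y, r x + s y)` for independent standard normal `x, y`. -/
theorem multivariateGaussian_pair_eq_map (p q r s : ℝ) :
    multivariateGaussian (0 : EuclideanSpace ℝ (Fin 2))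
        !![p ^ 2 + q ^ 2, p * r + q * s; p * r + q * s, r ^ 2 + s ^ 2] =
      ((gaussianReal 0 1).prod (gaussianReal 0 1)).map
        (fun w : ℝ × ℝ => !₂[p * w.1 + q * w.2, r * w.1 + s * w.2]) := by
  have hS : (!![p ^ 2 + q ^ 2, p * r + q * s; p * r + q * s, r ^ 2 + s ^ 2] :
      Matrix (Fin 2) (Fin 2) ℝ).PosSemidef := by
    have : (!![p ^ 2 + q ^ 2, p * r + q * s; p * r + q * s, r ^ 2 + s ^ 2] :
      Matrix (Fin 2) (Fin 2) ℝ) = !![p, q; r, s] * (!![p, q; r, s])ᴴ := by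
      ext i j
      fin_cases i <;> fin_cases j <;> simp [Matrix.mul_apply, Fin.sum_univ_two] <;> ring
    rw [this]
    exact Matrix.posSemidef_self_mul_conjTranspose _
  have hm : Measurable (fun w : ℝ × ℝ => !₂[p * w.1 + q * w.2, r * w.1 + s * w.2]) := by
    fun_prop
  have : IsProbabilityMeasure (((gaussianReal 0 1).prod (gaussianReal 0 1)).map
        (fun w : ℝ × ℝ => !₂[p * w.1 + q * w.2, r * w.1 + s * w.2])) :=
    Measure.isProbabilityMeasure_map hm.aemeasurable
  refine Measure.ext_of_charFun (funext fun t => ?_)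
  rw [charFun_multivariateGaussian hS, charFun_apply, integral_map hm.aemeasurable
    (by fun_prop)]
  have h1 : ∀ w : ℝ × ℝ, Complex.exp ((inner ℝ !₂[p * w.1 + q * w.2, r * w.1 + s * w.2] t : ℝ)
      * Complex.I) = Complex.exp (((t 0 * p + t 1 * r : ℝ) : ℂ) * w.1 * Complex.I) *
        Complex.exp (((t 0 * q + t 1 * s : ℝ) : ℂ) * w.2 * Complex.I) := by
    intro w
    rw [← Complex.exp_add]
    congr 1
    simp [PiLp.inner_apply, Fin.sum_univ_two]
    ring
  simp_rw [h1]
  rw [integral_prod_mul (fun x : ℝ => Complex.exp (((t 0 * p + t 1 * r : ℝ) : ℂ) * x * Complex.I))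
    (fun x : ℝ => Complex.exp (((t 0 * q + t 1 * s : ℝ) : ℂ) * x * Complex.I)),
    ← charFun_apply_real, ← charFun_apply_real, charFun_gaussianReal, charFun_gaussianReal,
    ← Complex.exp_add]
  congr 1
  simp [Matrix.mulVec, dotProduct, Fin.sum_univ_two]
  ring

/-- `𝔼[ψ(z₁) ψ(z₂)]` for a centred Gaussian pair with variances `a`, `d` and covariance `b`. -/
noncomputable def pairExp (ψ : ℝ → ℝ) (a b d : ℝ) : ℝ :=
  ∫ z, ψ (z 0) * ψ (z 1) ∂(multivariateGaussian (0 : EuclideanSpace ℝ (Fin 2)) !![a, b; b, d])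

theorem pairExp_eq_integral_prod {ψ : ℝ → ℝ} (hψ : Measurable ψ) (p q r s : ℝ) {a b d : ℝ}
    (ha : a = p ^ 2 + q ^ 2) (hb : b = p * r + q * s) (hd : d = r ^ 2 + s ^ 2) :
    pairExp ψ a b d = ∫ w, ψ (p * w.1 + q * w.2) * ψ (r * w.1 + s * w.2)
      ∂((gaussianReal 0 1).prod (gaussianReal 0 1)) := by
  subst ha hb hd
  rw [pairExp, multivariateGaussian_pair_eq_map, integral_map (by fun_prop)]
  · simp
  · exact (by fun_prop : Measurable fun z : EuclideanSpace ℝ (Fin 2) =>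
      ψ (z 0) * ψ (z 1)).aestronglyMeasurable

/-- Cholesky factorization: the pair becomes `(p x, r x + s y)` with `x, y` independent standard
normals. The degenerate case `a = 0` forces `b = 0`. -/
theorem exists_pair_factorization {a b d : ℝ} (ha : 0 ≤ a) (hd : 0 ≤ d) (h : b ^ 2 ≤ a * d) :
    ∃ p r s : ℝ, a = p ^ 2 ∧ b = p * r ∧ d = r ^ 2 + s ^ 2 := by
  rcases ha.eq_or_lt with rfl | ha'
  · refine ⟨0, 0, √d, by simp, ?_, by simp [Real.sq_sqrt hd]⟩
    have : b ^ 2 = 0 := le_antisymm (by simpa using h) (sq_nonneg b)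
    simpa using this
  · have hs : 0 < √a := Real.sqrt_pos.2 ha'
    have hsq : √a ^ 2 = a := Real.sq_sqrt ha
    have hle : 0 ≤ d - b ^ 2 / a := by
      rw [sub_nonneg, div_le_iff₀ ha']; linarith
    refine ⟨√a, b / √a, √(d - b ^ 2 / a), hsq.symm, by field_simp, ?_⟩
    rw [Real.sq_sqrt hle, div_pow, hsq]
    ring

theorem pairExp_comm {ψ : ℝ → ℝ} (hψ : Measurable ψ) {a b d : ℝ} (ha : 0 ≤ a) (hd : 0 ≤ d)
    (h : b ^ 2 ≤ a * d) : pairExp ψ a b d = pairExp ψ d b a := by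
  obtain ⟨p, r, s, h1, h2, h3⟩ := exists_pair_factorization ha hd h
  rw [pairExp_eq_integral_prod hψ p 0 r s (by simpa using h1) (by simpa using h2) h3,
    pairExp_eq_integral_prod hψ r s p 0 h3 (by rw [h2]; ring) (by simpa using h1)]
  simp_rw [mul_comm]

theorem integral_fst_gaussian_prod (f : ℝ → ℝ) :
    ∫ w, f w.1 ∂((gaussianReal 0 1).prod (gaussianReal 0 1)) = ∫ x, f x ∂(gaussianReal 0 1) := by
  simpa using integral_fun_fst (μ := gaussianReal 0 1) (ν := gaussianReal 0 1) f

theorem pairExp_self {ψ : ℝ → ℝ} (hψ : Measurable ψ) {a : ℝ} (ha : 0 ≤ a) :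
    pairExp ψ a a a = ∫ x, ψ (√a * x) ^ 2 ∂(gaussianReal 0 1) := by
  have hsq : a = √a ^ 2 + 0 ^ 2 := by simp [Real.sq_sqrt ha]
  rw [pairExp_eq_integral_prod hψ (√a) 0 (√a) 0 hsq (by linarith) hsq,
    ← integral_fst_gaussian_prod]
  simp [sq]

theorem covStep_eq_pairExp {V : Type*} (φ : ℝ → ℝ) (σw σb : ℝ) {S : V → V → ℝ} {u u' : V}
    (h : S u' u = S u u') :
    covStep φ σw σb S u u' = σw ^ 2 * pairExp φ (S u u) (S u u') (S u' u') + σb ^ 2 := by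
  rw [covStep, pairGaussian, h, pairExp]

theorem covDotStep_eq_pairExp {V : Type*} (φ : ℝ → ℝ) (σw : ℝ) {S : V → V → ℝ} {u u' : V}
    (h : S u' u = S u u') :
    covDotStep φ σw S u u' = σw ^ 2 * pairExp (deriv φ) (S u u) (S u u') (S u' u') := by
  rw [covDotStep, pairGaussian, h, pairExp]

/-! ### Positive semidefinite kernels -/

/-- This realizes all the pairs on one Gaussian vector, which is what makes the quadratic form in
`posSemidef_covStep` the expectation of a square. -/
theorem map_pair_multivariateGaussian {V : Type*} [Fintype V] [DecidableEq V]
    {S : Matrix V V ℝ} (hS : S.PosSemidef) (u u' : V) :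
    (multivariateGaussian (0 : EuclideanSpace ℝ V) S).map
        (fun z => (!₂[z u, z u'] : EuclideanSpace ℝ (Fin 2))) =
      multivariateGaussian 0 !![S u u, S u u'; S u' u, S u' u'] := by
  have hS2 : (!![S u u, S u u'; S u' u, S u' u'] : Matrix (Fin 2) (Fin 2) ℝ).PosSemidef := by
    have : (!![S u u, S u u'; S u' u, S u' u'] : Matrix (Fin 2) (Fin 2) ℝ) =
        S.submatrix ![u, u'] ![u, u'] := by
      ext i j
      fin_cases i <;> fin_cases j <;> simp
    rw [this]
    exact hS.submatrix _
  have hm : Measurable (fun z : EuclideanSpace ℝ V =>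
      (!₂[z u, z u'] : EuclideanSpace ℝ (Fin 2))) := by fun_prop
  have : IsProbabilityMeasure ((multivariateGaussian (0 : EuclideanSpace ℝ V) S).map
        (fun z => (!₂[z u, z u'] : EuclideanSpace ℝ (Fin 2)))) :=
    Measure.isProbabilityMeasure_map hm.aemeasurable
  refine Measure.ext_of_charFun (funext fun t => ?_)
  rw [charFun_multivariateGaussian hS2, charFun_apply, integral_map hm.aemeasurable
    (by fun_prop)]
  have h1 : ∀ z : EuclideanSpace ℝ V, (inner ℝ (!₂[z u, z u'] : EuclideanSpace ℝ (Fin 2)) t : ℝ)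
      = inner ℝ z (t 0 • EuclideanSpace.single u (1 : ℝ) +
          t 1 • EuclideanSpace.single u' (1 : ℝ)) := by
    intro z
    simp [PiLp.inner_apply, Fin.sum_univ_two, inner_add_right, inner_smul_right]
  simp_rw [h1]
  rw [← charFun_apply, charFun_multivariateGaussian hS]
  congr 2
  · simp
  · congr 1
    simp [Matrix.mulVec, dotProduct, Fin.sum_univ_two, Finset.sum_add_distrib, add_mul, mul_add]

theorem memLp_eval_multivariateGaussian {V : Type*} [Fintype V] [DecidableEq V]
    (S : Matrix V V ℝ) {φ : ℝ → ℝ} (hφ : Measurable φ) (hle : ∀ x, |φ x| ≤ |x|) (u : V) :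
    MemLp (fun z : EuclideanSpace ℝ V => φ (z u)) 2 (multivariateGaussian 0 S) := by
  have h : MemLp (id : EuclideanSpace ℝ V → _) 2 (multivariateGaussian 0 S) :=
    IsGaussian.memLp_two_id
  refine h.mono (hφ.comp (by fun_prop)).aestronglyMeasurable (ae_of_all _ fun z => ?_)
  exact (hle _).trans (PiLp.norm_apply_le z u)

/-- The quadratic form at `c` is σ_w² 𝔼[(∑ c_u φ(z_u))²] + σ_b² (∑ c_u)². The bound `|φ x| ≤ |x|`
supplies square integrability. -/
theorem posSemidef_covStep {V : Type*} [Fintype V] {φ : ℝ → ℝ} (hφ : Measurable φ)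
    (hle : ∀ x, |φ x| ≤ |x|) (σw σb : ℝ) {S : V → V → ℝ} (hS : (Matrix.of S).PosSemidef) :
    (Matrix.of (covStep φ σw σb S)).PosSemidef := by
  classical
  set μ := multivariateGaussian (0 : EuclideanSpace ℝ V) (Matrix.of S)
  have hL := memLp_eval_multivariateGaussian (Matrix.of S) hφ hle
  have hE : ∀ u u', covStep φ σw σb S u u' = σw ^ 2 * ∫ z, φ (z u) * φ (z u') ∂μ + σb ^ 2 := by
    intro u u'
    have := map_pair_multivariateGaussian hS u u'
    simp only [Matrix.of_apply] at this
    rw [covStep, pairGaussian, ← this, integral_map (by fun_prop)]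
    · simp [μ]
    · exact (by fun_prop : Measurable fun z : EuclideanSpace ℝ (Fin 2) =>
        φ (z 0) * φ (z 1)).aestronglyMeasurable
  refine Matrix.PosSemidef.of_dotProduct_mulVec_nonneg ?_ fun c => ?_
  · ext u u'
    simp only [Matrix.conjTranspose_apply, Matrix.of_apply, hE, star_trivial]
    simp_rw [mul_comm]
  · have h1 : ∀ u u', Integrable (fun z => φ (z u) * φ (z u')) μ :=
      fun u u' => (hL u).integrable_mul (hL u')
    have h4 : ∀ u u', Integrable (fun z => c u * φ (z u) * (c u' * φ (z u'))) μ := fun u u' => by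
      convert (h1 u u').const_mul (c u * c u') using 2
      ring
    have h2 : star c ⬝ᵥ Matrix.of (covStep φ σw σb S) *ᵥ c =
        σw ^ 2 * ∫ z, (∑ u, c u * φ (z u)) ^ 2 ∂μ + σb ^ 2 * (∑ u, c u) ^ 2 := by
      have h3 : ∫ z, (∑ u, c u * φ (z u)) ^ 2 ∂μ =
          ∑ u, ∑ u', c u * c u' * ∫ z, φ (z u) * φ (z u') ∂μ := by
        simp_rw [sq, Finset.sum_mul_sum]
        rw [integral_finsetSum _ fun u _ => integrable_finsetSum _ fun u' _ => h4 u u']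
        refine Finset.sum_congr rfl fun u _ => ?_
        rw [integral_finsetSum _ fun u' _ => h4 u u']
        refine Finset.sum_congr rfl fun u' _ => ?_
        rw [← integral_const_mul]
        congr 1; ext z; ring
      rw [h3, sq (∑ u, c u), Finset.sum_mul_sum, Finset.mul_sum, Finset.mul_sum,
        ← Finset.sum_add_distrib]
      simp only [dotProduct, Matrix.mulVec, Matrix.of_apply, hE, star_trivial, Finset.mul_sum,
        ← Finset.sum_add_distrib]
      refine Finset.sum_congr rfl fun u _ => Finset.sum_congr rfl fun u' _ => ?_
      ring
    rw [h2]
    have : 0 ≤ ∫ z, (∑ u, c u * φ (z u)) ^ 2 ∂μ := integral_nonneg fun z => sq_nonneg _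
    positivity

section

variable {V : Type*} {S : V → V → ℝ}

theorem psd_symm (hS : (Matrix.of S).PosSemidef) (u v : V) : S v u = S u v := by
  simpa using hS.isHermitian.apply u v

theorem psd_diag_nonneg (hS : (Matrix.of S).PosSemidef) (u : V) : 0 ≤ S u u :=
  hS.diag_nonneg

theorem psd_sq_le [Fintype V] (hS : (Matrix.of S).PosSemidef) (u v : V) : S u v ^ 2 ≤ S u u * S v v := by
  have h := (hS.submatrix ![u, v]).det_nonneg
  rw [Matrix.det_fin_two] at h
  simp only [Matrix.submatrix_apply, Matrix.of_apply, Matrix.cons_val_zero, Matrix.cons_val_one,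
    psd_symm hS u v] at h
  nlinarith

theorem psd_le_max [Fintype V] (hS : (Matrix.of S).PosSemidef) {M : ℝ} (hM : ∀ u, S u u ≤ M) (u v : V) :
    |S u v| ≤ M := by
  have h1 := psd_sq_le hS u v
  have h0 := psd_diag_nonneg hS u
  have h2 := psd_diag_nonneg hS v
  refine abs_le_of_sq_le_sq (h1.trans ?_) (h0.trans (hM u))
  rw [sq]
  exact mul_le_mul (hM u) (hM v) h2 (h0.trans (hM u))

end

/-! ### Exponentially decaying families -/

/-- The family `f l` decays exponentially in `l`, uniformly in the index. -/
def ExpDecay {ι : Type*} (f : ℕ → ι → ℝ) : Prop :=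
  ∃ C γ : ℝ, 0 ≤ C ∧ 0 < γ ∧ γ < 1 ∧ ∀ l i, |f l i| ≤ C * γ ^ l

namespace ExpDecay

variable {ι : Type*} {f g : ℕ → ι → ℝ}

theorem mono (hf : ExpDecay f) {κ : Type*} {g : ℕ → κ → ℝ} {K : ℝ} (hK : 0 ≤ K)
    (h : ∀ l j, ∃ i, |g l j| ≤ K * |f l i|) : ExpDecay g := by
  obtain ⟨C, γ, hC, h0, h1, hle⟩ := hf
  refine ⟨K * C, γ, by positivity, h0, h1, fun l j => ?_⟩
  obtain ⟨i, hi⟩ := h l j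
  calc |g l j| ≤ K * |f l i| := hi
    _ ≤ K * (C * γ ^ l) := by gcongr; exact hle l i
    _ = K * C * γ ^ l := by ring

theorem add (hf : ExpDecay f) (hg : ExpDecay g) : ExpDecay fun l i => f l i + g l i := by
  obtain ⟨C, γ, hC, h0, h1, hle⟩ := hf
  obtain ⟨C', γ', hC', h0', h1', hle'⟩ := hg
  refine ⟨C + C', max γ γ', by positivity, lt_max_of_lt_left h0, max_lt h1 h1', fun l i => ?_⟩
  calc |f l i + g l i| ≤ |f l i| + |g l i| := abs_add_le _ _
    _ ≤ C * γ ^ l + C' * γ' ^ l := add_le_add (hle l i) (hle' l i)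
    _ ≤ C * max γ γ' ^ l + C' * max γ γ' ^ l := by
      gcongr
      · exact le_max_left _ _
      · exact le_max_right _ _
    _ = (C + C') * max γ γ' ^ l := by ring

theorem zero : ExpDecay fun (_ : ℕ) (_ : ι) => (0 : ℝ) :=
  ⟨0, 1 / 2, le_rfl, by norm_num, by norm_num, fun l i => by simp⟩

theorem natCast_add_one_mul (hf : ExpDecay f) : ExpDecay fun l i => ((l : ℝ) + 1) * f l i := by
  obtain ⟨C, γ, hC, h0, h1, hle⟩ := hf
  -- Half of the decay is spent on the factor `l + 1`: Bernoulli's inequality for `(1 + x)^l =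
  -- s^(-l)` bounds `(l + 1) s^l`, and the other factor `s^l` remains.
  set s := √γ
  have hs0 : 0 < s := Real.sqrt_pos.2 h0
  have hs1 : s < 1 := by
    rw [Real.sqrt_lt' one_pos]; simpa using h1
  have hsq : γ = s * s := (Real.mul_self_sqrt h0.le).symm
  set x := s⁻¹ - 1
  have hx : 0 < x := sub_pos.2 ((one_lt_inv₀ hs0).2 hs1)
  have key : ∀ l : ℕ, ((l : ℝ) + 1) * s ^ l ≤ 1 + x⁻¹ := fun l => by
    have hB : 1 + (l : ℝ) * x ≤ (1 + x) ^ l :=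
      one_add_mul_le_pow (by linarith) l
    have h3 : (1 + x) ^ l * s ^ l = 1 := by
      rw [← mul_pow, show (1 + x) * s = 1 by simp [x, hs0.ne'], one_pow]
    have h4 : ((l : ℝ) + 1) ≤ (1 + x⁻¹) * (1 + l * x) := by
      have : x⁻¹ * x = 1 := inv_mul_cancel₀ hx.ne'
      have h5 : 0 ≤ x⁻¹ := by positivity
      have : (1 + x⁻¹) * (1 + l * x) = 1 + l * x + x⁻¹ + l * (x⁻¹ * x) := by ring
      rw [this, inv_mul_cancel₀ hx.ne']
      have : 0 ≤ (l : ℝ) * x := by positivity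
      linarith
    calc ((l : ℝ) + 1) * s ^ l ≤ (1 + x⁻¹) * (1 + l * x) * s ^ l := by gcongr
      _ ≤ (1 + x⁻¹) * (1 + x) ^ l * s ^ l := by gcongr
      _ = 1 + x⁻¹ := by rw [mul_assoc, h3, mul_one]
  refine ⟨C * (1 + x⁻¹), s, by positivity, hs0, hs1, fun l i => ?_⟩
  rw [abs_mul, abs_of_nonneg (by positivity : (0 : ℝ) ≤ (l : ℝ) + 1)]
  calc ((l : ℝ) + 1) * |f l i| ≤ ((l : ℝ) + 1) * (C * γ ^ l) := by gcongr; exact hle l i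
    _ = C * (((l : ℝ) + 1) * s ^ l) * s ^ l := by rw [hsq, mul_pow]; ring
    _ ≤ C * (1 + x⁻¹) * s ^ l := by gcongr; exact key l

theorem of_eventually {B C γ : ℝ} (h0 : 0 < γ) (h1 : γ < 1) (hB : ∀ l i, |f l i| ≤ B) (l₀ : ℕ)
    (h : ∀ l ≥ l₀, ∀ i, |f l i| ≤ C * γ ^ l) : ExpDecay f := by
  refine ⟨max C 0 + max B 0 / γ ^ l₀, γ, by positivity, h0, h1, fun l i => ?_⟩
  rcases le_or_gt l₀ l with hl | hl
  · refine (h l hl i).trans ?_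
    have : C ≤ max C 0 + max B 0 / γ ^ l₀ := (le_max_left C 0).trans (by simp; positivity)
    gcongr
  · calc |f l i| ≤ max B 0 := (hB l i).trans (le_max_left _ _)
      _ = max B 0 / γ ^ l₀ * γ ^ l₀ := by field_simp
      _ ≤ max B 0 / γ ^ l₀ * γ ^ l := by
        gcongr ?_ * ?_
        exact pow_le_pow_of_le_one h0.le h1.le hl.le
      _ ≤ (max C 0 + max B 0 / γ ^ l₀) * γ ^ l := by gcongr; simp

/-- The exponential decay may be tested on a tail of the sequence. -/
theorem of_shift {B : ℝ} (hB : ∀ l i, |f l i| ≤ B) (l₀ : ℕ)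
    (h : ExpDecay fun l i => f (l₀ + l) i) : ExpDecay f := by
  obtain ⟨C, γ, hC, h0, h1, hle⟩ := h
  refine of_eventually (C := C / γ ^ l₀) h0 h1 hB l₀ fun l hl i => ?_
  obtain ⟨m, rfl⟩ := Nat.exists_eq_add_of_le hl
  refine (hle m i).trans (le_of_eq ?_)
  rw [pow_add]
  field_simp

/-- A common rate for finitely many decaying families. -/
theorem uniform {n : ℕ} {F : ℕ → ℕ → ι → ℝ} (h : ∀ r < n, ExpDecay (F r)) :
    ∃ C γ : ℝ, 0 < C ∧ 0 < γ ∧ γ < 1 ∧ ∀ r < n, ∀ l i, |F r l i| ≤ C * γ ^ l := by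
  have hd : ExpDecay fun l i => ∑ r ∈ Finset.range n, |F r l i| := by
    have : ∀ m ≤ n, ExpDecay fun l i => ∑ r ∈ Finset.range m, |F r l i| := by
      intro m
      induction m with
      | zero => intro _; simpa using zero
      | succ m ih =>
        intro hm
        simp_rw [Finset.sum_range_succ]
        exact (ih (by omega)).add ((h m (by omega)).mono zero_le_one fun l i => ⟨i, by simp⟩)
    exact this _ le_rfl
  obtain ⟨C, γ, hC, h0, h1, hle⟩ := hd
  refine ⟨C + 1, γ, by positivity, h0, h1, fun r hr l i => ?_⟩
  calc |F r l i| ≤ ∑ r ∈ Finset.range n, |F r l i| :=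
        Finset.single_le_sum (f := fun r => |F r l i|) (fun _ _ => abs_nonneg _)
          (Finset.mem_range.2 hr)
    _ ≤ C * γ ^ l := (le_abs_self _).trans (hle l i)
    _ ≤ (C + 1) * γ ^ l := by gcongr; simp

end ExpDecay

/-- A delayed contraction with an exponentially small perturbation decays exponentially. -/
theorem exists_geometric_bound {a : ℕ → ℝ} {k : ℕ} {ρ C β : ℝ} (hk : 0 < k) (hρ0 : 0 ≤ ρ)
    (hρ : ρ < 1) (hβ0 : 0 ≤ β) (hβ : β < 1) (hC : 0 ≤ C)
    (h : ∀ l, a (l + k) ≤ ρ * a l + C * β ^ l) :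
    ∃ K γ : ℝ, 0 ≤ K ∧ 0 < γ ∧ γ < 1 ∧ ∀ l, a l ≤ K * γ ^ l := by
  obtain ⟨γ, hγβ, hγk, hγ1⟩ : ∃ γ : ℝ, max β (1 / 2) < γ ∧ ρ < γ ^ k ∧ γ < 1 := by
    have h1 : ∀ᶠ γ : ℝ in nhdsWithin 1 (Set.Iio 1), ρ < γ ^ k := by
      have : Filter.Tendsto (fun γ : ℝ => γ ^ k) (nhds 1) (nhds (1 ^ k)) :=
        (continuous_pow k).tendsto 1
      rw [one_pow] at this
      exact (this.eventually (lt_mem_nhds hρ)).filter_mono nhdsWithin_le_nhds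
    have h2 : ∀ᶠ γ : ℝ in nhdsWithin 1 (Set.Iio 1), max β (1 / 2) < γ :=
      (lt_mem_nhds (max_lt hβ (by norm_num))).filter_mono nhdsWithin_le_nhds
    obtain ⟨γ, h1, h2, h3⟩ := (h1.and (h2.and self_mem_nhdsWithin)).exists
    exact ⟨γ, h2, h1, h3⟩
  have hγ0 : 0 < γ := lt_of_lt_of_le (by norm_num) ((le_max_right β (1 / 2)).trans hγβ.le)
  have hβγ : β ≤ γ := (le_max_left β _).trans hγβ.le
  -- The sum covers the first `k` terms, and the quotient makes the induction close: `ρ K + C ≤ K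
  -- γ^k`.
  set K := C / (γ ^ k - ρ) + ∑ j ∈ Finset.range k, |a j| / γ ^ j
  have hpos : 0 < γ ^ k - ρ := by linarith
  have hS : 0 ≤ ∑ j ∈ Finset.range k, |a j| / γ ^ j := Finset.sum_nonneg fun j _ => by positivity
  have hKC : C ≤ K * (γ ^ k - ρ) := by
    have : C = C / (γ ^ k - ρ) * (γ ^ k - ρ) := by field_simp
    calc C = C / (γ ^ k - ρ) * (γ ^ k - ρ) := this
      _ ≤ K * (γ ^ k - ρ) := by gcongr; simp [K, hS]
  refine ⟨K, γ, by positivity, hγ0, hγ1, fun l => ?_⟩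
  induction l using Nat.strong_induction_on with
  | _ l ih =>
    rcases lt_or_ge l k with hl | hl
    · have h1 : |a l| / γ ^ l ≤ K := by
        refine (Finset.single_le_sum (f := fun j => |a j| / γ ^ j) (fun j _ => by positivity)
          (Finset.mem_range.2 hl)).trans ?_
        simp [K]; positivity
      rw [div_le_iff₀ (by positivity)] at h1
      exact (le_abs_self _).trans h1
    · obtain ⟨m, rfl⟩ := Nat.exists_eq_add_of_le' hl
      have h1 : β ^ m ≤ γ ^ m := by gcongr
      have h2 : 0 < γ ^ m := by positivity
      calc a (m + k) ≤ ρ * a m + C * β ^ m := h m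
        _ ≤ ρ * (K * γ ^ m) + C * γ ^ m := by gcongr; exact ih m (by omega)
        _ ≤ ρ * (K * γ ^ m) + K * (γ ^ k - ρ) * γ ^ m := by gcongr
        _ = K * γ ^ (m + k) := by rw [pow_add]; ring

/-! ### Averaging matrices -/

section Stochastic

variable {ι : Type*} [Fintype ι] {A : Matrix ι ι ℝ}

/-- A nonnegative matrix with unit row sums. -/
structure IsRowStochastic (A : Matrix ι ι ℝ) : Prop where
  nonneg : ∀ i j, 0 ≤ A i j
  sum_row : ∀ i, ∑ j, A i j = 1

namespace IsRowStochastic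

theorem mulVec_mono (hA : IsRowStochastic A) {x y : ι → ℝ} (h : ∀ i, x i ≤ y i) (i : ι) :
    (A *ᵥ x) i ≤ (A *ᵥ y) i :=
  Finset.sum_le_sum fun j _ => mul_le_mul_of_nonneg_left (h j) (hA.nonneg i j)

theorem mulVec_const (hA : IsRowStochastic A) (c : ℝ) (i : ι) : (A *ᵥ fun _ => c) i = c := by
  simp [Matrix.mulVec, dotProduct, ← Finset.sum_mul, hA.sum_row i]

theorem mulVec_add_const (hA : IsRowStochastic A) (x : ι → ℝ) (c : ℝ) (i : ι) :
    (A *ᵥ fun j => x j + c) i = (A *ᵥ x) i + c := by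
  have : (fun j => x j + c) = x + fun _ => c := rfl
  rw [this, Matrix.mulVec_add, Pi.add_apply, hA.mulVec_const]

theorem mulVec_le (hA : IsRowStochastic A) {x : ι → ℝ} {c : ℝ} (h : ∀ i, x i ≤ c) (i : ι) :
    (A *ᵥ x) i ≤ c := by
  simpa [hA.mulVec_const] using hA.mulVec_mono h i

theorem le_mulVec (hA : IsRowStochastic A) {x : ι → ℝ} {c : ℝ} (h : ∀ i, c ≤ x i) (i : ι) :
    c ≤ (A *ᵥ x) i := by
  simpa [hA.mulVec_const] using hA.mulVec_mono h i

theorem norm_mulVec_le (hA : IsRowStochastic A) (x : ι → ℝ) : ‖A *ᵥ x‖ ≤ ‖x‖ := by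
  rw [pi_norm_le_iff_of_nonneg (norm_nonneg _)]
  intro i
  rw [Real.norm_eq_abs, abs_le]
  exact ⟨hA.le_mulVec (fun j => (abs_le.1 (norm_le_pi_norm x j)).1) i,
    hA.mulVec_le (fun j => (abs_le.1 (norm_le_pi_norm x j)).2) i⟩

/-- An entry bounded below pulls an average away from the upper bound. -/
theorem mulVec_le_sub (hA : IsRowStochastic A) {x : ι → ℝ} {c δ : ℝ} (h : ∀ i, x i ≤ c) (i j : ι)
    (hδ : δ ≤ A i j) : (A *ᵥ x) i ≤ c - δ * (c - x j) := by
  have h1 : (A *ᵥ fun j => c - x j) i = c - (A *ᵥ x) i := by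
    have : (fun j => c - x j) = (fun _ => c) - x := rfl
    rw [this, Matrix.mulVec_sub, Pi.sub_apply, hA.mulVec_const]
  have h2 : A i j * (c - x j) ≤ (A *ᵥ fun j => c - x j) i :=
    Finset.single_le_sum (f := fun j => A i j * (c - x j))
      (fun k _ => mul_nonneg (hA.nonneg i k) (sub_nonneg.2 (h k))) (Finset.mem_univ j)
  have h3 : δ * (c - x j) ≤ A i j * (c - x j) :=
    mul_le_mul_of_nonneg_right hδ (sub_nonneg.2 (h j))
  linarith

variable [DecidableEq ι]

theorem pow (hA : IsRowStochastic A) (k : ℕ) : IsRowStochastic (A ^ k) := by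
  refine ⟨Matrix.pow_apply_nonneg hA.nonneg k, ?_⟩
  induction k with
  | zero => intro i; simp [Matrix.one_apply]
  | succ k ih =>
    intro i
    simp_rw [pow_succ, Matrix.mul_apply]
    rw [Finset.sum_comm]
    simp_rw [← Finset.mul_sum, hA.sum_row, mul_one, ih]

/-- A perturbed subharmonic sequence is controlled by the powers of the averaging matrix. -/
theorem le_pow_mulVec_add (hA : IsRowStochastic A) {x : ℕ → ι → ℝ} {e : ℝ}
    (h : ∀ l i, x (l + 1) i ≤ (A *ᵥ x l) i + e) (k : ℕ) (i : ι) :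
    x k i ≤ ((A ^ k) *ᵥ x 0) i + k * e := by
  induction k generalizing i with
  | zero => simp
  | succ k ih =>
    calc x (k + 1) i ≤ (A *ᵥ x k) i + e := h k i
      _ ≤ (A *ᵥ fun j => ((A ^ k) *ᵥ x 0) j + k * e) i + e := by
        gcongr; exact hA.mulVec_mono ih i
      _ = ((A ^ (k + 1)) *ᵥ x 0) i + (k + 1 : ℕ) * e := by
        rw [hA.mulVec_add_const, Matrix.mulVec_mulVec, ← pow_succ']
        push_cast; ring

/-- Doeblin's argument: subtracting `δ π j` from every entry `(i, j)` of `A ^ k` does not change its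
action on vectors of zero `π`-mean, and leaves a nonnegative matrix with row sums `1 - δ`. -/
theorem norm_pow_mulVec_le (hA : IsRowStochastic A) {π : ι → ℝ}
    (hπ : IsStationaryDistribution A π) {k : ℕ} {δ : ℝ} (hδ0 : 0 ≤ δ)
    (hδ : ∀ i j, δ ≤ (A ^ k) i j) {y : ι → ℝ} (hy : π ⬝ᵥ y = 0) :
    ‖(A ^ k) *ᵥ y‖ ≤ (1 - δ) * ‖y‖ := by
  obtain ⟨h0, h1, -⟩ := hπ
  have hB : ∀ i j, 0 ≤ (A ^ k) i j - δ * π j := fun i j => by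
    have : π j ≤ 1 := h1 ▸ Finset.single_le_sum (fun j _ => h0 j) (Finset.mem_univ j)
    nlinarith [hδ i j, h0 j]
  have hBs : ∀ i, ∑ j, ((A ^ k) i j - δ * π j) = 1 - δ := fun i => by
    rw [Finset.sum_sub_distrib, ← Finset.mul_sum, h1, (hA.pow k).sum_row, mul_one]
  rcases isEmpty_or_nonempty ι with hι | ⟨⟨i₀⟩⟩
  · simp at h1
  have h1δ : 0 ≤ 1 - δ := hBs i₀ ▸ Finset.sum_nonneg fun j _ => hB i₀ j
  rw [pi_norm_le_iff_of_nonneg (by positivity)]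
  intro i
  have : ((A ^ k) *ᵥ y) i = ∑ j, ((A ^ k) i j - δ * π j) * y j := by
    simp_rw [sub_mul, Finset.sum_sub_distrib, mul_assoc, ← Finset.mul_sum]
    have h2 : ∑ j, π j * y j = 0 := hy
    rw [h2]; simp [Matrix.mulVec, dotProduct]
  rw [this]
  calc ‖∑ j, ((A ^ k) i j - δ * π j) * y j‖ ≤ ∑ j, ‖((A ^ k) i j - δ * π j) * y j‖ :=
        norm_sum_le _ _
    _ ≤ ∑ j, ((A ^ k) i j - δ * π j) * ‖y‖ := by
      refine Finset.sum_le_sum fun j _ => ?_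
      rw [norm_mul, Real.norm_of_nonneg (hB i j)]
      exact mul_le_mul_of_nonneg_left (norm_le_pi_norm y j) (hB i j)
    _ = (1 - δ) * ‖y‖ := by rw [← Finset.sum_mul, hBs]

end IsRowStochastic

/-- A mixing Markov averaging with an exponentially decaying forcing converges exponentially to a
constant vector. -/
theorem exists_limit_of_perturbed_average [DecidableEq ι] (hA : IsRowStochastic A) {π : ι → ℝ}
    (hπ : IsStationaryDistribution A π) {k : ℕ} (hk : 0 < k) {δ : ℝ} (hδ0 : 0 < δ)
    (hδ : ∀ i j, δ ≤ (A ^ k) i j) {x e : ℕ → ι → ℝ} (hx : ∀ l, x (l + 1) = A *ᵥ x l + e l)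
    (he : ExpDecay e) : ∃ κ : ℝ, ExpDecay fun l i => x l i - κ := by
  obtain ⟨C, γ, hC, hγ0, hγ1, hle⟩ := he
  have hnorm : ∀ l, ‖e l‖ ≤ C * γ ^ l := fun l => by
    rw [pi_norm_le_iff_of_nonneg (by positivity)]; exact hle l
  have hdot : ∀ y : ι → ℝ, |π ⬝ᵥ y| ≤ ‖y‖ := fun y => by
    calc |π ⬝ᵥ y| ≤ ∑ i, |π i * y i| := Finset.abs_sum_le_sum_abs _ _
      _ ≤ ∑ i, π i * ‖y‖ := by
        refine Finset.sum_le_sum fun i _ => ?_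
        rw [abs_mul, abs_of_nonneg (hπ.1 i)]
        exact mul_le_mul_of_nonneg_left (norm_le_pi_norm y i) (hπ.1 i)
      _ = ‖y‖ := by rw [← Finset.sum_mul, hπ.2.1, one_mul]
  -- The sequence is split into its `π`-mean `m`, which moves only by the summable forcing, and the
  -- centred part `y`, which `A ^ k` contracts.
  set m : ℕ → ℝ := fun l => π ⬝ᵥ x l
  have hm : ∀ l, m (l + 1) = m l + π ⬝ᵥ e l := fun l => by
    simp only [m, hx, dotProduct_add, Matrix.dotProduct_mulVec, hπ.2.2]
  have hdist : ∀ l, dist (m l) (m (l + 1)) ≤ C * γ ^ l := fun l => by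
    rw [hm, dist_comm, Real.dist_eq, add_sub_cancel_left]
    exact (hdot _).trans (hnorm l)
  obtain ⟨κ, hκ⟩ := cauchySeq_tendsto_of_complete (cauchySeq_of_le_geometric γ C hγ1 hdist)
  have hmκ := dist_le_of_le_geometric_of_tendsto γ C hγ1 hdist hκ
  set y : ℕ → ι → ℝ := fun l => x l - fun _ => m l
  set f : ℕ → ι → ℝ := fun l => e l - fun _ => π ⬝ᵥ e l
  have hfn : ∀ l, ‖f l‖ ≤ 2 * C * γ ^ l := fun l => by
    rw [pi_norm_le_iff_of_nonneg (by positivity)]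
    intro i
    calc ‖f l i‖ ≤ ‖e l i‖ + ‖π ⬝ᵥ e l‖ := norm_sub_le _ _
      _ ≤ C * γ ^ l + C * γ ^ l := add_le_add (hle l i) ((hdot _).trans (hnorm l))
      _ = _ := by ring
  have hconst : ∀ c : ℝ, (A *ᵥ fun _ => c) = fun _ => c := fun c =>
    funext (hA.mulVec_const c)
  have hy : ∀ l, y (l + 1) = A *ᵥ y l + f l := fun l => by
    simp only [y, f, Matrix.mulVec_sub, hconst, hx, hm]
    ext i; simp; ring
  have hπy : ∀ l, π ⬝ᵥ y l = 0 := fun l => by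
    simp only [y, dotProduct_sub, m]
    simp [dotProduct, ← Finset.sum_mul, hπ.2.1]
  have hiter : ∀ l j, ‖y (l + j) - (A ^ j) *ᵥ y l‖ ≤ j * (2 * C * γ ^ l) := by
    intro l j
    induction j with
    | zero => simp
    | succ j ih =>
      have h1 : y (l + (j + 1)) - (A ^ (j + 1)) *ᵥ y l =
          A *ᵥ (y (l + j) - (A ^ j) *ᵥ y l) + f (l + j) := by
        rw [← add_assoc, hy, Matrix.mulVec_sub A (y (l + j)), Matrix.mulVec_mulVec, ← pow_succ']
        abel
      have h2 : γ ^ (l + j) ≤ γ ^ l := pow_le_pow_of_le_one hγ0.le hγ1.le (by omega)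
      calc _ ≤ ‖A *ᵥ (y (l + j) - (A ^ j) *ᵥ y l)‖ + ‖f (l + j)‖ := by
            rw [h1]; exact norm_add_le _ _
        _ ≤ j * (2 * C * γ ^ l) + 2 * C * γ ^ l := by
          refine add_le_add ((hA.norm_mulVec_le _).trans ih) ((hfn _).trans ?_)
          gcongr
        _ = _ := by push_cast; ring
  have hrec : ∀ l, ‖y (l + k)‖ ≤ (1 - δ) * ‖y l‖ + k * (2 * C) * γ ^ l := fun l => by
    have h1 := hA.norm_pow_mulVec_le hπ hδ0.le hδ (hπy l)
    have h2 : ‖y (l + k)‖ ≤ ‖(A ^ k) *ᵥ y l‖ + ‖y (l + k) - (A ^ k) *ᵥ y l‖ := by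
      simpa using norm_add_le ((A ^ k) *ᵥ y l) (y (l + k) - (A ^ k) *ᵥ y l)
    have h3 := hiter l k
    linarith
  have h1δ : 0 ≤ 1 - δ := by
    obtain ⟨i₀⟩ : Nonempty ι := by
      by_contra hne
      have := not_nonempty_iff.1 hne
      simpa using hπ.2.1
    have := Finset.single_le_sum (f := fun j => (A ^ k) i₀ j)
      (fun j _ => (hA.pow k).nonneg i₀ j) (Finset.mem_univ i₀)
    rw [(hA.pow k).sum_row] at this
    linarith [hδ i₀ i₀]
  obtain ⟨K, β, hK, hβ0, hβ1, hgeo⟩ := exists_geometric_bound (a := fun l => ‖y l‖) hk h1δ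
    (by linarith) hγ0.le hγ1 (by positivity) hrec
  refine ⟨κ, ?_⟩
  have d1 : ExpDecay y := ⟨K, β, hK, hβ0, hβ1, fun l i => (norm_le_pi_norm (y l) i).trans (hgeo l)⟩
  have d2 : ExpDecay fun l (_ : ι) => m l - κ := by
    refine ⟨C / (1 - γ), γ, div_nonneg hC (by linarith), hγ0, hγ1, fun l i => ?_⟩
    rw [← Real.dist_eq]
    exact (hmκ l).trans (le_of_eq (by ring))
  convert d1.add d2 using 3
  simp [y]

end Stochastic

/-! ### Mixing of the aggregation operator -/

/-- A positive diagonal lets any path be prolonged by waiting at its endpoint. Hence the sum of the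
connecting times over all pairs is an exponent that serves every pair at once. -/
theorem exists_pow_ge_of_irreducible {ι : Type*} [Fintype ι] [DecidableEq ι] [Nonempty ι]
    {A : Matrix ι ι ℝ} (hA : A.IsIrreducible) (hdiag : ∀ i, 0 < A i i) :
    ∃ k : ℕ, 0 < k ∧ ∃ δ : ℝ, 0 < δ ∧ ∀ i j, δ ≤ (A ^ k) i j := by
  have hstep : ∀ (m n : ℕ) (i j : ι), 0 < (A ^ m) i j → 0 < (A ^ (m + n)) i j := by
    intro m n i j h
    induction n with
    | zero => simpa
    | succ n ih =>
      rw [← add_assoc, pow_succ, Matrix.mul_apply]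
      exact (mul_pos ih (hdiag j)).trans_le (Finset.single_le_sum
        (f := fun l => (A ^ (m + n)) i l * A l j)
        (fun l _ => mul_nonneg (Matrix.pow_apply_nonneg hA.nonneg _ i l) (hA.nonneg l j))
        (Finset.mem_univ j))
  choose k hk0 hk using (Matrix.isIrreducible_iff_exists_pow_pos hA.nonneg).1 hA
  have hall : ∀ i j, 0 < (A ^ (∑ p : ι × ι, k p.1 p.2)) i j := by
    intro i j
    have hle : k i j ≤ ∑ p : ι × ι, k p.1 p.2 :=
      Finset.single_le_sum (f := fun p : ι × ι => k p.1 p.2) (fun _ _ => Nat.zero_le _)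
        (Finset.mem_univ (i, j))
    obtain ⟨n, hn⟩ := Nat.exists_eq_add_of_le hle
    rw [hn]
    exact hstep _ _ i j (hk i j)
  obtain ⟨i₀⟩ := ‹Nonempty ι›
  refine ⟨∑ p : ι × ι, k p.1 p.2, ?_, ?_⟩
  · exact (hk0 i₀ i₀).trans_le (Finset.single_le_sum (f := fun p : ι × ι => k p.1 p.2)
      (fun _ _ => Nat.zero_le _) (Finset.mem_univ (i₀, i₀)))
  · have : Nonempty (ι × ι) := ⟨(i₀, i₀)⟩
    obtain ⟨p, hp⟩ := Finite.exists_min fun p : ι × ι => (A ^ (∑ p : ι × ι, k p.1 p.2)) p.1 p.2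
    exact ⟨_, hall p.1 p.2, fun i j => hp (i, j)⟩

section Graph

variable {V : Type*} [Fintype V] [DecidableEq V] (G : SimpleGraph V) [DecidableRel G.Adj]

theorem isRowStochastic_avgMatrix : IsRowStochastic (avgMatrix G) := by
  refine ⟨fun u v => ?_, fun u => ?_⟩
  · simp only [avgMatrix, Matrix.of_apply]
    split_ifs <;> positivity
  · have h : ∀ v, avgMatrix G u v =
        if v ∈ insert u (G.neighborFinset u) then 1 / ((G.degree u : ℝ) + 1) else 0 := by
      intro v
      simp [avgMatrix]
    simp_rw [h]
    rw [Finset.sum_ite_mem, Finset.univ_inter, Finset.sum_const,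
      Finset.card_insert_of_notMem (by simp), SimpleGraph.card_neighborFinset_eq_degree]
    rw [nsmul_eq_mul]
    push_cast
    field_simp

theorem isRowStochastic_aggMatrix : IsRowStochastic (aggMatrix G) := by
  have h := isRowStochastic_avgMatrix G
  refine ⟨fun p q => mul_nonneg (h.nonneg _ _) (h.nonneg _ _), fun p => ?_⟩
  simp only [aggMatrix, Matrix.kroneckerMap_apply, Fintype.sum_prod_type, ← Finset.mul_sum,
    h.sum_row, mul_one]

theorem aggMatrix_diag_pos (p : V × V) : 0 < aggMatrix G p p := by
  simp only [aggMatrix, Matrix.kroneckerMap_apply, avgMatrix, Matrix.of_apply]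
  simp only [true_or, if_true]
  positivity

theorem aggregate_eq_sum (S : V → V → ℝ) (u u' : V) :
    aggregate G S u u' = ∑ v, ∑ v', avgMatrix G u v * avgMatrix G u' v' * S v v' := by
  rw [← aggMatrix_mulVec G S (u, u')]
  simp [Matrix.mulVec, dotProduct, aggMatrix, Matrix.kroneckerMap_apply, Fintype.sum_prod_type]

theorem posSemidef_aggregate {S : V → V → ℝ} (hS : (Matrix.of S).PosSemidef) :
    (Matrix.of (aggregate G S)).PosSemidef := by
  have : Matrix.of (aggregate G S) = avgMatrix G * Matrix.of S * (avgMatrix G)ᴴ := by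
    ext u u'
    simp only [Matrix.of_apply, aggregate_eq_sum, Matrix.mul_apply, Matrix.conjTranspose_apply,
      star_trivial, Finset.sum_mul]
    rw [Finset.sum_comm]
    refine Finset.sum_congr rfl fun v' _ => Finset.sum_congr rfl fun v _ => ?_
    ring
  rw [this]
  exact hS.mul_mul_conjTranspose_same _

variable {G} {d : ℕ} {h : V → EuclideanSpace ℝ (Fin d)} {φ : ℝ → ℝ} {σw σb : ℝ} {R : ℕ}

@[simp] theorem gpk_zero_zero (u u' : V) :
    gpk G h φ σw σb R 0 0 u u' = inner ℝ (h u) (h u') := by simp only [gpk]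

theorem gpk_succ_zero (l : ℕ) :
    gpk G h φ σw σb R (l + 1) 0 = aggregate G (gpk G h φ σw σb R l R) := by simp only [gpk]

theorem gpk_succ (l r : ℕ) :
    gpk G h φ σw σb R l (r + 1) = covStep φ σw σb (gpk G h φ σw σb R l r) := by
  cases l <;> simp only [gpk]

theorem gntk_succ_zero (l : ℕ) :
    gntk G h φ σw σb R (l + 1) 0 = aggregate G (gntk G h φ σw σb R l R) := by simp only [gntk]

theorem gntk_succ (l r : ℕ) (u u' : V) :
    gntk G h φ σw σb R l (r + 1) u u' = gntk G h φ σw σb R l r u u' *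
      covDotStep φ σw (gpk G h φ σw σb R l r) u u' + gpk G h φ σw σb R l (r + 1) u u' := by
  cases l <;> simp only [gntk]

theorem posSemidef_gpk (hφ : Measurable φ) (hle : ∀ x, |φ x| ≤ |x|) (l r : ℕ) :
    (Matrix.of (gpk G h φ σw σb R l r)).PosSemidef := by
  have hr : ∀ l, (Matrix.of (gpk G h φ σw σb R l 0)).PosSemidef →
      ∀ r, (Matrix.of (gpk G h φ σw σb R l r)).PosSemidef := by
    intro l h0 r
    induction r with
    | zero => exact h0
    | succ r ih => rw [gpk_succ]; exact posSemidef_covStep hφ hle σw σb ih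
  have h0 : ∀ l, (Matrix.of (gpk G h φ σw σb R l 0)).PosSemidef := by
    intro l
    induction l with
    | zero =>
      have : Matrix.of (gpk G h φ σw σb R 0 0) = Matrix.gram ℝ h := by
        ext u u'
        simp [Matrix.gram]
      rw [this]
      exact Matrix.posSemidef_gram _ _
    | succ l ih => rw [gpk_succ_zero]; exact posSemidef_aggregate G (hr l ih R)
  exact hr l (h0 l) r

end Graph

/-! ### Linear growth of the tangent kernel -/

/-- A mixing average interlaced with nearly neutral affine maps grows linearly, up to an
exponentially small error. -/
theorem exists_linear_growth {ι : Type*} [Fintype ι] [DecidableEq ι] {A : Matrix ι ι ℝ}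
    (hA : IsRowStochastic A) {π : ι → ℝ} (hπ : IsStationaryDistribution A π) {k : ℕ} (hk : 0 < k)
    {δ : ℝ} (hδ0 : 0 < δ) (hδ : ∀ i j, δ ≤ (A ^ k) i j) {R : ℕ} {T D S : ℕ → ℕ → ι → ℝ} {c : ℝ}
    (hT0 : ∀ l, T (l + 1) 0 = A *ᵥ T l R)
    (hT : ∀ l r i, T l (r + 1) i = T l r i * D l r i + S l r i)
    (hD : ∀ r < R, ExpDecay fun l i => D l r i - 1)
    (hS : ∀ r < R, ExpDecay fun l i => S l r i - c) :
    ∃ κ : ℝ, ∀ r ≤ R, ExpDecay fun l i => T l r i - (R * l * c + κ + r * c) := by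
  obtain ⟨C, γ, hC, hγ0, hγ1, hCle⟩ := ExpDecay.uniform hD
  obtain ⟨C', γ', hC', hγ0', hγ1', hCle'⟩ := ExpDecay.uniform hS
  set B := |c| + C'
  have hB : 0 ≤ B := by positivity
  have hSB : ∀ l, ∀ r < R, ∀ i, |S l r i| ≤ B := fun l r hr i => by
    have h1 : |S l r i| ≤ |c| + |S l r i - c| := by
      simpa using abs_add_le c (S l r i - c)
    have h2 : C' * γ' ^ l ≤ C' := mul_le_of_le_one_right hC'.le (pow_le_one₀ hγ0'.le hγ1'.le)
    linarith [hCle' r hr l i]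
  -- The exponential form turns products of these factors over all layers into the exponential of a
  -- geometric series, which stays bounded.
  have hDB : ∀ l, ∀ r < R, ∀ i, |D l r i| ≤ Real.exp (C * γ ^ l) := fun l r hr i => by
    have h1 : |D l r i| ≤ 1 + |D l r i - 1| := by
      simpa using abs_add_le 1 (D l r i - 1)
    have h2 := Real.add_one_le_exp (C * γ ^ l)
    linarith [hCle r hr l i]
  have hrow : ∀ l, ∀ r ≤ R, ‖T l r‖ ≤ Real.exp (r * (C * γ ^ l)) * (‖T l 0‖ + r * B) := by
    intro l r
    induction r with
    | zero => intro _; simp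
    | succ r ih =>
      intro hr
      rw [pi_norm_le_iff_of_nonneg (by positivity)]
      intro i
      have h1 : |T l r i| ≤ Real.exp (r * (C * γ ^ l)) * (‖T l 0‖ + r * B) :=
        (norm_le_pi_norm (T l r) i).trans (ih (by omega))
      have h2 : 1 ≤ Real.exp ((r + 1 : ℕ) * (C * γ ^ l)) := Real.one_le_exp (by positivity)
      calc ‖T l (r + 1) i‖ ≤ |T l r i| * |D l r i| + |S l r i| := by
            rw [hT, Real.norm_eq_abs, ← abs_mul]; exact abs_add_le _ _
        _ ≤ Real.exp (r * (C * γ ^ l)) * (‖T l 0‖ + r * B) * Real.exp (C * γ ^ l) + B := by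
          gcongr
          · exact hDB l r (by omega) i
          · exact hSB l r (by omega) i
        _ = Real.exp ((r + 1 : ℕ) * (C * γ ^ l)) * (‖T l 0‖ + r * B) + B := by
          rw [mul_right_comm, ← Real.exp_add]; push_cast; ring_nf
        _ ≤ Real.exp ((r + 1 : ℕ) * (C * γ ^ l)) * (‖T l 0‖ + r * B) +
            Real.exp ((r + 1 : ℕ) * (C * γ ^ l)) * B := by
          gcongr; exact le_mul_of_one_le_left hB h2
        _ = _ := by push_cast; ring
  have hcol : ∀ l, ‖T l 0‖ ≤ Real.exp (R * C * ∑ j ∈ Finset.range l, γ ^ j) *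
      (‖T 0 0‖ + l * (R * B)) := by
    intro l
    induction l with
    | zero => simp
    | succ l ih =>
      have h2 : 1 ≤ Real.exp (R * C * ∑ j ∈ Finset.range l, γ ^ j) :=
        Real.one_le_exp (by positivity)
      calc ‖T (l + 1) 0‖ ≤ ‖T l R‖ := by rw [hT0]; exact hA.norm_mulVec_le _
        _ ≤ Real.exp (R * (C * γ ^ l)) * (‖T l 0‖ + R * B) := hrow l R le_rfl
        _ ≤ Real.exp (R * (C * γ ^ l)) * (Real.exp (R * C * ∑ j ∈ Finset.range l, γ ^ j) *
            (‖T 0 0‖ + l * (R * B)) + Real.exp (R * C * ∑ j ∈ Finset.range l, γ ^ j) * (R * B)) := by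
          exact mul_le_mul_of_nonneg_left (add_le_add ih (le_mul_of_one_le_left (by positivity) h2))
            (by positivity)
        _ = _ := by
          rw [Finset.sum_range_succ, mul_add (R * C : ℝ), Real.exp_add]
          push_cast; ring_nf
  set E := Real.exp (R * C * (1 - γ)⁻¹)
  have hE : 1 ≤ E := Real.one_le_exp (by have : 0 < 1 - γ := by linarith
                                         positivity)
  -- The a priori linear bound: multiplication by `D` costs a bounded factor in total, and each
  -- layer adds at most `B`.
  have hgrow : ∀ l, ∀ r ≤ R, ∀ i, |T l r i| ≤
      Real.exp (R * C) * E * (‖T 0 0‖ + R * B) * (l + 1) := by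
    intro l r hr i
    have hrR : (r : ℝ) ≤ R := by exact_mod_cast hr
    have h1 : Real.exp (r * (C * γ ^ l)) ≤ Real.exp (R * C) := by
      apply Real.exp_le_exp.2
      have : C * γ ^ l ≤ C := mul_le_of_le_one_right hC.le (pow_le_one₀ hγ0.le hγ1.le)
      gcongr
    have h2 : ‖T l 0‖ ≤ E * (‖T 0 0‖ + l * (R * B)) := by
      refine (hcol l).trans ?_
      gcongr
      exact Real.exp_le_exp.2 (by
        gcongr
        exact (Summable.sum_le_tsum _ (fun j _ => by positivity)
          (summable_geometric_of_lt_one hγ0.le hγ1)).trans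
          (tsum_geometric_of_lt_one hγ0.le hγ1).le)
    calc |T l r i| ≤ ‖T l r‖ := norm_le_pi_norm (T l r) i
      _ ≤ Real.exp (r * (C * γ ^ l)) * (‖T l 0‖ + r * B) := hrow l r hr
      _ ≤ Real.exp (R * C) * (E * (‖T 0 0‖ + l * (R * B)) + E * (R * B)) := by
        refine mul_le_mul h1 (add_le_add h2 ?_) (by positivity) (by positivity)
        calc r * B ≤ R * B := by gcongr
          _ ≤ E * (R * B) := le_mul_of_one_le_left (by positivity) hE
      _ = Real.exp (R * C) * E * (‖T 0 0‖ + R * B * (l + 1)) := by ring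
      _ ≤ Real.exp (R * C) * E * (‖T 0 0‖ * (l + 1) + R * B * (l + 1)) := by
        gcongr
        exact le_mul_of_one_le_right (norm_nonneg _) (by simp)
      _ = _ := by ring
  set K := Real.exp (R * C) * E * (‖T 0 0‖ + R * B)
  have hK : 0 ≤ K := by positivity
  -- Within a block the error comes from `T (D - 1)`, linear growth times exponential decay, and
  -- from `S - c`.
  have herr : ∀ r ≤ R, ExpDecay fun l i => T l r i - (T l 0 i + r * c) := by
    intro r
    induction r with
    | zero => intro _; simpa using ExpDecay.zero
    | succ r ih =>
      intro hr
      have d1 : ExpDecay fun l i => T l r i * (D l r i - 1) :=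
        (hD r (by omega)).natCast_add_one_mul.mono hK fun l i => ⟨i, by
          rw [abs_mul, abs_mul, abs_of_nonneg (by positivity : (0 : ℝ) ≤ (l : ℝ) + 1), ← mul_assoc]
          gcongr
          exact hgrow l r (by omega) i⟩
      convert (ih (by omega)).add (d1.add (hS r (by omega))) using 3
      rw [hT]
      push_cast
      ring
  -- Each block adds `R c`; once this drift is removed, the start-of-block values form a perturbed
  -- Markov average.
  obtain ⟨κ, hκ⟩ := exists_limit_of_perturbed_average hA hπ hk hδ0 hδ
    (x := fun l i => T l 0 i - R * l * c)
    (e := fun l => A *ᵥ fun i => T l R i - (T l 0 i + R * c)) (fun l => by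
      ext i
      have h1 : (fun i => T l R i - (T l 0 i + R * c)) =
          T l R - fun i => T l 0 i + R * c := rfl
      have h2 : (fun i => T l 0 i - R * l * c) = fun i => T l 0 i + -(R * l * c) := by
        ext; ring
      rw [Pi.add_apply, hT0, h1, h2, Matrix.mulVec_sub, Pi.sub_apply, hA.mulVec_add_const,
        hA.mulVec_add_const]
      push_cast
      ring) (by
      obtain ⟨C₁, γ₁, h1, h2, h3, h4⟩ := herr R le_rfl
      refine ⟨C₁, γ₁, h1, h2, h3, fun l i => ?_⟩
      refine (norm_le_pi_norm (A *ᵥ fun i => T l R i - (T l 0 i + R * c)) i).trans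
        ((hA.norm_mulVec_le _).trans ?_)
      rw [pi_norm_le_iff_of_nonneg (by positivity)]
      exact h4 l)
  refine ⟨κ, fun r hr => ?_⟩
  convert (herr r hr).add hκ using 3
  ring

/-- If the covariances converge exponentially to a constant `c` and the derivative covariances to
`1`, then the tangent kernel grows linearly with an exponentially small error. -/
theorem gntk_linear_growth {V : Type*} [Fintype V] [DecidableEq V] {G : SimpleGraph V}
    [DecidableRel G.Adj] {d : ℕ} {h : V → EuclideanSpace ℝ (Fin d)} {R : ℕ} {φ : ℝ → ℝ}
    {σw σb : ℝ} (hirr : (aggMatrix G).IsIrreducible) {π : V × V → ℝ}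
    (hπ : IsStationaryDistribution (aggMatrix G) π) {c : ℝ}
    (hdot : ∀ r < R, ExpDecay fun l (p : V × V) =>
      covDotStep φ σw (gpk G h φ σw σb R l r) p.1 p.2 - 1)
    (hcov : ∀ r < R, ExpDecay fun l (p : V × V) => gpk G h φ σw σb R l (r + 1) p.1 p.2 - c) :
    ∃ κ : ℝ, ∀ r ≤ R, ExpDecay fun l (p : V × V) =>
      gntk G h φ σw σb R l r p.1 p.2 - (R * l * c + κ + r * c) := by
  have : Nonempty (V × V) := by
    by_contra hne
    have := not_nonempty_iff.1 hne
    simpa using hπ.2.1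
  obtain ⟨k, hk, δ, hδ0, hδ⟩ := exists_pow_ge_of_irreducible hirr (aggMatrix_diag_pos G)
  refine exists_linear_growth (isRowStochastic_aggMatrix G) hπ hk hδ0 hδ
    (T := fun l r p => gntk G h φ σw σb R l r p.1 p.2)
    (D := fun l r p => covDotStep φ σw (gpk G h φ σw σb R l r) p.1 p.2)
    (S := fun l r p => gpk G h φ σw σb R l (r + 1) p.1 p.2) (fun l => ?_)
    (fun l r p => gntk_succ l r p.1 p.2) hdot hcov
  ext p
  rw [aggMatrix_mulVec, gntk_succ_zero]

/-! ### Moments and symmetry of the standard Gaussian -/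

theorem integrable_sq_gaussian : Integrable (fun x : ℝ => x ^ 2) (gaussianReal 0 1) := by
  have h : MemLp (id : ℝ → ℝ) 2 (gaussianReal 0 1) := IsGaussian.memLp_two_id
  simpa using h.integrable_sq

theorem integral_sq_gaussian : ∫ x : ℝ, x ^ 2 ∂(gaussianReal 0 1) = 1 := by
  have h := variance_fun_id_gaussianReal (μ := 0) (v := 1)
  rw [variance_eq_integral (by fun_prop)] at h
  simpa using h

theorem measurePreserving_neg_gaussian :
    MeasurePreserving (fun x : ℝ => -x) (gaussianReal 0 1) (gaussianReal 0 1) :=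
  ⟨measurable_neg, by simpa using gaussianReal_map_neg (μ := 0) (v := 1)⟩

theorem integral_neg_gaussian (f : ℝ → ℝ) :
    ∫ x, f (-x) ∂(gaussianReal 0 1) = ∫ x, f x ∂(gaussianReal 0 1) :=
  measurePreserving_neg_gaussian.integral_comp (MeasurableEquiv.neg ℝ).measurableEmbedding f

/-- The law of a pair of independent standard normal variables. -/
noncomputable abbrev gauss2 : Measure (ℝ × ℝ) := (gaussianReal 0 1).prod (gaussianReal 0 1)

theorem integral_neg_gauss2 (f : ℝ × ℝ → ℝ) :
    ∫ w, f (-w.1, -w.2) ∂gauss2 = ∫ w, f w ∂gauss2 :=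
  (measurePreserving_neg_gaussian.prod measurePreserving_neg_gaussian).integral_comp
    ((MeasurableEquiv.neg ℝ).prodCongr (MeasurableEquiv.neg ℝ)).measurableEmbedding f

theorem integral_neg_snd_gauss2 (f : ℝ × ℝ → ℝ) :
    ∫ w, f (w.1, -w.2) ∂gauss2 = ∫ w, f w ∂gauss2 :=
  ((MeasurePreserving.id _).prod measurePreserving_neg_gaussian).integral_comp
    ((MeasurableEquiv.refl ℝ).prodCongr (MeasurableEquiv.neg ℝ)).measurableEmbedding f

theorem memLp_fst_gauss2 : MemLp (fun w : ℝ × ℝ => w.1) 2 gauss2 :=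
  (IsGaussian.memLp_two_id (μ := gaussianReal 0 1)).comp_measurePreserving measurePreserving_fst

theorem memLp_snd_gauss2 : MemLp (fun w : ℝ × ℝ => w.2) 2 gauss2 :=
  (IsGaussian.memLp_two_id (μ := gaussianReal 0 1)).comp_measurePreserving measurePreserving_snd

theorem memLp_linear_gauss2 (p q : ℝ) : MemLp (fun w : ℝ × ℝ => p * w.1 + q * w.2) 2 gauss2 :=
  (memLp_fst_gauss2.const_mul p).add (memLp_snd_gauss2.const_mul q)

theorem integral_linear_mul_linear (p q r s : ℝ) :
    ∫ w, (p * w.1 + q * w.2) * (r * w.1 + s * w.2) ∂gauss2 = p * r + q * s := by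
  have i1 : Integrable (fun w : ℝ × ℝ => w.1 * w.1) gauss2 :=
    memLp_fst_gauss2.integrable_mul memLp_fst_gauss2
  have i2 : Integrable (fun w : ℝ × ℝ => w.1 * w.2) gauss2 :=
    memLp_fst_gauss2.integrable_mul memLp_snd_gauss2
  have i3 : Integrable (fun w : ℝ × ℝ => w.2 * w.2) gauss2 :=
    memLp_snd_gauss2.integrable_mul memLp_snd_gauss2
  have e1 : ∫ w : ℝ × ℝ, w.1 * w.1 ∂gauss2 = 1 := by
    rw [integral_fst_gaussian_prod (fun x => x * x), ← integral_sq_gaussian]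
    simp [sq]
  have e2 : ∫ w : ℝ × ℝ, w.1 * w.2 ∂gauss2 = 0 := by
    rw [integral_prod_mul (fun x : ℝ => x) (fun x : ℝ => x)]; simp
  have e3 : ∫ w : ℝ × ℝ, w.2 * w.2 ∂gauss2 = 1 := by
    rw [integral_fun_snd (fun x : ℝ => x * x), ← integral_sq_gaussian]
    simp [sq]
  have : ∀ w : ℝ × ℝ, (p * w.1 + q * w.2) * (r * w.1 + s * w.2) =
      p * r * (w.1 * w.1) + ((p * s + q * r) * (w.1 * w.2) + q * s * (w.2 * w.2)) := by
    intro w; ring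
  simp_rw [this]
  have i4 : Integrable (fun w : ℝ × ℝ => (p * s + q * r) * (w.1 * w.2) + q * s * (w.2 * w.2))
      gauss2 := (i2.const_mul _).add (i3.const_mul _)
  rw [integral_add (i1.const_mul _) i4,
    integral_add (i2.const_mul _) (i3.const_mul _)]
  simp only [integral_const_mul, e1, e2, e3]
  ring

theorem integral_linear_sq (p q : ℝ) :
    ∫ w, (p * w.1 + q * w.2) ^ 2 ∂gauss2 = p ^ 2 + q ^ 2 := by
  simp_rw [sq]; exact integral_linear_mul_linear p q p q

/-! ### The ReLU recursion -/

theorem measurable_relu : Measurable relu := by unfold relu; fun_prop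

theorem relu_nonneg (x : ℝ) : 0 ≤ relu x := le_max_left _ _

theorem abs_relu_le (x : ℝ) : |relu x| ≤ |x| := by
  rw [abs_of_nonneg (relu_nonneg x)]
  exact max_le (abs_nonneg x) (le_abs_self x)

theorem deriv_relu (x : ℝ) : deriv relu x = if 0 < x then 1 else 0 := by
  rcases lt_trichotomy x 0 with hx | rfl | hx
  · rw [if_neg hx.not_gt]
    have : relu =ᶠ[nhds x] fun _ => 0 := by
      filter_upwards [gt_mem_nhds hx] with y hy
      simp [relu, hy.le]
    rw [this.deriv_eq]; simp
  · rw [if_neg (lt_irrefl _)]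
    -- At the kink `deriv` takes its default value `0`; differentiability there would pass to `|x| =
    -- 2 relu x - x`.
    refine deriv_zero_of_not_differentiableAt fun hd => ?_
    have h2 : DifferentiableAt ℝ (fun x : ℝ => |x|) 0 := by
      have : (fun x : ℝ => |x|) = fun x => 2 * relu x - x := by
        ext x
        rcases le_total 0 x with h | h
        · simp [relu, abs_of_nonneg h, max_eq_right h]; ring
        · simp [relu, abs_of_nonpos h, max_eq_left h]
      rw [this]
      exact (hd.const_mul 2).sub differentiableAt_id
    exact not_differentiableAt_abs_zero h2
  · rw [if_pos hx]
    have : relu =ᶠ[nhds x] fun y => y := by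
      filter_upwards [lt_mem_nhds hx] with y hy
      simp [relu, hy.le]
    rw [this.deriv_eq]; simp

/-- Expand `x y` in positive and negative parts and drop the two nonpositive cross terms. -/
theorem relu_mul_add_relu_neg_mul_ge (x y : ℝ) :
    x * y ≤ relu x * relu y + relu (-x) * relu (-y) := by
  unfold relu
  rcases le_total 0 x with hx | hx <;> rcases le_total 0 y with hy | hy
  · simp [hx, hy]
  · simp [max_eq_left hy, hx]; nlinarith
  · simp [max_eq_left hx, hy]; nlinarith
  · simp [hx, hy]

theorem relu_sq_add_relu_neg_sq (x : ℝ) : relu x ^ 2 + relu (-x) ^ 2 = x ^ 2 := by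
  unfold relu
  rcases le_total 0 x with hx | hx <;> simp [hx]

theorem memLp_relu_linear (p q : ℝ) : MemLp (fun w : ℝ × ℝ => relu (p * w.1 + q * w.2)) 2 gauss2 :=
  (memLp_linear_gauss2 p q).mono
    (measurable_relu.comp (by fun_prop)).aestronglyMeasurable (ae_of_all _ fun _ => abs_relu_le _)

theorem integral_relu_linear_sq (p q : ℝ) :
    ∫ w, relu (p * w.1 + q * w.2) ^ 2 ∂gauss2 = (p ^ 2 + q ^ 2) / 2 := by
  have i1 := (memLp_relu_linear p q).integrable_sq
  have i2 : Integrable (fun w : ℝ × ℝ => relu (-(p * w.1 + q * w.2)) ^ 2) gauss2 := by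
    convert (memLp_relu_linear (-p) (-q)).integrable_sq using 4; ring
  have h1 : ∫ w, relu (-(p * w.1 + q * w.2)) ^ 2 ∂gauss2 =
      ∫ w, relu (p * w.1 + q * w.2) ^ 2 ∂gauss2 := by
    rw [← integral_neg_gauss2]
    simp only [mul_neg, neg_add, neg_neg]
  have h2 := integral_add i1 i2
  simp_rw [relu_sq_add_relu_neg_sq] at h2
  rw [integral_linear_sq, h1] at h2
  linarith

/-- The symmetry `z ↦ -z` rewrites the right side as the expectation of the sum of the products of
positive and of negative parts, which dominates `z₁ z₂` pointwise. -/
theorem le_two_mul_pairExp_relu {a b d : ℝ} (ha : 0 ≤ a) (hd : 0 ≤ d) (hb : b ^ 2 ≤ a * d) :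
    b ≤ 2 * pairExp relu a b d := by
  obtain ⟨p, r, s, h1, h2, h3⟩ := exists_pair_factorization ha hd hb
  rw [pairExp_eq_integral_prod measurable_relu p 0 r s (by simpa using h1) (by simpa using h2) h3]
  set X : ℝ × ℝ → ℝ := fun w => p * w.1 + 0 * w.2
  set Y : ℝ × ℝ → ℝ := fun w => r * w.1 + s * w.2
  have i1 : Integrable (fun w => relu (X w) * relu (Y w)) gauss2 :=
    (memLp_relu_linear p 0).integrable_mul (memLp_relu_linear r s)
  have i2 : Integrable (fun w => relu (-X w) * relu (-Y w)) gauss2 := by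
    have := (memLp_relu_linear (-p) 0).integrable_mul (memLp_relu_linear (-r) (-s))
    refine this.congr (ae_of_all _ fun w => ?_)
    simp only [Pi.mul_apply, X, Y]
    congr 2 <;> ring
  have h4 : ∫ w, relu (-X w) * relu (-Y w) ∂gauss2 = ∫ w, relu (X w) * relu (Y w) ∂gauss2 := by
    rw [← integral_neg_gauss2]
    simp only [X, Y, mul_neg, neg_add, neg_neg]
  have h5 : ∫ w, X w * Y w ∂gauss2 = b := by
    rw [integral_linear_mul_linear, h2]; ring
  calc b = ∫ w, X w * Y w ∂gauss2 := h5.symm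
    _ ≤ ∫ w, (relu (X w) * relu (Y w) + relu (-X w) * relu (-Y w)) ∂gauss2 :=
      integral_mono ((memLp_linear_gauss2 p 0).integrable_mul (memLp_linear_gauss2 r s))
        (i1.add i2) fun w => relu_mul_add_relu_neg_mul_ge _ _
    _ = _ := by rw [integral_add i1 i2, h4]; ring

/-- Apply `2xy ≤ x² + y²`; by symmetry the positive part carries half of the second moment. -/
theorem two_mul_pairExp_relu_le {a b d : ℝ} (ha : 0 ≤ a) (hd : 0 ≤ d) (hb : b ^ 2 ≤ a * d) :
    2 * pairExp relu a b d ≤ (a + d) / 2 := by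
  obtain ⟨p, r, s, h1, h2, h3⟩ := exists_pair_factorization ha hd hb
  rw [pairExp_eq_integral_prod measurable_relu p 0 r s (by simpa using h1) (by simpa using h2) h3,
    ← integral_const_mul]
  calc _ ≤ ∫ w, (relu (p * w.1 + 0 * w.2) ^ 2 + relu (r * w.1 + s * w.2) ^ 2) ∂gauss2 := by
        refine integral_mono (((memLp_relu_linear p 0).integrable_mul
          (memLp_relu_linear r s)).const_mul 2) ((memLp_relu_linear p 0).integrable_sq.add
          (memLp_relu_linear r s).integrable_sq) fun w => ?_
        have := two_mul_le_add_sq (relu (p * w.1 + 0 * w.2)) (relu (r * w.1 + s * w.2))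
        simpa [mul_assoc] using this
    _ = (a + d) / 2 := by
      rw [integral_add (memLp_relu_linear p 0).integrable_sq (memLp_relu_linear r s).integrable_sq,
        integral_relu_linear_sq, integral_relu_linear_sq, h1, h3]
      ring

theorem pairExp_relu_nonneg (a b d : ℝ) : 0 ≤ pairExp relu a b d :=
  integral_nonneg fun _ => mul_nonneg (relu_nonneg _) (relu_nonneg _)

/-- A crude bound for the finitely many initial layers, where the variances are not yet bounded
below. -/
theorem abs_two_mul_pairExp_deriv_relu_sub_one_le_one (a b d : ℝ) :
    |2 * pairExp (deriv relu) a b d - 1| ≤ 1 := by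
  have h01 : ∀ x, 0 ≤ deriv relu x ∧ deriv relu x ≤ 1 := fun x => by
    rw [deriv_relu]; split_ifs <;> norm_num
  have h0 : 0 ≤ pairExp (deriv relu) a b d :=
    integral_nonneg fun _ => mul_nonneg (h01 _).1 (h01 _).1
  have h1 : pairExp (deriv relu) a b d ≤ 1 := by
    have : ∫ _ : EuclideanSpace ℝ (Fin 2), (1 : ℝ) ∂(multivariateGaussian 0 !![a, b; b, d]) = 1 := by
      simp
    rw [← this]
    exact integral_mono_of_nonneg (ae_of_all _ fun _ => mul_nonneg (h01 _).1 (h01 _).1)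
      (integrable_const _) (ae_of_all _ fun _ => mul_le_one₀ (h01 _).2 (h01 _).1 (h01 _).2)
  rw [abs_le]; constructor <;> linarith

theorem integral_ite_pos_gaussian :
    ∫ x : ℝ, (if 0 < x then 1 else 0 : ℝ) ∂(gaussianReal 0 1) = 1 / 2 := by
  have hm : Measurable fun x : ℝ => (if 0 < x then 1 else 0 : ℝ) :=
    Measurable.ite measurableSet_Ioi measurable_const measurable_const
  have i1 : Integrable (fun x : ℝ => (if 0 < x then 1 else 0 : ℝ)) (gaussianReal 0 1) :=
    Integrable.of_bound hm.aestronglyMeasurable 1 (ae_of_all _ fun x => by split_ifs <;> simp)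
  have i2 : Integrable (fun x : ℝ => (if 0 < -x then 1 else 0 : ℝ)) (gaussianReal 0 1) :=
    Integrable.of_bound (hm.comp measurable_neg).aestronglyMeasurable 1
      (ae_of_all _ fun x => by split_ifs <;> simp)
  have h := integral_neg_gaussian fun x : ℝ => (if 0 < x then 1 else 0 : ℝ)
  have h2 := integral_add i1 i2
  have : NullSingletonClass (gaussianReal 0 1) := nullSingletonClass_gaussianReal one_ne_zero
  have hne : ∀ᵐ x : ℝ ∂(gaussianReal 0 1), x ≠ 0 := by
    simp [ae_iff]
  have h3 : ∫ x : ℝ, ((if 0 < x then 1 else 0 : ℝ) + if 0 < -x then 1 else 0)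
      ∂(gaussianReal 0 1) = 1 := by
    rw [integral_congr_ae (g := fun _ => (1 : ℝ))]
    · simp
    · filter_upwards [hne] with x hx
      rcases lt_or_gt_of_ne hx with h | h
      · simp [h, h.not_gt]
      · simp [h, h.le]
  rw [h3, h] at h2
  linarith

theorem integral_ite_Ioc_gaussian_le {t : ℝ} (ht : 0 ≤ t) :
    ∫ x : ℝ, (if 0 < x ∧ x ≤ t then 1 else 0 : ℝ) ∂(gaussianReal 0 1) ≤ t := by
  have hpdf : ∀ x, gaussianPDFReal 0 1 x ≤ 1 := fun x => by
    rw [gaussianPDFReal_def]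
    have h1 : (√(2 * Real.pi * ((1 : NNReal) : ℝ)))⁻¹ ≤ 1 := by
      apply inv_le_one_of_one_le₀
      rw [Real.one_le_sqrt]
      have := Real.pi_gt_three
      simp; linarith
    have h2 : Real.exp (-(x - 0) ^ 2 / (2 * ((1 : NNReal) : ℝ))) ≤ 1 :=
      Real.exp_le_one_iff.2 (div_nonpos_of_nonpos_of_nonneg (by nlinarith [sq_nonneg (x - 0)]) (by simp))
    exact mul_le_one₀ h1 (Real.exp_nonneg _) h2
  rw [integral_gaussianReal_eq_integral_smul one_ne_zero]
  have hI : ∫ x : ℝ, (Set.Ioc 0 t).indicator (fun _ => (1 : ℝ)) x = t := by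
    rw [integral_indicator measurableSet_Ioc]
    simp [ht]
  calc _ ≤ ∫ x : ℝ, (Set.Ioc 0 t).indicator (fun _ => (1 : ℝ)) x := by
        refine integral_mono_of_nonneg (ae_of_all _ fun x => ?_) ?_ (ae_of_all _ fun x => ?_)
        · have := gaussianPDFReal_nonneg 0 1 x
          simp only [smul_eq_mul, Pi.zero_apply]
          split_ifs <;> simp [this]
        · exact (integrable_indicator_iff measurableSet_Ioc).2 (by simp)
        · by_cases hx : 0 < x ∧ x ≤ t
          · simpa [hx, Set.indicator] using hpdf x
          · simp [hx, Set.indicator]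
    _ = t := hI

/-- Since `z₁ > 0` has probability `1/2`, only the event `z₁ > 0 ≥ z₂` matters. On it either `0 < z₁
≤ t`, of probability at most `t / √a` because the density is below `1`, or `z₁ - z₂ > t`, which
Chebyshev's inequality controls through `Var(z₁ - z₂) = a + d - 2b`. The parameter `t` is left free
for optimization. -/
theorem abs_two_mul_pairExp_deriv_relu_sub_one_le {a b d t : ℝ} (ha : 0 < a)
    (hb : b ^ 2 ≤ a * d) (ht : 0 < t) :
    |2 * pairExp (deriv relu) a b d - 1| ≤ 2 * (t / √a) + 2 * ((a + d - 2 * b) / t ^ 2) := by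
  have hs : 0 < √a := Real.sqrt_pos.2 ha
  obtain ⟨r, s, h2, h3⟩ : ∃ r s : ℝ, b = √a * r ∧ d = r ^ 2 + s ^ 2 := by
    have hle : 0 ≤ d - b ^ 2 / a := by
      rw [sub_nonneg, div_le_iff₀ ha]; linarith
    refine ⟨b / √a, √(d - b ^ 2 / a), by field_simp, ?_⟩
    rw [Real.sq_sqrt hle, div_pow, Real.sq_sqrt ha.le]
    ring
  have h1 : a = √a ^ 2 := (Real.sq_sqrt ha.le).symm
  have hm : Measurable (deriv relu) := measurable_deriv relu
  rw [pairExp_eq_integral_prod hm (√a) 0 r s (by simpa using h1) (by simpa using h2) h3]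
  set I : ℝ → ℝ := fun x => if 0 < x then 1 else 0
  have hmI : Measurable I := Measurable.ite measurableSet_Ioi measurable_const measurable_const
  have hI : ∀ x, 0 ≤ I x ∧ I x ≤ 1 := fun x => by simp only [I]; split_ifs <;> norm_num
  have hdI : deriv relu = I := funext deriv_relu
  rw [hdI]
  -- `J w.1` is the indicator of `0 < z₁ ≤ t`, because `z₁ = √a w.1`.
  set J : ℝ → ℝ := fun x => if 0 < x ∧ x ≤ t / √a then 1 else 0
  have hmJ : Measurable J := Measurable.ite measurableSet_Ioc measurable_const measurable_const
  have hE1 : ∫ w, I (√a * w.1 + 0 * w.2) ∂gauss2 = 1 / 2 := by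
    rw [← integral_ite_pos_gaussian, ← integral_fst_gaussian_prod]
    simp [I, hs]
  have iI : Integrable (fun w : ℝ × ℝ => I (√a * w.1 + 0 * w.2)) gauss2 :=
    Integrable.of_bound (hmI.comp (by fun_prop)).aestronglyMeasurable 1
      (ae_of_all _ fun w => by rw [Real.norm_of_nonneg (hI _).1]; exact (hI _).2)
  have iII : Integrable (fun w : ℝ × ℝ => I (√a * w.1 + 0 * w.2) * I (r * w.1 + s * w.2)) gauss2 :=
    Integrable.of_bound ((hmI.comp (by fun_prop)).mul (hmI.comp (by fun_prop))).aestronglyMeasurable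
      1 (ae_of_all _ fun w => by
        rw [Real.norm_of_nonneg (mul_nonneg (hI _).1 (hI _).1)]
        exact mul_le_one₀ (hI _).2 (hI _).1 (hI _).2)
  have iJ : Integrable (fun w : ℝ × ℝ => J w.1) gauss2 :=
    Integrable.of_bound (hmJ.comp measurable_fst).aestronglyMeasurable 1
      (ae_of_all _ fun w => by simp only [J]; split_ifs <;> simp)
  have iQ : Integrable (fun w : ℝ × ℝ => ((√a - r) * w.1 + (-s) * w.2) ^ 2) gauss2 :=
    (memLp_linear_gauss2 _ _).integrable_sq
  have hEQ : ∫ w : ℝ × ℝ, ((√a - r) * w.1 + (-s) * w.2) ^ 2 ∂gauss2 = a + d - 2 * b := by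
    rw [integral_linear_sq, h3, h2]
    nlinarith
  have hEJ : ∫ w : ℝ × ℝ, J w.1 ∂gauss2 ≤ t / √a := by
    rw [integral_fst_gaussian_prod]
    exact integral_ite_Ioc_gaussian_le (by positivity)
  have hup : ∫ w, I (√a * w.1 + 0 * w.2) * I (r * w.1 + s * w.2) ∂gauss2 ≤ 1 / 2 := by
    rw [← hE1]
    exact integral_mono iII iI fun w => mul_le_of_le_one_right (hI _).1 (hI _).2
  have hlow : 1 / 2 - t / √a - (a + d - 2 * b) / t ^ 2 ≤
      ∫ w, I (√a * w.1 + 0 * w.2) * I (r * w.1 + s * w.2) ∂gauss2 := by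
    have : ∫ w : ℝ × ℝ, (I (√a * w.1 + 0 * w.2) - J w.1 -
        ((√a - r) * w.1 + (-s) * w.2) ^ 2 / t ^ 2) ∂gauss2 =
        1 / 2 - ∫ w : ℝ × ℝ, J w.1 ∂gauss2 - (a + d - 2 * b) / t ^ 2 := by
      have iIJ : Integrable (fun w : ℝ × ℝ => I (√a * w.1 + 0 * w.2) - J w.1) gauss2 := iI.sub iJ
      rw [integral_sub iIJ (iQ.div_const _), integral_sub iI iJ, hE1, integral_div, hEQ]
    calc _ ≤ 1 / 2 - ∫ w : ℝ × ℝ, J w.1 ∂gauss2 - (a + d - 2 * b) / t ^ 2 := by linarith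
      _ ≤ _ := by
        rw [← this]
        refine integral_mono ((iI.sub iJ).sub (iQ.div_const _)) iII fun w => ?_
        have hQ : 0 ≤ ((√a - r) * w.1 + (-s) * w.2) ^ 2 / t ^ 2 := by positivity
        simp only [zero_mul, add_zero]
        by_cases hx : 0 < √a * w.1
        · by_cases hy : 0 < r * w.1 + s * w.2
          · have : 0 ≤ J w.1 := by simp only [J]; split_ifs <;> norm_num
            simp only [I, hx, hy, if_true]
            linarith
          · by_cases hJ : w.1 ≤ t / √a
            · have h0 : 0 < w.1 := (mul_pos_iff_of_pos_left hs).1 hx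
              simp only [I, J, hx, hy, h0, hJ, if_true, if_false, and_self]
              linarith
            · have h0 : 0 < w.1 := (mul_pos_iff_of_pos_left hs).1 hx
              have h4 : t < √a * w.1 := by
                rw [not_le, div_lt_iff₀ hs] at hJ
                linarith
              have h5 : 1 ≤ ((√a - r) * w.1 + (-s) * w.2) ^ 2 / t ^ 2 := by
                rw [one_le_div (by positivity)]
                apply pow_le_pow_left₀ ht.le
                nlinarith
              simp only [I, J, hx, hy, hJ, if_true, if_false, and_false]
              linarith
        · have h0 : ¬ 0 < w.1 := fun h => hx (mul_pos hs h)
          simp only [I, J, hx, h0, if_false, false_and]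
          linarith
  rw [abs_le]
  have h6 : 0 ≤ t / √a := by positivity
  have h7 : 0 ≤ (a + d - 2 * b) / t ^ 2 := by
    rw [← hEQ]
    exact div_nonneg (integral_nonneg fun w => sq_nonneg _) (by positivity)
  constructor <;> linarith

theorem edgeOfChaos_relu {σw σb : ℝ} (h : EdgeOfChaos relu σw σb) : σw ^ 2 = 2 ∧ σb = 0 := by
  obtain ⟨q, hq, h1, h2⟩ := h
  have hs : 0 < √q := Real.sqrt_pos.2 hq
  have e2 : ∫ z, deriv relu (√q * z) ^ 2 ∂(gaussianReal 0 1) = 1 / 2 := by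
    rw [← integral_ite_pos_gaussian]
    congr 1; ext z
    rw [deriv_relu]
    by_cases hz : 0 < z <;> simp [hz, hs]
  have e1 : ∫ z, relu (√q * z) ^ 2 ∂(gaussianReal 0 1) = q / 2 := by
    have := integral_relu_linear_sq (√q) 0
    rw [← integral_fst_gaussian_prod]
    simpa [Real.sq_sqrt hq.le] using this
  rw [e2] at h2
  rw [e1] at h1
  have h3 : σw ^ 2 = 2 := by linarith
  refine ⟨h3, ?_⟩
  rw [h3] at h1
  have : σb ^ 2 = 0 := by linarith
  simpa using this

/-- A sequence which is superharmonic for a mixing average and whose upper bounds persist has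
exponentially small oscillation, and squeezes to a constant. -/
theorem exists_squeeze_of_superharmonic {ι : Type*} [Fintype ι] [DecidableEq ι] [Nonempty ι]
    {A : Matrix ι ι ℝ} (hA : IsRowStochastic A) {k : ℕ} (hk : 0 < k) {δ : ℝ} (hδ0 : 0 < δ)
    (hδ : ∀ i j, δ ≤ (A ^ k) i j) {x : ℕ → ι → ℝ} (hsup : ∀ l i, (A *ᵥ x l) i ≤ x (l + 1) i)
    (hub : ∀ l M, (∀ i, x l i ≤ M) → ∀ i, x (l + 1) i ≤ M) :
    ∃ c K γ : ℝ, 0 ≤ K ∧ 0 < γ ∧ γ < 1 ∧ (∀ l m, (∀ i, m ≤ x l i) → m ≤ c) ∧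
      ∀ l, ∃ m M, (∀ i, m ≤ x l i) ∧ (∀ i, x l i ≤ M) ∧ m ≤ c ∧ c ≤ M ∧ M - m ≤ K * γ ^ l := by
  have hmax : ∀ l, ∃ i, ∀ j, x l j ≤ x l i := fun l => Finite.exists_max (x l)
  have hmin : ∀ l, ∃ i, ∀ j, x l i ≤ x l j := fun l => Finite.exists_min (x l)
  choose iM hM using hmax
  choose im hm using hmin
  set M : ℕ → ℝ := fun l => x l (iM l)
  set m : ℕ → ℝ := fun l => x l (im l)
  have hMa : Antitone M := antitone_nat_of_succ_le fun l => hub l (M l) (hM l) _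
  have hmm : Monotone m := monotone_nat_of_le_succ fun l =>
    (hA.le_mulVec (hm l) _).trans (hsup l _)
  have hmM : ∀ l, m l ≤ M l := fun l => hM l _
  -- Over `k` steps every state gives weight at least `δ` to the maximizer at time `l`, so the
  -- minimum rises by `δ (M l - m l)` while the maximum does not rise.
  have hrec : ∀ l, M (l + k) - m (l + k) ≤ (1 - δ) * (M l - m l) + 0 * 0 ^ l := by
    intro l
    have h1 := hA.le_pow_mulVec_add (x := fun j i => -x (l + j) i) (e := 0) (fun j i => by
      have h2 : (fun i => -x (l + j) i) = -x (l + j) := rfl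
      rw [h2, Matrix.mulVec_neg, Pi.neg_apply, add_zero, neg_le_neg_iff]
      exact hsup (l + j) i) k (im (l + k))
    have h3 := (hA.pow k).mulVec_le_sub (x := fun i => -x (l + 0) i) (c := -m l)
      (fun i => neg_le_neg (hm l i)) (im (l + k)) (iM l) (hδ _ _)
    simp only [add_zero, mul_zero] at h1 h3
    have h4 : -m (l + k) ≤ -m l - δ * (-m l - -M l) := h1.trans h3
    have h5 : M (l + k) ≤ M l := hMa (by omega)
    linarith
  have hδ1 : 0 ≤ 1 - δ := by
    obtain ⟨i₀⟩ := ‹Nonempty ι›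
    have := Finset.single_le_sum (f := fun j => (A ^ k) i₀ j)
      (fun j _ => (hA.pow k).nonneg i₀ j) (Finset.mem_univ i₀)
    rw [(hA.pow k).sum_row] at this
    linarith [hδ i₀ i₀]
  obtain ⟨K, γ, hK, hγ0, hγ1, hle⟩ := exists_geometric_bound (a := fun l => M l - m l) hk hδ1
    (by linarith) le_rfl one_pos le_rfl hrec
  have hbdd : BddAbove (Set.range m) := ⟨M 0, by
    rintro _ ⟨l, rfl⟩
    exact (hmM l).trans (hMa (Nat.zero_le l))⟩
  have hmc : ∀ l, m l ≤ ⨆ l, m l := le_ciSup hbdd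
  have hcM : ∀ l, ⨆ l, m l ≤ M l := fun l => ciSup_le fun j =>
    (hmm (le_max_left j l)).trans ((hmM _).trans (hMa (le_max_right j l)))
  exact ⟨⨆ l, m l, K, γ, hK, hγ0, hγ1, fun l m' h => (h _).trans (hmc l),
    fun l => ⟨m l, M l, hm l, hM l, hmc l, hcM l, hle l⟩⟩

/-! ### ReLU kernels on the graph and their tangent kernel -/

section ReluKernel

variable {V : Type*} [Fintype V] [DecidableEq V] {G : SimpleGraph V} [DecidableRel G.Adj]
  {d : ℕ} {h : V → EuclideanSpace ℝ (Fin d)} {σw σb : ℝ} {R : ℕ}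

theorem gpk_relu_succ (hw : σw ^ 2 = 2) (hb : σb = 0) (l r : ℕ) (u u' : V) :
    gpk G h relu σw σb R l (r + 1) u u' = 2 * pairExp relu (gpk G h relu σw σb R l r u u)
      (gpk G h relu σw σb R l r u u') (gpk G h relu σw σb R l r u' u') := by
  rw [gpk_succ, covStep_eq_pairExp _ _ _ (psd_symm (posSemidef_gpk measurable_relu abs_relu_le l r)
    u u'), hw, hb]
  simp

theorem gpk_relu_le_succ (hw : σw ^ 2 = 2) (hb : σb = 0) (l r : ℕ) (u u' : V) :
    gpk G h relu σw σb R l r u u' ≤ gpk G h relu σw σb R l (r + 1) u u' := by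
  have hS : (Matrix.of (gpk G h relu σw σb R l r)).PosSemidef :=
    posSemidef_gpk measurable_relu abs_relu_le l r
  rw [gpk_relu_succ hw hb]
  exact le_two_mul_pairExp_relu (psd_diag_nonneg hS u) (psd_diag_nonneg hS u') (psd_sq_le hS u u')

theorem gpk_relu_succ_le (hw : σw ^ 2 = 2) (hb : σb = 0) (l r : ℕ) {M : ℝ}
    (hM : ∀ u u', gpk G h relu σw σb R l r u u' ≤ M) (u u' : V) :
    gpk G h relu σw σb R l (r + 1) u u' ≤ M := by
  have hS : (Matrix.of (gpk G h relu σw σb R l r)).PosSemidef :=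
    posSemidef_gpk measurable_relu abs_relu_le l r
  rw [gpk_relu_succ hw hb]
  have := two_mul_pairExp_relu_le (psd_diag_nonneg hS u) (psd_diag_nonneg hS u') (psd_sq_le hS u u')
  linarith [hM u u, hM u' u']

theorem gpk_relu_mono (hw : σw ^ 2 = 2) (hb : σb = 0) (l : ℕ) (u u' : V) :
    Monotone fun r => gpk G h relu σw σb R l r u u' :=
  monotone_nat_of_le_succ fun r => gpk_relu_le_succ hw hb l r u u'

theorem gpk_relu_le (hw : σw ^ 2 = 2) (hb : σb = 0) (l : ℕ) {M : ℝ}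
    (hM : ∀ u u', gpk G h relu σw σb R l 0 u u' ≤ M) (r : ℕ) (u u' : V) :
    gpk G h relu σw σb R l r u u' ≤ M := by
  induction r generalizing u u' with
  | zero => exact hM u u'
  | succ r ih => exact gpk_relu_succ_le hw hb l r ih u u'

/-- This case must be separated: the limiting variance is `0`, and the argument that the derivative
covariance tends to `1` needs a positive one. -/
theorem gntk_relu_of_zero_features (hw : σw ^ 2 = 2) (hb : σb = 0) (h0 : ∀ u, h u = 0) (l r : ℕ)
    (u u' : V) : gntk G h relu σw σb R l r u u' = 0 := by
  have hagg : ∀ S : V → V → ℝ, (∀ u u', S u u' = 0) → ∀ u u', aggregate G S u u' = 0 := by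
    intro S hS u u'
    simp [aggregate, hS]
  have hz : pairExp relu 0 0 0 = 0 := by
    have h1 := le_two_mul_pairExp_relu (a := 0) (b := 0) (d := 0) le_rfl le_rfl (by simp)
    have h2 := two_mul_pairExp_relu_le (a := 0) (b := 0) (d := 0) le_rfl le_rfl (by simp)
    linarith
  have hrow : ∀ l, (∀ u u', gpk G h relu σw σb R l 0 u u' = 0) →
      ∀ r u u', gpk G h relu σw σb R l r u u' = 0 := by
    intro l hl r
    induction r with
    | zero => exact hl
    | succ r ih => intro u u'; rw [gpk_relu_succ hw hb, ih, ih, ih, hz, mul_zero]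
  have hgpk : ∀ l r u u', gpk G h relu σw σb R l r u u' = 0 := by
    intro l
    induction l with
    | zero => exact hrow 0 fun u u' => by simp [h0]
    | succ l ih => exact hrow _ fun u u' => by rw [gpk_succ_zero]; exact hagg _ (ih R) u u'
  have hrow' : ∀ l, (∀ u u', gntk G h relu σw σb R l 0 u u' = 0) →
      ∀ r u u', gntk G h relu σw σb R l r u u' = 0 := by
    intro l hl r
    induction r with
    | zero => exact hl
    | succ r ih => intro u u'; rw [gntk_succ, ih, hgpk]; simp
  revert l r u u'
  intro l
  induction l with
  | zero => exact hrow' 0 fun u u' => by simp [gntk, h0]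
  | succ l ih => exact hrow' _ fun u u' => by rw [gntk_succ_zero]; exact hagg _ (ih R) u u'

theorem gntk_relu_growth (hw : σw ^ 2 = 2) (hb : σb = 0) (hirr : (aggMatrix G).IsIrreducible)
    {π : V × V → ℝ} (hπ : IsStationaryDistribution (aggMatrix G) π) :
    ∃ c κ : ℝ, ∀ r ≤ R, ExpDecay fun l (p : V × V) =>
      gntk G h relu σw σb R l r p.1 p.2 - (R * l * c + κ + r * c) := by
  by_cases h0 : ∀ u, h u = 0
  · refine ⟨0, 0, fun r _ => ?_⟩
    simpa [gntk_relu_of_zero_features hw hb h0] using ExpDecay.zero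
  -- Without nonlinear layers the convergence hypotheses are vacuous and any slope serves.
  rcases Nat.eq_zero_or_pos R with rfl | hR
  · exact ⟨0, gntk_linear_growth (c := 0) hirr hπ (by simp) (by simp)⟩
  push Not at h0
  obtain ⟨u₀, hu₀⟩ := h0
  have : Nonempty (V × V) := ⟨(u₀, u₀)⟩
  have hA := isRowStochastic_aggMatrix G
  obtain ⟨k, hk, δ, hδ0, hδ⟩ := exists_pow_ge_of_irreducible hirr (aggMatrix_diag_pos G)
  set S := gpk G h relu σw σb R
  have hagg : ∀ l p, S (l + 1) 0 p.1 p.2 = (aggMatrix G *ᵥ fun q => S l R q.1 q.2) p := by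
    intro l p
    rw [aggMatrix_mulVec]
    exact congrFun₂ (gpk_succ_zero l) p.1 p.2
  have hmono : ∀ l u u', Monotone fun r => S l r u u' := gpk_relu_mono hw hb
  have hsup : ∀ l p, (aggMatrix G *ᵥ fun q => S l 0 q.1 q.2) p ≤ S (l + 1) 0 p.1 p.2 :=
    fun l p => by
      rw [hagg]
      exact hA.mulVec_mono (fun q => hmono l q.1 q.2 (Nat.zero_le R)) p
  obtain ⟨c, K, γ, hK, hγ0, hγ1, hcm, hsq⟩ := exists_squeeze_of_superharmonic hA hk hδ0 hδ
    (x := fun l p => S l 0 p.1 p.2) hsup (fun l M hM p => by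
      rw [hagg]
      exact hA.mulVec_le (fun q => gpk_relu_le hw hb l (fun u u' => hM (u, u')) R q.1 q.2) p)
  -- One ReLU layer makes all entries nonnegative, the diagonal entry at `u₀` stays positive, and
  -- `k` further aggregations spread a share `δ` of it to every pair. Lower bounds persist to the
  -- limit.
  have hcpos : 0 < c := by
    have hS01 : ∀ u u', 0 ≤ S 0 R u u' := fun u u' => by
      refine le_trans ?_ (hmono 0 u u' hR)
      simp only [S]
      rw [show Nat.succ 0 = 0 + 1 from rfl, gpk_relu_succ hw hb]
      exact mul_nonneg zero_le_two (pairExp_relu_nonneg _ _ _)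
    have hS0 : 0 < S 0 R u₀ u₀ := by
      refine lt_of_lt_of_le ?_ (hmono 0 u₀ u₀ (Nat.zero_le R))
      simp only [S, gpk_zero_zero]
      exact real_inner_self_pos.2 hu₀
    have h1 : ∀ p : V × V, 0 ≤ S 1 0 p.1 p.2 := fun p => by
      rw [hagg]; exact hA.le_mulVec (fun q => hS01 q.1 q.2) p
    have h1pos : 0 < S 1 0 u₀ u₀ := by
      rw [hagg 0 (u₀, u₀)]
      refine (mul_pos (aggMatrix_diag_pos G (u₀, u₀)) hS0).trans_le ?_
      exact Finset.single_le_sum (f := fun q => aggMatrix G (u₀, u₀) q * S 0 R q.1 q.2)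
        (fun q _ => mul_nonneg (hA.nonneg _ _) (hS01 _ _)) (Finset.mem_univ (u₀, u₀))
    have h2 : ∀ p : V × V, δ * S 1 0 u₀ u₀ ≤ S (1 + k) 0 p.1 p.2 := fun p => by
      have h3 := hA.le_pow_mulVec_add (x := fun j p => -S (1 + j) 0 p.1 p.2) (e := 0)
        (fun j i => by
          have h2 : (fun p : V × V => -S (1 + j) 0 p.1 p.2) =
            -fun p : V × V => S (1 + j) 0 p.1 p.2 := rfl
          rw [h2, Matrix.mulVec_neg, Pi.neg_apply, add_zero, neg_le_neg_iff]
          exact hsup (1 + j) i) k p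
      have h4 := (hA.pow k).mulVec_le_sub (x := fun p => -S (1 + 0) 0 p.1 p.2) (c := 0)
        (fun i => neg_nonpos.2 (h1 i)) p (u₀, u₀) (hδ _ _)
      simp only [add_zero, mul_zero, sub_neg_eq_add, zero_add, zero_sub] at h3 h4
      linarith
    exact (mul_pos hδ0 h1pos).trans_le (hcm (1 + k) _ h2)
  have hconv : ∀ r l (p : V × V), |S l r p.1 p.2 - c| ≤ K * γ ^ l := by
    intro r l p
    obtain ⟨m, M, h1, h2, h3, h4, h5⟩ := hsq l
    have h6 : m ≤ S l r p.1 p.2 := (h1 p).trans (hmono l p.1 p.2 (Nat.zero_le r))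
    have h7 : S l r p.1 p.2 ≤ M := gpk_relu_le hw hb l (fun u u' => h2 (u, u')) r p.1 p.2
    rw [abs_le]
    constructor <;> linarith
  refine ⟨c, gntk_linear_growth hirr hπ (fun r _ => ?_)
    fun r _ => ⟨K, γ, hK, hγ0, hγ1, hconv (r + 1)⟩⟩
  -- The bound has the shape `t + γ^l / t²`; the choice `t = γ^(l/3) = s^l` balances its two terms.
  set s := γ ^ (1 / 3 : ℝ)
  have hs0 : 0 < s := Real.rpow_pos_of_pos hγ0 _
  have hs1 : s < 1 := Real.rpow_lt_one hγ0.le hγ1 (by norm_num)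
  have hs3 : s ^ 3 = γ := by
    rw [← Real.rpow_natCast, ← Real.rpow_mul hγ0.le]; norm_num
  -- From here on the variances exceed `c / 2`, which keeps the division by `√a` harmless.
  obtain ⟨l₀, hl₀⟩ : ∃ l₀ : ℕ, ∀ l ≥ l₀, K * γ ^ l < c / 2 := by
    have ht : Filter.Tendsto (fun l : ℕ => K * γ ^ l) Filter.atTop (nhds (K * 0)) :=
      (tendsto_pow_atTop_nhds_zero_of_lt_one hγ0.le hγ1).const_mul K
    rw [mul_zero] at ht
    exact Filter.eventually_atTop.1 (ht.eventually (gt_mem_nhds (half_pos hcpos)))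
  have hdot : ∀ l (p : V × V), covDotStep relu σw (S l r) p.1 p.2 - 1 =
      2 * pairExp (deriv relu) (S l r p.1 p.1) (S l r p.1 p.2) (S l r p.2 p.2) - 1 := fun l p => by
    rw [covDotStep_eq_pairExp _ _ (psd_symm (posSemidef_gpk measurable_relu abs_relu_le l r)
      p.1 p.2), hw]
  refine ExpDecay.of_eventually (B := 1) (C := 2 / √(c / 2) + 8 * K) hs0 hs1 (fun l p => ?_) l₀
    fun l hl p => ?_
  · rw [hdot]; exact abs_two_mul_pairExp_deriv_relu_sub_one_le_one _ _ _
  · rw [hdot]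
    have hS : (Matrix.of (S l r)).PosSemidef := posSemidef_gpk measurable_relu abs_relu_le l r
    have h1 := abs_le.1 (hconv r l (p.1, p.1))
    have h2 := abs_le.1 (hconv r l (p.1, p.2))
    have h3 := abs_le.1 (hconv r l (p.2, p.2))
    have h4 := hl₀ l hl
    have hac : c / 2 ≤ S l r p.1 p.1 := by linarith [h1.1]
    have ha : 0 < S l r p.1 p.1 := by linarith
    refine (abs_two_mul_pairExp_deriv_relu_sub_one_le ha (psd_sq_le hS p.1 p.2)
      (pow_pos hs0 l)).trans ?_
    have h5 : s ^ l / √(S l r p.1 p.1) ≤ s ^ l / √(c / 2) := by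
      have : 0 < √(c / 2) := Real.sqrt_pos.2 (by linarith)
      gcongr
    have h6 : (S l r p.1 p.1 + S l r p.2 p.2 - 2 * S l r p.1 p.2) / (s ^ l) ^ 2 ≤ 4 * K * s ^ l := by
      rw [div_le_iff₀ (by positivity)]
      have : 4 * K * s ^ l * (s ^ l) ^ 2 = 4 * (K * γ ^ l) := by rw [← hs3]; ring
      rw [this]
      simp only at h1 h2 h3
      linarith [h1.2, h2.1, h3.2]
    calc _ ≤ 2 * (s ^ l / √(c / 2)) + 2 * (4 * K * s ^ l) := by linarith
      _ = _ := by ring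

end ReluKernel

open Real (tanh sinh cosh)

/-! ### The hyperbolic tangent -/

/-- The derivative `1 - tanh²` of the hyperbolic tangent. -/
noncomputable def sechSq (x : ℝ) : ℝ := 1 - tanh x ^ 2

theorem hasDerivAt_tanh (x : ℝ) : HasDerivAt tanh (sechSq x) x := by
  have h : tanh = fun x => sinh x / cosh x := funext Real.tanh_eq_sinh_div_cosh
  rw [h]
  have hc := (Real.cosh_pos x).ne'
  refine ((Real.hasDerivAt_sinh x).div (Real.hasDerivAt_cosh x) hc).congr_deriv ?_
  rw [sechSq, Real.tanh_eq_sinh_div_cosh]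
  field_simp

theorem deriv_tanh : deriv tanh = sechSq := funext fun x => (hasDerivAt_tanh x).deriv

theorem continuous_tanh : Continuous tanh :=
  continuous_iff_continuousAt.2 fun x => (hasDerivAt_tanh x).continuousAt

theorem continuous_sechSq : Continuous sechSq := by
  unfold sechSq; exact continuous_const.sub (continuous_tanh.pow 2)

theorem abs_tanh_le_one (x : ℝ) : |tanh x| ≤ 1 := (Real.abs_tanh_lt_one x).le

theorem sechSq_pos (x : ℝ) : 0 < sechSq x := sub_pos.2 (Real.tanh_sq_lt_one x)

theorem sechSq_le_one (x : ℝ) : sechSq x ≤ 1 := by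
  unfold sechSq; nlinarith [sq_nonneg (tanh x)]

theorem abs_sechSq_le_one (x : ℝ) : |sechSq x| ≤ 1 := by
  rw [abs_of_pos (sechSq_pos x)]; exact sechSq_le_one x

theorem hasDerivAt_sechSq (x : ℝ) : HasDerivAt sechSq (-2 * tanh x * sechSq x) x := by
  refine (((hasDerivAt_tanh x).pow 2).const_sub 1).congr_deriv ?_
  simp

theorem tanh_strictMono : StrictMono tanh :=
  strictMono_of_deriv_pos fun x => by rw [deriv_tanh]; exact sechSq_pos x

theorem tanh_nonneg {x : ℝ} (hx : 0 ≤ x) : 0 ≤ tanh x := by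
  simpa using tanh_strictMono.monotone hx

theorem abs_tanh (x : ℝ) : |tanh x| = tanh |x| := by
  rcases le_total 0 x with hx | hx
  · rw [abs_of_nonneg hx, abs_of_nonneg (tanh_nonneg hx)]
  · rw [abs_of_nonpos hx, Real.tanh_neg, abs_of_nonpos]
    simpa using tanh_strictMono.monotone hx

theorem abs_tanh_sub_tanh_le (x y : ℝ) : |tanh x - tanh y| ≤ |x - y| := by
  have h : LipschitzWith 1 tanh :=
    lipschitzWith_of_nnnorm_deriv_le (fun x => (hasDerivAt_tanh x).differentiableAt) fun x => by
      rw [deriv_tanh, ← NNReal.coe_le_coe]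
      simpa using abs_sechSq_le_one x
  simpa [Real.dist_eq] using h.dist_le_mul x y

theorem abs_tanh_le_abs (x : ℝ) : |tanh x| ≤ |x| := by
  simpa using abs_tanh_sub_tanh_le x 0

theorem abs_sechSq_sub_le (x y : ℝ) : |sechSq x - sechSq y| ≤ 2 * |x - y| := by
  have h1 : sechSq x - sechSq y = -((tanh x + tanh y) * (tanh x - tanh y)) := by
    unfold sechSq; ring
  rw [h1, abs_neg, abs_mul]
  have h2 : |tanh x + tanh y| ≤ 2 :=
    (abs_add_le _ _).trans (by linarith [abs_tanh_le_one x, abs_tanh_le_one y])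
  exact mul_le_mul h2 (abs_tanh_sub_tanh_le x y) (abs_nonneg _) zero_le_two

theorem tanh_sq_le_of_abs_le {x y : ℝ} (h : |x| ≤ |y|) : tanh x ^ 2 ≤ tanh y ^ 2 := by
  rw [sq_le_sq, abs_tanh, abs_tanh]
  exact tanh_strictMono.monotone h

/-- The difference vanishes at `0` and has derivative `c (sech² t - sech² (c t)) ≥ 0`. This
concavity is the source of the contraction of variances. -/
theorem tanh_mul_le {c x : ℝ} (hc : 1 ≤ c) (hx : 0 ≤ x) : tanh (c * x) ≤ c * tanh x := by
  have hd : ∀ t, HasDerivAt (fun t => c * tanh t - tanh (c * t))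
      (c * sechSq t - sechSq (c * t) * c) t := fun t => by
    have h1 : HasDerivAt (fun t => c * t) c t := by simpa using (hasDerivAt_id t).const_mul c
    exact ((hasDerivAt_tanh t).const_mul c).sub ((hasDerivAt_tanh (c * t)).comp t h1)
  have hmono : MonotoneOn (fun t => c * tanh t - tanh (c * t)) (Set.Ici 0) := by
    refine monotoneOn_of_deriv_nonneg (convex_Ici 0)
      (fun t _ => (hd t).continuousAt.continuousWithinAt)
      (fun t _ => (hd t).differentiableAt.differentiableWithinAt) fun t ht => ?_
    rw [interior_Ici, Set.mem_Ioi] at ht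
    rw [(hd t).deriv]
    have : tanh t ^ 2 ≤ tanh (c * t) ^ 2 := by
      apply tanh_sq_le_of_abs_le
      rw [abs_mul, abs_of_nonneg (by linarith : 0 ≤ c)]
      exact le_mul_of_one_le_left (abs_nonneg t) hc
    unfold sechSq
    nlinarith
  have := hmono (Set.mem_Ici.2 le_rfl) (Set.mem_Ici.2 hx) hx
  simpa using this

theorem tanh_mul_sq_le {c : ℝ} (hc : 1 ≤ c) (x : ℝ) : tanh (c * x) ^ 2 ≤ c ^ 2 * tanh x ^ 2 := by
  rw [← mul_pow, sq_le_sq, abs_mul, abs_tanh, abs_tanh, abs_mul, abs_of_nonneg (by linarith : 0 ≤ c)]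
  exact tanh_mul_le hc (abs_nonneg x)

theorem tanh_add_tanh_sub (x y : ℝ) :
    tanh (x + y) + tanh (x - y) = 2 * sinh (2 * x) / (cosh (2 * x) + cosh (2 * y)) := by
  have h1 := (Real.cosh_pos (x + y)).ne'
  have h2 := (Real.cosh_pos (x - y)).ne'
  have h3 : cosh (2 * x) + cosh (2 * y) = 2 * (cosh (x + y) * cosh (x - y)) := by
    rw [show 2 * x = (x + y) + (x - y) by ring, show 2 * y = (x + y) - (x - y) by ring,
      Real.cosh_add (x + y), Real.cosh_sub (x + y)]
    ring
  have h4 : sinh (2 * x) = sinh (x + y) * cosh (x - y) + cosh (x + y) * sinh (x - y) := by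
    rw [← Real.sinh_add]; congr 1; ring
  rw [Real.tanh_eq_sinh_div_cosh, Real.tanh_eq_sinh_div_cosh, h3, h4]
  field_simp

theorem tanh_mul_sinh_nonneg {x y : ℝ} (h : 0 ≤ x * y) : 0 ≤ tanh x * sinh y := by
  have h1 : ∀ {x y : ℝ}, 0 ≤ x → 0 ≤ y → 0 ≤ tanh x * sinh y := fun hx hy =>
    mul_nonneg (tanh_nonneg hx) (Real.sinh_nonneg_iff.2 hy)
  rcases mul_nonneg_iff.1 h with ⟨hx, hy⟩ | ⟨hx, hy⟩
  · exact h1 hx hy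
  · simpa [Real.tanh_neg, Real.sinh_neg] using h1 (neg_nonneg.2 hx) (neg_nonneg.2 hy)

/-! ### Gaussian integration by parts -/

theorem hasDerivAt_gaussianPDFReal (x : ℝ) :
    HasDerivAt (gaussianPDFReal 0 1) (-x * gaussianPDFReal 0 1 x) x := by
  have h : gaussianPDFReal 0 1 = fun x => (√(2 * Real.pi))⁻¹ * Real.exp (-x ^ 2 / 2) := by
    ext x; simp [gaussianPDFReal_def]
  rw [h]
  have h1 : HasDerivAt (fun x : ℝ => -x ^ 2 / 2) (-x) x := by
    refine (((hasDerivAt_pow 2 x).neg).div_const 2).congr_deriv ?_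
    simp
    ring
  refine (h1.exp.const_mul (√(2 * Real.pi))⁻¹).congr_deriv ?_
  ring

/-- Stein's identity: the Gaussian density has derivative `-x` times itself. -/
theorem integral_id_mul_gaussian {f f' : ℝ → ℝ} {C : ℝ} (hf : ∀ x, HasDerivAt f (f' x) x)
    (hf' : Continuous f') (hC : ∀ x, |f x| ≤ C) (hC' : ∀ x, |f' x| ≤ C) :
    ∫ x, x * f x ∂(gaussianReal 0 1) = ∫ x, f' x ∂(gaussianReal 0 1) := by
  have hfc : Continuous f := continuous_iff_continuousAt.2 fun x => (hf x).continuousAt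
  have hp := integrable_gaussianPDFReal 0 1
  have hxp : Integrable (fun x : ℝ => -x * gaussianPDFReal 0 1 x) := by
    have h : Integrable (fun x : ℝ => x) (gaussianReal 0 1) := IsGaussian.integrable_id
    rw [gaussianReal_of_var_ne_zero _ one_ne_zero,
      integrable_withDensity_iff (measurable_gaussianPDF 0 1)
        (ae_of_all _ fun x => gaussianPDF_lt_top)] at h
    simp only [toReal_gaussianPDF] at h
    simpa using h.neg
  have key := integral_mul_deriv_eq_deriv_mul_of_integrable (u := gaussianPDFReal 0 1) (v := f)
    (u' := fun x => -x * gaussianPDFReal 0 1 x) (v' := f')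
    (fun x _ => hasDerivAt_gaussianPDFReal x) (fun x _ => hf x)
    (hp.mul_bdd hf'.aestronglyMeasurable (ae_of_all _ hC'))
    (hxp.mul_bdd hfc.aestronglyMeasurable (ae_of_all _ hC))
    (hp.mul_bdd hfc.aestronglyMeasurable (ae_of_all _ hC))
  rw [integral_gaussianReal_eq_integral_smul one_ne_zero,
    integral_gaussianReal_eq_integral_smul one_ne_zero]
  simp only [smul_eq_mul]
  rw [key, ← integral_neg]
  congr 1; ext x; ring

theorem integrable_of_abs_le {f : ℝ × ℝ → ℝ} (hf : Continuous f) {C : ℝ}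
    (h : ∀ w, |f w| ≤ C) : Integrable f gauss2 :=
  Integrable.of_bound hf.aestronglyMeasurable C (ae_of_all _ h)

theorem integrable_fst_mul {f : ℝ × ℝ → ℝ} (hf : Continuous f) {C : ℝ} (h : ∀ w, |f w| ≤ C) :
    Integrable (fun w => w.1 * f w) gauss2 :=
  (memLp_fst_gauss2.integrable one_le_two).mul_bdd hf.aestronglyMeasurable (ae_of_all _ h)

theorem integrable_snd_mul {f : ℝ × ℝ → ℝ} (hf : Continuous f) {C : ℝ} (h : ∀ w, |f w| ≤ C) :
    Integrable (fun w => w.2 * f w) gauss2 :=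
  (memLp_snd_gauss2.integrable one_le_two).mul_bdd hf.aestronglyMeasurable (ae_of_all _ h)

theorem integral_fst_mul_gauss2 {f f' : ℝ × ℝ → ℝ} {C : ℝ}
    (hd : ∀ x y, HasDerivAt (fun x => f (x, y)) (f' (x, y)) x) (hf : Continuous f)
    (hf' : Continuous f') (hC : ∀ w, |f w| ≤ C) (hC' : ∀ w, |f' w| ≤ C) :
    ∫ w, w.1 * f w ∂gauss2 = ∫ w, f' w ∂gauss2 := by
  rw [integral_prod_symm _ (integrable_fst_mul hf hC),
    integral_prod_symm _ (integrable_of_abs_le hf' hC')]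
  congr 1; ext y
  exact integral_id_mul_gaussian (fun x => hd x y) (by fun_prop) (fun x => hC _) fun x => hC' _

theorem integral_snd_mul_gauss2 {f f' : ℝ × ℝ → ℝ} {C : ℝ}
    (hd : ∀ x y, HasDerivAt (fun y => f (x, y)) (f' (x, y)) y) (hf : Continuous f)
    (hf' : Continuous f') (hC : ∀ w, |f w| ≤ C) (hC' : ∀ w, |f' w| ≤ C) :
    ∫ w, w.2 * f w ∂gauss2 = ∫ w, f' w ∂gauss2 := by
  rw [integral_prod _ (integrable_snd_mul hf hC),
    integral_prod _ (integrable_of_abs_le hf' hC')]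
  congr 1; ext x
  exact integral_id_mul_gaussian (fun y => hd x y) (by fun_prop) (fun y => hC _) fun y => hC' _

/-! ### Covariances of `tanh` -/

theorem abs_mul_le_one {x y : ℝ} (hx : |x| ≤ 1) (hy : |y| ≤ 1) : |x * y| ≤ 1 := by
  rw [abs_mul]; exact mul_le_one₀ hx (abs_nonneg _) hy

/-- Averaging over the sign of `w.2` isolates `s` in a single `cosh` in the denominator, so that
monotonicity in `|s|` becomes visible pointwise. -/
theorem integral_tanh_symmetrize (p r s : ℝ) :
    ∫ w, tanh (p * w.1 + 0 * w.2) * tanh (r * w.1 + s * w.2) ∂gauss2 =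
      ∫ w, tanh (p * w.1) * sinh (2 * (r * w.1)) /
        (cosh (2 * (r * w.1)) + cosh (2 * (s * w.2))) ∂gauss2 := by
  have c := continuous_tanh
  have i1 : Integrable (fun w : ℝ × ℝ => tanh (p * w.1) * tanh (r * w.1 + s * w.2)) gauss2 :=
    integrable_of_abs_le (by fun_prop) fun w =>
      abs_mul_le_one (abs_tanh_le_one _) (abs_tanh_le_one _)
  have i2 : Integrable (fun w : ℝ × ℝ => tanh (p * w.1) * tanh (r * w.1 - s * w.2)) gauss2 :=
    integrable_of_abs_le (by fun_prop) fun w =>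
      abs_mul_le_one (abs_tanh_le_one _) (abs_tanh_le_one _)
  have h1 : ∫ w, tanh (p * w.1) * tanh (r * w.1 - s * w.2) ∂gauss2 =
      ∫ w, tanh (p * w.1) * tanh (r * w.1 + s * w.2) ∂gauss2 := by
    rw [← integral_neg_snd_gauss2]
    simp only [mul_neg, sub_neg_eq_add]
  have h2 := integral_add i1 i2
  rw [h1] at h2
  have h3 : ∫ w : ℝ × ℝ, (tanh (p * w.1) * tanh (r * w.1 + s * w.2) +
      tanh (p * w.1) * tanh (r * w.1 - s * w.2)) ∂gauss2 =
      2 * ∫ w : ℝ × ℝ, tanh (p * w.1) * sinh (2 * (r * w.1)) /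
        (cosh (2 * (r * w.1)) + cosh (2 * (s * w.2))) ∂gauss2 := by
    rw [← integral_const_mul]
    congr 1; ext w
    rw [← mul_add, tanh_add_tanh_sub]
    ring
  rw [h3] at h2
  simp only [zero_mul, add_zero]
  linarith

theorem pairExp_tanh_eq {a b d p r s : ℝ} (hd : d = p ^ 2) (hb : b = p * r)
    (ha : a = r ^ 2 + s ^ 2) (ha0 : 0 ≤ a) (hd0 : 0 ≤ d) (h : b ^ 2 ≤ a * d) :
    pairExp tanh a b d = ∫ w, tanh (p * w.1) * sinh (2 * (r * w.1)) /
        (cosh (2 * (r * w.1)) + cosh (2 * (s * w.2))) ∂gauss2 := by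
  have hm := continuous_tanh.measurable
  rw [pairExp_comm hm ha0 hd0 h, pairExp_eq_integral_prod hm p 0 r s (by simpa using hd)
    (by simpa using hb) ha, integral_tanh_symmetrize]

theorem tanh_mul_sinh_mul_nonneg {p r : ℝ} (h : 0 ≤ p * r) (x : ℝ) :
    0 ≤ tanh (p * x) * sinh (2 * (r * x)) :=
  tanh_mul_sinh_nonneg (by nlinarith [mul_nonneg h (sq_nonneg x)])

theorem pairExp_tanh_nonneg {a b d : ℝ} (ha : 0 ≤ a) (hd : 0 ≤ d) (h : b ^ 2 ≤ a * d)
    (hb : 0 ≤ b) : 0 ≤ pairExp tanh a b d := by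
  obtain ⟨p, r, s, h1, h2, h3⟩ := exists_pair_factorization hd ha (by linarith : b ^ 2 ≤ d * a)
  rw [pairExp_tanh_eq h1 h2 h3 ha hd h]
  refine integral_nonneg fun w => div_nonneg (tanh_mul_sinh_mul_nonneg (h2 ▸ hb) _) ?_
  have := Real.cosh_pos (2 * (r * w.1))
  have := Real.cosh_pos (2 * (s * w.2))
  positivity

/-- For nonnegatively correlated pairs the covariance of `tanh` decreases with the variances. -/
theorem pairExp_tanh_antitone_left {a a' b d : ℝ} (ha : 0 ≤ a) (haa' : a ≤ a') (hd : 0 ≤ d)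
    (h : b ^ 2 ≤ a * d) (hb : 0 ≤ b) : pairExp tanh a' b d ≤ pairExp tanh a b d := by
  obtain ⟨p, r, s, h1, h2, h3⟩ := exists_pair_factorization hd ha (by linarith : b ^ 2 ≤ d * a)
  -- Raising `a` at fixed `b` and `d` keeps `p` and `r` and only enlarges `|s|`, hence the
  -- denominator; the numerator is nonnegative because `p r = b ≥ 0`.
  have ha' : a' = r ^ 2 + √(a' - r ^ 2) ^ 2 := by
    rw [Real.sq_sqrt (by nlinarith [sq_nonneg s])]; ring
  have h' : b ^ 2 ≤ a' * d := h.trans (by gcongr)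
  rw [pairExp_tanh_eq h1 h2 h3 ha hd h, pairExp_tanh_eq h1 h2 ha' (ha.trans haa') hd h']
  set s' := √(a' - r ^ 2)
  have hss : |s| ≤ |s'| := by
    rw [← sq_le_sq]; linarith
  have hc : ∀ (t : ℝ) (w : ℝ × ℝ), 0 < cosh (2 * (r * w.1)) + cosh (2 * (t * w.2)) :=
    fun t w => add_pos (Real.cosh_pos _) (Real.cosh_pos _)
  have hcont : ∀ t : ℝ, Continuous fun w : ℝ × ℝ => tanh (p * w.1) * sinh (2 * (r * w.1)) /
        (cosh (2 * (r * w.1)) + cosh (2 * (t * w.2))) := fun t => by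
    have c := continuous_tanh
    have c1 := Real.continuous_sinh
    have c2 := Real.continuous_cosh
    refine Continuous.div (by fun_prop) (by fun_prop) fun w => (hc t w).ne'
  have hint : ∀ t : ℝ, Integrable (fun w : ℝ × ℝ => tanh (p * w.1) * sinh (2 * (r * w.1)) /
        (cosh (2 * (r * w.1)) + cosh (2 * (t * w.2)))) gauss2 := fun t => by
    refine integrable_of_abs_le (hcont t) (C := 1) fun w => ?_
    rw [abs_div, abs_mul, abs_of_pos (hc t w), div_le_one (hc t w)]
    have h4 : |sinh (2 * (r * w.1))| ≤ cosh (2 * (r * w.1)) := by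
      rw [Real.abs_sinh, ← Real.cosh_abs]; exact (Real.sinh_lt_cosh _).le
    have h5 := Real.cosh_pos (2 * (t * w.2))
    have h6 := abs_tanh_le_one (p * w.1)
    nlinarith [abs_nonneg (sinh (2 * (r * w.1))), abs_nonneg (tanh (p * w.1))]
  refine integral_mono (hint s') (hint s) fun w => ?_
  refine div_le_div_of_nonneg_left (tanh_mul_sinh_mul_nonneg (h2 ▸ hb) _) (hc s w) ?_
  gcongr
  rw [Real.cosh_le_cosh]
  simp only [abs_mul]
  gcongr

/-- Raising the two variances one at a time reduces lower bounds to pairs of equal variance, where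
the rotation argument applies. -/
theorem pairExp_tanh_antitone {a b d Q : ℝ} (ha : 0 ≤ a) (haQ : a ≤ Q) (hd : 0 ≤ d) (hdQ : d ≤ Q)
    (h : b ^ 2 ≤ a * d) (hb : 0 ≤ b) : pairExp tanh Q b Q ≤ pairExp tanh a b d := by
  have hm := continuous_tanh.measurable
  have hQ : 0 ≤ Q := ha.trans haQ
  have h1 : b ^ 2 ≤ Q * d := h.trans (by gcongr)
  have h2 : b ^ 2 ≤ Q * Q := h1.trans (by gcongr)
  calc pairExp tanh Q b Q ≤ pairExp tanh d b Q :=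
        pairExp_tanh_antitone_left hd hdQ hQ (by linarith) hb
    _ = pairExp tanh Q b d := pairExp_comm hm hd hQ (by linarith)
    _ ≤ pairExp tanh a b d := pairExp_tanh_antitone_left ha haQ hd h hb

/-- Covariance of `tanh` along a rotation of a standard Gaussian pair. -/
noncomputable def rotExp (Q θ : ℝ) : ℝ :=
  ∫ w, tanh (√Q * Real.cos θ * w.1 + √Q * Real.sin θ * w.2) *
    tanh (√Q * Real.cos θ * w.1 - √Q * Real.sin θ * w.2) ∂gauss2

theorem pairExp_rotation {ψ : ℝ → ℝ} (hψ : Measurable ψ) {Q : ℝ} (hQ : 0 ≤ Q) (θ : ℝ) :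
    pairExp ψ Q (Q * Real.cos (2 * θ)) Q =
      ∫ w, ψ (√Q * Real.cos θ * w.1 + √Q * Real.sin θ * w.2) *
        ψ (√Q * Real.cos θ * w.1 - √Q * Real.sin θ * w.2) ∂gauss2 := by
  have h1 : Q = (√Q * Real.cos θ) ^ 2 + (√Q * Real.sin θ) ^ 2 := by
    rw [mul_pow, mul_pow, ← mul_add, Real.cos_sq_add_sin_sq, Real.sq_sqrt hQ, mul_one]
  rw [pairExp_eq_integral_prod hψ (√Q * Real.cos θ) (√Q * Real.sin θ) (√Q * Real.cos θ)
    (-(√Q * Real.sin θ)) h1 ?_ (by rw [neg_sq]; exact h1)]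
  · simp only [neg_mul, ← sub_eq_add_neg]
  · have h2 : √Q * √Q = Q := Real.mul_self_sqrt hQ
    rw [Real.cos_two_mul']
    linear_combination -(Real.cos θ ^ 2 - Real.sin θ ^ 2) * h2

theorem integral_sq_rotation {ψ : ℝ → ℝ} (hψ : Measurable ψ) {Q : ℝ} (hQ : 0 ≤ Q) (θ : ℝ) :
    ∫ w, ψ (√Q * Real.cos θ * w.1 + √Q * Real.sin θ * w.2) ^ 2 ∂gauss2 =
      ∫ x, ψ (√Q * x) ^ 2 ∂(gaussianReal 0 1) := by
  have h1 : Q = (√Q * Real.cos θ) ^ 2 + (√Q * Real.sin θ) ^ 2 := by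
    rw [mul_pow, mul_pow, ← mul_add, Real.cos_sq_add_sin_sq, Real.sq_sqrt hQ, mul_one]
  rw [← pairExp_self hψ hQ, pairExp_eq_integral_prod hψ (√Q * Real.cos θ) (√Q * Real.sin θ)
    (√Q * Real.cos θ) (√Q * Real.sin θ) h1 (by rw [← sq, ← sq]; exact h1) h1]
  simp only [sq]

/-- Differentiation under the integral produces factors `w.1` and `w.2`, which Gaussian integration
by parts removes. The terms that differentiate `sechSq` cancel, leaving the covariance of the
derivatives: `d/db 𝔼[φφ] = 𝔼[φ'φ']` along `b = Q cos 2θ`. -/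
theorem hasDerivAt_rotExp {Q : ℝ} (hQ : 0 ≤ Q) (θ : ℝ) :
    HasDerivAt (rotExp Q) (-(2 * Q * Real.sin (2 * θ)) *
      ∫ w, sechSq (√Q * Real.cos θ * w.1 + √Q * Real.sin θ * w.2) *
        sechSq (√Q * Real.cos θ * w.1 - √Q * Real.sin θ * w.2) ∂gauss2) θ := by
  have c := continuous_tanh
  have c' := continuous_sechSq
  set q := √Q
  have hq : 0 ≤ q := Real.sqrt_nonneg Q
  set F' : ℝ → ℝ × ℝ → ℝ := fun θ w =>
    sechSq (q * Real.cos θ * w.1 + q * Real.sin θ * w.2) *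
      (q * -Real.sin θ * w.1 + q * Real.cos θ * w.2) *
      tanh (q * Real.cos θ * w.1 - q * Real.sin θ * w.2) +
    tanh (q * Real.cos θ * w.1 + q * Real.sin θ * w.2) *
      (sechSq (q * Real.cos θ * w.1 - q * Real.sin θ * w.2) *
      (q * -Real.sin θ * w.1 - q * Real.cos θ * w.2))
  have hF' : ∀ θ w, HasDerivAt (fun θ => tanh (q * Real.cos θ * w.1 + q * Real.sin θ * w.2) *
    tanh (q * Real.cos θ * w.1 - q * Real.sin θ * w.2)) (F' θ w) θ := by
    intro θ w
    have e1 : HasDerivAt (fun θ => q * Real.cos θ * w.1) (q * -Real.sin θ * w.1) θ :=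
      ((Real.hasDerivAt_cos θ).const_mul q).mul_const _
    have e2 : HasDerivAt (fun θ => q * Real.sin θ * w.2) (q * Real.cos θ * w.2) θ :=
      ((Real.hasDerivAt_sin θ).const_mul q).mul_const _
    exact ((hasDerivAt_tanh _).comp θ (e1.add e2)).mul ((hasDerivAt_tanh _).comp θ (e1.sub e2))
  have hbound : ∀ θ w, ‖F' θ w‖ ≤ 2 * q * (|w.1| + |w.2|) := by
    intro θ w
    have hlin : ∀ s t : ℝ, |s| ≤ 1 → |t| ≤ 1 → |q * s * w.1 + q * t * w.2| ≤
        q * (|w.1| + |w.2|) := fun s t hs ht => by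
      refine (abs_add_le _ _).trans ?_
      rw [abs_mul, abs_mul, abs_mul, abs_mul, abs_of_nonneg hq]
      have h1 : q * |s| * |w.1| ≤ q * 1 * |w.1| := by gcongr
      have h2 : q * |t| * |w.2| ≤ q * 1 * |w.2| := by gcongr
      linarith
    have k1 : |q * -Real.sin θ * w.1 + q * Real.cos θ * w.2| ≤ q * (|w.1| + |w.2|) :=
      hlin _ _ (by rw [abs_neg]; exact Real.abs_sin_le_one θ) (Real.abs_cos_le_one θ)
    have k2 : |q * -Real.sin θ * w.1 - q * Real.cos θ * w.2| ≤ q * (|w.1| + |w.2|) := by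
      have := hlin (-Real.sin θ) (-Real.cos θ) (by rw [abs_neg]; exact Real.abs_sin_le_one θ)
        (by rw [abs_neg]; exact Real.abs_cos_le_one θ)
      convert this using 2; ring
    have hmul : ∀ x y z B : ℝ, |x| ≤ 1 → |z| ≤ 1 → |y| ≤ B → |x * y * z| ≤ B := by
      intro x y z B hx hz hy
      rw [abs_mul, abs_mul]
      calc |x| * |y| * |z| ≤ 1 * |y| * 1 := by gcongr
        _ ≤ B := by linarith
    have m1 := hmul (sechSq (q * Real.cos θ * w.1 + q * Real.sin θ * w.2)) _
      (tanh (q * Real.cos θ * w.1 - q * Real.sin θ * w.2)) _ (abs_sechSq_le_one _)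
      (abs_tanh_le_one _) k1
    have m2 := hmul (tanh (q * Real.cos θ * w.1 + q * Real.sin θ * w.2)) _
      (sechSq (q * Real.cos θ * w.1 - q * Real.sin θ * w.2)) _ (abs_tanh_le_one _)
      (abs_sechSq_le_one _) k2
    rw [mul_assoc, mul_comm (q * -Real.sin θ * w.1 - q * Real.cos θ * w.2)] at m2
    rw [Real.norm_eq_abs]
    refine (abs_add_le _ _).trans ?_
    linarith
  have hbi : Integrable (fun w : ℝ × ℝ => 2 * q * (|w.1| + |w.2|)) gauss2 :=
    ((memLp_fst_gauss2.integrable one_le_two).abs.add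
      (memLp_snd_gauss2.integrable one_le_two).abs).const_mul _
  have main := (hasDerivAt_integral_of_dominated_loc_of_deriv_le (μ := gauss2)
    (F := fun θ w => tanh (q * Real.cos θ * w.1 + q * Real.sin θ * w.2) *
      tanh (q * Real.cos θ * w.1 - q * Real.sin θ * w.2)) (F' := F') (x₀ := θ)
    (bound := fun w => 2 * q * (|w.1| + |w.2|)) Filter.univ_mem
    (Filter.Eventually.of_forall fun θ => Continuous.aestronglyMeasurable (by fun_prop))
    (integrable_of_abs_le (by fun_prop) fun w =>
      abs_mul_le_one (abs_tanh_le_one _) (abs_tanh_le_one _))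
    (Continuous.aestronglyMeasurable (by simp only [F']; fun_prop))
    (ae_of_all _ fun w θ _ => hbound θ w) hbi (ae_of_all _ fun w θ _ => hF' θ w)).2
  refine main.congr_deriv ?_
  set α := q * Real.cos θ
  set β := q * Real.sin θ
  set g₁ : ℝ × ℝ → ℝ := fun w => sechSq (α * w.1 + β * w.2) * tanh (α * w.1 - β * w.2)
  set g₂ : ℝ × ℝ → ℝ := fun w => tanh (α * w.1 + β * w.2) * sechSq (α * w.1 - β * w.2)
  set D : ℝ × ℝ → ℝ := fun w => sechSq (α * w.1 + β * w.2) * sechSq (α * w.1 - β * w.2)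
  set E : ℝ × ℝ → ℝ := fun w => tanh (α * w.1 + β * w.2) * sechSq (α * w.1 + β * w.2) *
    tanh (α * w.1 - β * w.2)
  set H : ℝ × ℝ → ℝ := fun w => tanh (α * w.1 + β * w.2) * (tanh (α * w.1 - β * w.2) *
    sechSq (α * w.1 - β * w.2))
  have hD1 : ∀ w, |D w| ≤ 1 := fun w =>
    abs_mul_le_one (abs_sechSq_le_one _) (abs_sechSq_le_one _)
  have hE1 : ∀ w, |E w| ≤ 1 := fun w =>
    abs_mul_le_one (abs_mul_le_one (abs_tanh_le_one _) (abs_sechSq_le_one _)) (abs_tanh_le_one _)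
  have hH1 : ∀ w, |H w| ≤ 1 := fun w =>
    abs_mul_le_one (abs_tanh_le_one _) (abs_mul_le_one (abs_tanh_le_one _) (abs_sechSq_le_one _))
  have hg1 : ∀ w, |g₁ w| ≤ 1 := fun w => abs_mul_le_one (abs_sechSq_le_one _) (abs_tanh_le_one _)
  have hg2 : ∀ w, |g₂ w| ≤ 1 := fun w => abs_mul_le_one (abs_tanh_le_one _) (abs_sechSq_le_one _)
  have cD : Continuous D := by simp only [D]; fun_prop
  have cE : Continuous E := by simp only [E]; fun_prop
  have cH : Continuous H := by simp only [H]; fun_prop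
  have cg1 : Continuous g₁ := by simp only [g₁]; fun_prop
  have cg2 : Continuous g₂ := by simp only [g₂]; fun_prop
  have iD := integrable_of_abs_le cD hD1
  have iE := integrable_of_abs_le cE hE1
  have iH := integrable_of_abs_le cH hH1
  set C := 1 + 3 * |α| + 3 * |β|
  have hC1 : 1 ≤ C := by simp only [C]; linarith [abs_nonneg α, abs_nonneg β]
  have hαC : ∀ x y : ℝ, |x| ≤ 1 → |y| ≤ 1 → |α * (x - 2 * y)| ≤ C := fun x y hx hy => by
    rw [abs_mul]
    have : |x - 2 * y| ≤ 3 := (abs_sub _ _).trans (by rw [abs_mul, abs_two]; linarith)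
    have := mul_le_mul_of_nonneg_left this (abs_nonneg α)
    simp only [C]; linarith [abs_nonneg β]
  have hβC : ∀ x y : ℝ, |x| ≤ 1 → |y| ≤ 1 → |β * (x + 2 * y)| ≤ C := fun x y hx hy => by
    rw [abs_mul]
    have : |x + 2 * y| ≤ 3 := (abs_add_le _ _).trans (by rw [abs_mul, abs_two]; linarith)
    have := mul_le_mul_of_nonneg_left this (abs_nonneg β)
    simp only [C]; linarith [abs_nonneg α]
  have dx : ∀ (t x y : ℝ), HasDerivAt (fun x => α * x + t * y) α x := fun t x y => by
    simpa using ((hasDerivAt_id x).const_mul α).add_const (t * y)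
  have dx' : ∀ (x y : ℝ), HasDerivAt (fun x => α * x - β * y) α x := fun x y => by
    simpa using ((hasDerivAt_id x).const_mul α).sub_const (β * y)
  have dy : ∀ (x y : ℝ), HasDerivAt (fun y => α * x + β * y) β y := fun x y => by
    simpa using ((hasDerivAt_id y).const_mul β).const_add (α * x)
  have dy' : ∀ (x y : ℝ), HasDerivAt (fun y => α * x - β * y) (-β) y := fun x y => by
    simpa using ((hasDerivAt_id y).const_mul β).const_sub (α * x)
  have s1 : ∫ w, w.1 * g₁ w ∂gauss2 = ∫ w, α * (D w - 2 * E w) ∂gauss2 := by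
    refine integral_fst_mul_gauss2 (C := C) (fun x y => ?_) cg1 (by fun_prop)
      (fun w => (hg1 w).trans hC1) (fun w => hαC _ _ (hD1 w) (hE1 w))
    refine (((hasDerivAt_sechSq _).comp x (dx β x y)).mul
      ((hasDerivAt_tanh _).comp x (dx' x y))).congr_deriv ?_
    simp only [D, E, Function.comp_apply]; ring
  have s2 : ∫ w, w.1 * g₂ w ∂gauss2 = ∫ w, α * (D w - 2 * H w) ∂gauss2 := by
    refine integral_fst_mul_gauss2 (C := C) (fun x y => ?_) cg2 (by fun_prop)
      (fun w => (hg2 w).trans hC1) (fun w => hαC _ _ (hD1 w) (hH1 w))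
    refine (((hasDerivAt_tanh _).comp x (dx β x y)).mul
      ((hasDerivAt_sechSq _).comp x (dx' x y))).congr_deriv ?_
    simp only [D, H, Function.comp_apply]; ring
  have s3 : ∫ w, w.2 * g₁ w ∂gauss2 = ∫ w, β * -(D w + 2 * E w) ∂gauss2 := by
    refine integral_snd_mul_gauss2 (C := C) (fun x y => ?_) cg1 (by fun_prop)
      (fun w => (hg1 w).trans hC1)
      (fun w => by rw [mul_neg, abs_neg]; exact hβC _ _ (hD1 w) (hE1 w))
    refine (((hasDerivAt_sechSq _).comp y (dy x y)).mul
      ((hasDerivAt_tanh _).comp y (dy' x y))).congr_deriv ?_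
    simp only [D, E, Function.comp_apply]; ring
  have s4 : ∫ w, w.2 * g₂ w ∂gauss2 = ∫ w, β * (D w + 2 * H w) ∂gauss2 := by
    refine integral_snd_mul_gauss2 (C := C) (fun x y => ?_) cg2 (by fun_prop)
      (fun w => (hg2 w).trans hC1) (fun w => hβC _ _ (hD1 w) (hH1 w))
    refine (((hasDerivAt_tanh _).comp y (dy x y)).mul
      ((hasDerivAt_sechSq _).comp y (dy' x y))).congr_deriv ?_
    simp only [D, H, Function.comp_apply]; ring
  have i1 := integrable_fst_mul cg1 hg1
  have i2 := integrable_fst_mul cg2 hg2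
  have i3 := integrable_snd_mul cg1 hg1
  have i4 := integrable_snd_mul cg2 hg2
  have hsplit : ∫ w, F' θ w ∂gauss2 = -β * ∫ w, w.1 * g₁ w ∂gauss2 - β * ∫ w, w.1 * g₂ w ∂gauss2 +
      (α * ∫ w, w.2 * g₁ w ∂gauss2 - α * ∫ w, w.2 * g₂ w ∂gauss2) := by
    have i12 : Integrable (fun w : ℝ × ℝ => -β * (w.1 * g₁ w) - β * (w.1 * g₂ w)) gauss2 :=
      (i1.const_mul _).sub (i2.const_mul _)
    have i34 : Integrable (fun w : ℝ × ℝ => α * (w.2 * g₁ w) - α * (w.2 * g₂ w)) gauss2 :=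
      (i3.const_mul _).sub (i4.const_mul _)
    rw [← integral_const_mul, ← integral_const_mul, ← integral_const_mul, ← integral_const_mul,
      ← integral_sub (i1.const_mul _) (i2.const_mul _),
      ← integral_sub (i3.const_mul _) (i4.const_mul _),
      ← integral_add i12 i34]
    congr 1; ext w
    simp only [F', g₁, g₂, α, β]
    ring
  have hαβ : 4 * (α * β) = 2 * Q * Real.sin (2 * θ) := by
    have : q * q = Q := Real.mul_self_sqrt hQ
    rw [Real.sin_two_mul]
    simp only [α, β]
    linear_combination (4 * Real.cos θ * Real.sin θ) * this
  -- In the four contributions the terms with `E` and `H` cancel, and `-4 α β ∫ D` is left.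
  rw [hsplit, s1, s2, s3, s4, ← hαβ]
  simp only [integral_const_mul]
  rw [integral_sub iD (iE.const_mul 2), integral_sub iD (iH.const_mul 2),
    integral_neg, integral_add iD (iE.const_mul 2), integral_add iD (iH.const_mul 2)]
  simp only [integral_const_mul]
  ring

/-- The slope `𝔼[sech⁴(√Q z)]` of the covariance of `tanh` at full correlation. -/
noncomputable def tanhSlope (Q : ℝ) : ℝ := ∫ x, sechSq (√Q * x) ^ 2 ∂(gaussianReal 0 1)

instance : Measure.IsOpenPosMeasure (gaussianReal 0 1) :=
  (gaussianReal_absolutelyContinuous' 0 one_ne_zero).isOpenPosMeasure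

/-- Twice the difference of the two sides is 𝔼[(X - Y)²], since `X` and `Y` have the same second
moment. It is positive because `X` and `Y` are continuous and distinct, and the Gaussian charges all
open sets. -/
theorem integral_sechSq_mul_lt {Q θ : ℝ} (hQ : 0 < Q) (h0 : 0 < θ) (h1 : θ < Real.pi / 2) :
    ∫ w, sechSq (√Q * Real.cos θ * w.1 + √Q * Real.sin θ * w.2) *
        sechSq (√Q * Real.cos θ * w.1 - √Q * Real.sin θ * w.2) ∂gauss2 < tanhSlope Q := by
  have c' := continuous_sechSq
  set X : ℝ × ℝ → ℝ := fun w => sechSq (√Q * Real.cos θ * w.1 + √Q * Real.sin θ * w.2)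
  set Y : ℝ × ℝ → ℝ := fun w => sechSq (√Q * Real.cos θ * w.1 - √Q * Real.sin θ * w.2)
  have hX : Continuous X := by simp only [X]; fun_prop
  have hY : Continuous Y := by simp only [Y]; fun_prop
  have eX : ∫ w, X w ^ 2 ∂gauss2 = tanhSlope Q := integral_sq_rotation c'.measurable hQ.le θ
  have eY : ∫ w, Y w ^ 2 ∂gauss2 = tanhSlope Q := by
    rw [← eX, ← integral_neg_snd_gauss2]
    simp only [X, Y, mul_neg, sub_neg_eq_add]
  have iX : Integrable (fun w => X w ^ 2) gauss2 :=
    integrable_of_abs_le (by fun_prop) (C := 1) fun w => by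
      rw [sq]; exact abs_mul_le_one (abs_sechSq_le_one _) (abs_sechSq_le_one _)
  have iY : Integrable (fun w => Y w ^ 2) gauss2 :=
    integrable_of_abs_le (by fun_prop) (C := 1) fun w => by
      rw [sq]; exact abs_mul_le_one (abs_sechSq_le_one _) (abs_sechSq_le_one _)
  have iXY : Integrable (fun w => X w * Y w) gauss2 :=
    integrable_of_abs_le (by fun_prop) (C := 1) fun w =>
      abs_mul_le_one (abs_sechSq_le_one _) (abs_sechSq_le_one _)
  have hexp : ∀ w, (X w - Y w) ^ 2 = X w ^ 2 + Y w ^ 2 - 2 * (X w * Y w) := fun w => by ring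
  have iS : Integrable (fun w => X w ^ 2 + Y w ^ 2) gauss2 := iX.add iY
  have iD : Integrable (fun w => (X w - Y w) ^ 2) gauss2 := by
    simp_rw [hexp]; exact iS.sub (iXY.const_mul 2)
  have hval : ∫ w, (X w - Y w) ^ 2 ∂gauss2 = 2 * tanhSlope Q - 2 * ∫ w, X w * Y w ∂gauss2 := by
    simp_rw [hexp]
    rw [integral_sub iS (iXY.const_mul 2), integral_add iX iY, integral_const_mul, eX, eY]
    ring
  have hnn : 0 ≤ ∫ w, (X w - Y w) ^ 2 ∂gauss2 := integral_nonneg fun w => sq_nonneg _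
  have hne : ∫ w, (X w - Y w) ^ 2 ∂gauss2 ≠ 0 := fun h => by
    rw [integral_eq_zero_iff_of_nonneg (fun w => sq_nonneg _) iD] at h
    have h2 : (fun w => (X w - Y w) ^ 2) = fun _ => 0 :=
      (Continuous.ae_eq_iff_eq gauss2 (by fun_prop) continuous_const).1 h
    have hs : 0 < √Q * Real.sin θ :=
      mul_pos (Real.sqrt_pos.2 hQ) (Real.sin_pos_of_pos_of_lt_pi h0 (by linarith))
    have hcos : 0 < √Q * Real.cos θ :=
      mul_pos (Real.sqrt_pos.2 hQ) (Real.cos_pos_of_mem_Ioo ⟨by linarith, by linarith⟩)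
    -- At this point the arguments of the two factors are `2` and `0`.
    have h3 := congrFun h2 ((√Q * Real.cos θ)⁻¹, (√Q * Real.sin θ)⁻¹)
    have h4 : X ((√Q * Real.cos θ)⁻¹, (√Q * Real.sin θ)⁻¹) = sechSq 2 := by
      simp only [X, mul_inv_cancel₀ hs.ne', mul_inv_cancel₀ hcos.ne']; norm_num
    have h5 : Y ((√Q * Real.cos θ)⁻¹, (√Q * Real.sin θ)⁻¹) = 1 := by
      simp only [Y, mul_inv_cancel₀ hs.ne', mul_inv_cancel₀ hcos.ne']; simp [sechSq]
    simp only [h4, h5] at h3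
    have h6 : tanh 2 = 0 := by
      have : (sechSq 2 - 1) ^ 2 = 0 := h3
      simpa [sechSq] using this
    have h7 : 0 < tanh 2 := by
      simpa using tanh_strictMono (show (0 : ℝ) < 2 by norm_num)
    exact h7.ne' h6
  have := lt_of_le_of_ne hnn hne.symm
  rw [hval] at this
  simp only [X, Y] at this
  linarith

/-- As a function of the covariance, 𝔼[tanh tanh] has slope below its value `tanhSlope Q` at full
correlation. In the angle this says that `rotExp Q θ - tanhSlope Q * (Q cos 2θ)` increases strictly;
it is compared at `0` and at `arccos (b / Q) / 2`. -/
theorem pairExp_tanh_gap_strict {Q b : ℝ} (hQ : 0 < Q) (hb0 : 0 ≤ b) (hbQ : b < Q) :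
    pairExp tanh Q Q Q - pairExp tanh Q b Q < tanhSlope Q * (Q - b) := by
  have hm := continuous_tanh.measurable
  have hd : ∀ θ, HasDerivAt (fun θ => rotExp Q θ - tanhSlope Q * (Q * Real.cos (2 * θ)))
      (2 * Q * Real.sin (2 * θ) * (tanhSlope Q -
      ∫ w, sechSq (√Q * Real.cos θ * w.1 + √Q * Real.sin θ * w.2) *
        sechSq (√Q * Real.cos θ * w.1 - √Q * Real.sin θ * w.2) ∂gauss2)) θ := fun θ => by
    have h1 : HasDerivAt (fun θ : ℝ => 2 * θ) 2 θ := by simpa using (hasDerivAt_id θ).const_mul 2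
    have h2 := (((Real.hasDerivAt_cos (2 * θ)).comp θ h1).const_mul Q).const_mul (tanhSlope Q)
    refine ((hasDerivAt_rotExp hQ.le θ).sub h2).congr_deriv ?_
    ring
  have hmono : StrictMonoOn (fun θ => rotExp Q θ - tanhSlope Q * (Q * Real.cos (2 * θ)))
      (Set.Icc 0 (Real.pi / 4)) := by
    refine strictMonoOn_of_deriv_pos (convex_Icc _ _)
      (fun θ _ => (hd θ).continuousAt.continuousWithinAt) fun θ hθ => ?_
    rw [interior_Icc, Set.mem_Ioo] at hθ
    rw [(hd θ).deriv]
    have h1 := integral_sechSq_mul_lt hQ hθ.1 (by linarith [Real.pi_pos])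
    have h2 := Real.sin_pos_of_pos_of_lt_pi (x := 2 * θ) (by linarith) (by linarith [Real.pi_pos])
    have h3 : 0 < 2 * Q * Real.sin (2 * θ) := by positivity
    exact mul_pos h3 (by linarith)
  set θ := Real.arccos (b / Q) / 2
  have hbq : b / Q < 1 := (div_lt_one hQ).2 hbQ
  have hbq0 : 0 ≤ b / Q := by positivity
  have hcos : Q * Real.cos (2 * θ) = b := by
    rw [show 2 * θ = Real.arccos (b / Q) by simp only [θ]; ring,
      Real.cos_arccos (by linarith) hbq.le]
    field_simp
  have hθ0 : 0 < θ := half_pos (Real.arccos_pos.2 hbq)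
  have hθ1 : θ ≤ Real.pi / 4 := by
    have := Real.arccos_le_pi_div_two.2 hbq0
    simp only [θ]; linarith
  have h := hmono ⟨le_rfl, by positivity⟩ ⟨hθ0.le, hθ1⟩ hθ0
  have e0 : rotExp Q 0 = pairExp tanh Q Q Q := by
    have := pairExp_rotation hm hQ.le 0
    simp only [mul_zero, Real.cos_zero, mul_one] at this
    rw [this]; simp [rotExp]
  have e1 : rotExp Q θ = pairExp tanh Q b Q := by
    rw [← hcos]; exact (pairExp_rotation hm hQ.le θ).symm
  simp only [e0, e1, hcos, mul_zero, Real.cos_zero, mul_one] at h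
  linarith

theorem pairExp_tanh_gap {Q b : ℝ} (hQ : 0 < Q) (hb0 : 0 ≤ b) (hbQ : b ≤ Q) :
    pairExp tanh Q Q Q - pairExp tanh Q b Q ≤ tanhSlope Q * (Q - b) := by
  rcases hbQ.eq_or_lt with rfl | h
  · simp
  · exact (pairExp_tanh_gap_strict hQ hb0 h).le

theorem integrable_gaussian_of_abs_le {f : ℝ → ℝ} (hf : Continuous f) {C : ℝ}
    (h : ∀ x, |f x| ≤ C) : Integrable f (gaussianReal 0 1) :=
  Integrable.of_bound hf.aestronglyMeasurable C (ae_of_all _ h)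

theorem integrable_tanh_sq (c : ℝ) : Integrable (fun x => tanh (c * x) ^ 2) (gaussianReal 0 1) :=
  have := continuous_tanh
  integrable_gaussian_of_abs_le (by fun_prop) (C := 1) fun x => by
    rw [sq]; exact abs_mul_le_one (abs_tanh_le_one _) (abs_tanh_le_one _)

theorem integrable_sechSq_sq (c : ℝ) :
    Integrable (fun x => sechSq (c * x) ^ 2) (gaussianReal 0 1) :=
  have := continuous_sechSq
  integrable_gaussian_of_abs_le (by fun_prop) (C := 1) fun x => by
    rw [sq]; exact abs_mul_le_one (abs_sechSq_le_one _) (abs_sechSq_le_one _)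

theorem tanhSlope_antitone {q Q : ℝ} (h : q ≤ Q) : tanhSlope Q ≤ tanhSlope q := by
  refine integral_mono (integrable_sechSq_sq _) (integrable_sechSq_sq _) fun x => ?_
  refine pow_le_pow_left₀ (sechSq_pos _).le (sub_le_sub_left (tanh_sq_le_of_abs_le ?_) 1) 2
  rw [abs_mul, abs_mul, abs_of_nonneg (Real.sqrt_nonneg _), abs_of_nonneg (Real.sqrt_nonneg _)]
  gcongr

theorem pairExp_tanh_diag_mono {a a' : ℝ} (ha : 0 ≤ a) (h : a ≤ a') :
    pairExp tanh a a a ≤ pairExp tanh a' a' a' := by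
  have hm := continuous_tanh.measurable
  rw [pairExp_self hm ha, pairExp_self hm (ha.trans h)]
  refine integral_mono (integrable_tanh_sq _) (integrable_tanh_sq _) fun x => ?_
  refine tanh_sq_le_of_abs_le ?_
  rw [abs_mul, abs_mul, abs_of_nonneg (Real.sqrt_nonneg _), abs_of_nonneg (Real.sqrt_nonneg _)]
  gcongr

/-- The variance of `tanh` is sublinear in the variance of its argument. -/
theorem pairExp_tanh_diag_sublinear {a a' : ℝ} (ha : 0 < a) (h : a ≤ a') :
    a * pairExp tanh a' a' a' ≤ a' * pairExp tanh a a a := by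
  have hm := continuous_tanh.measurable
  have ha' : 0 < a' := ha.trans_le h
  rw [pairExp_self hm ha.le, pairExp_self hm ha'.le, ← integral_const_mul, ← integral_const_mul]
  refine integral_mono ((integrable_tanh_sq _).const_mul _) ((integrable_tanh_sq _).const_mul _)
    fun x => ?_
  have hs : 0 < √a := Real.sqrt_pos.2 ha
  have h1 : 1 ≤ √a' / √a := (one_le_div hs).2 (Real.sqrt_le_sqrt h)
  have h2 := tanh_mul_sq_le h1 (√a * x)
  rw [← mul_assoc, div_mul_cancel₀ _ hs.ne', div_pow, Real.sq_sqrt ha.le, Real.sq_sqrt ha'.le] at h2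
  calc a * tanh (√a' * x) ^ 2 ≤ a * (a' / a * tanh (√a * x) ^ 2) := by gcongr
    _ = a' * tanh (√a * x) ^ 2 := by field_simp

theorem pairExp_tanh_le_half {a b d : ℝ} (ha : 0 ≤ a) (hd : 0 ≤ d) (h : b ^ 2 ≤ a * d) :
    pairExp tanh a b d ≤ (pairExp tanh a a a + pairExp tanh d d d) / 2 := by
  have hm := continuous_tanh.measurable
  have c := continuous_tanh
  obtain ⟨p, r, s, h1, h2, h3⟩ := exists_pair_factorization ha hd h
  have hp := pairExp_eq_integral_prod hm p 0 p 0 (a := a) (b := a) (d := a) (by simpa using h1)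
    (by linarith) (by simpa using h1)
  have hd' := pairExp_eq_integral_prod hm r s r s (a := d) (b := d) (d := d) h3
    (by linarith) h3
  rw [pairExp_eq_integral_prod hm p 0 r s (by simpa using h1) (by simpa using h2) h3, hp, hd']
  have hi : ∀ p q r s : ℝ, Integrable (fun w : ℝ × ℝ =>
      tanh (p * w.1 + q * w.2) * tanh (r * w.1 + s * w.2)) gauss2 := fun p q r s =>
    integrable_of_abs_le (by fun_prop) fun w =>
      abs_mul_le_one (abs_tanh_le_one _) (abs_tanh_le_one _)
  rw [← integral_add (hi _ _ _ _) (hi _ _ _ _), ← integral_div]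
  refine integral_mono (hi _ _ _ _) (((hi _ _ _ _).add (hi _ _ _ _)).div_const 2) fun w => ?_
  have := two_mul_le_add_sq (tanh (p * w.1 + 0 * w.2)) (tanh (r * w.1 + s * w.2))
  nlinarith

/-- Polarization: `2XY = X² + Y² - (X - Y)²`. Each second moment is within `4ε / √q` of `tanhSlope
q`, and 𝔼[(X - Y)²] ≤ 4(a + d - 2b) ≤ 16ε because `sechSq` is 2-Lipschitz. -/
theorem abs_pairExp_sechSq_sub_le {a b d q ε : ℝ} (hq : 0 < q) (ha : 0 ≤ a) (hd : 0 ≤ d)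
    (h : b ^ 2 ≤ a * d) (haε : |a - q| ≤ ε) (hbε : |b - q| ≤ ε) (hdε : |d - q| ≤ ε) :
    |pairExp sechSq a b d - tanhSlope q| ≤ (4 / √q + 8) * ε := by
  have hm := continuous_sechSq.measurable
  have c := continuous_sechSq
  have hmarg : ∀ a, 0 ≤ a → |a - q| ≤ ε → |pairExp sechSq a a a - tanhSlope q| ≤ 4 / √q * ε := by
    intro a ha haε
    rw [pairExp_self hm ha, tanhSlope, ← integral_sub (integrable_sechSq_sq _)
      (integrable_sechSq_sq _)]
    have hsq : 0 < √q := Real.sqrt_pos.2 hq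
    have hs : |√a - √q| ≤ ε / √q := by
      rw [le_div_iff₀ hsq]
      have : (√a - √q) * (√a + √q) = a - q := by
        ring_nf; rw [Real.sq_sqrt ha, Real.sq_sqrt hq.le]
      calc |√a - √q| * √q ≤ |√a - √q| * |√a + √q| := by
            gcongr
            rw [abs_of_nonneg (by positivity)]
            linarith [Real.sqrt_nonneg a]
        _ = |a - q| := by rw [← abs_mul, this]
        _ ≤ ε := haε
    have hε : 0 ≤ ε := (abs_nonneg _).trans haε
    have hpt : ∀ x : ℝ, |sechSq (√a * x) ^ 2 - sechSq (√q * x) ^ 2| ≤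
        2 * (ε / √q) * (1 + x ^ 2) := fun x => by
      have e1 : sechSq (√a * x) ^ 2 - sechSq (√q * x) ^ 2 =
        (sechSq (√a * x) + sechSq (√q * x)) * (sechSq (√a * x) - sechSq (√q * x)) := by ring
      have e2 : |sechSq (√a * x) + sechSq (√q * x)| ≤ 2 :=
        (abs_add_le _ _).trans (by linarith [abs_sechSq_le_one (√a * x), abs_sechSq_le_one (√q * x)])
      have e3 := abs_sechSq_sub_le (√a * x) (√q * x)
      rw [← sub_mul, abs_mul] at e3
      have e4 : |√a - √q| * |x| ≤ ε / √q * |x| := by gcongr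
      have e5 : 2 * |x| ≤ 1 + x ^ 2 := by
        have := two_mul_le_add_sq 1 |x|
        rw [sq_abs] at this; linarith
      rw [e1, abs_mul]
      calc _ ≤ 2 * (2 * (ε / √q * |x|)) := by
            refine mul_le_mul e2 (e3.trans ?_) (abs_nonneg _) zero_le_two
            linarith
        _ = 2 * (ε / √q) * (2 * |x|) := by ring
        _ ≤ _ := by gcongr
    have hint : Integrable (fun x : ℝ => 2 * (ε / √q) * (1 + x ^ 2)) (gaussianReal 0 1) :=
      ((integrable_const 1).add integrable_sq_gaussian).const_mul _
    refine (norm_integral_le_of_norm_le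
      (f := fun x => sechSq (√a * x) ^ 2 - sechSq (√q * x) ^ 2) hint (ae_of_all _ hpt)).trans (le_of_eq ?_)
    rw [integral_const_mul, integral_add (integrable_const 1) integrable_sq_gaussian,
      integral_sq_gaussian]
    simp
    ring
  obtain ⟨p, r, s, h1, h2, h3⟩ := exists_pair_factorization ha hd h
  have ep := pairExp_eq_integral_prod hm p 0 p 0 (a := a) (b := a) (d := a) (by simpa using h1)
    (by linarith) (by simpa using h1)
  have ed := pairExp_eq_integral_prod hm r s r s (a := d) (b := d) (d := d) h3
    (by linarith) h3
  have eb := pairExp_eq_integral_prod hm p 0 r s (by simpa using h1) (by simpa using h2) h3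
  set X : ℝ × ℝ → ℝ := fun w => sechSq (p * w.1 + 0 * w.2)
  set Y : ℝ × ℝ → ℝ := fun w => sechSq (r * w.1 + s * w.2)
  have hX : Continuous X := by simp only [X]; fun_prop
  have hY : Continuous Y := by simp only [Y]; fun_prop
  have hX1 : ∀ w, |X w| ≤ 1 := fun w => abs_sechSq_le_one _
  have hY1 : ∀ w, |Y w| ≤ 1 := fun w => abs_sechSq_le_one _
  have iXX : Integrable (fun w => X w * X w) gauss2 :=
    integrable_of_abs_le (by fun_prop) fun w => abs_mul_le_one (hX1 w) (hX1 w)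
  have iYY : Integrable (fun w => Y w * Y w) gauss2 :=
    integrable_of_abs_le (by fun_prop) fun w => abs_mul_le_one (hY1 w) (hY1 w)
  have iXY : Integrable (fun w => X w * Y w) gauss2 :=
    integrable_of_abs_le (by fun_prop) fun w => abs_mul_le_one (hX1 w) (hY1 w)
  have hexp : ∀ w, (X w - Y w) ^ 2 = X w * X w + Y w * Y w - 2 * (X w * Y w) := fun w => by ring
  have iS : Integrable (fun w => X w * X w + Y w * Y w) gauss2 := iXX.add iYY
  have hval : ∫ w, (X w - Y w) ^ 2 ∂gauss2 =
      pairExp sechSq a a a + pairExp sechSq d d d - 2 * pairExp sechSq a b d := by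
    simp_rw [hexp]
    rw [integral_sub iS (iXY.const_mul 2), integral_add iXX iYY, integral_const_mul, ep, ed, eb]
  have hnn : 0 ≤ ∫ w, (X w - Y w) ^ 2 ∂gauss2 := integral_nonneg fun w => sq_nonneg _
  have hle : ∫ w, (X w - Y w) ^ 2 ∂gauss2 ≤ 4 * (a + d - 2 * b) := by
    have e1 : ∫ w : ℝ × ℝ, ((p - r) * w.1 + (-s) * w.2) ^ 2 ∂gauss2 = a + d - 2 * b := by
      rw [integral_linear_sq, h3, h2, h1]; ring
    rw [← e1, ← integral_const_mul]
    refine integral_mono_of_nonneg (ae_of_all _ fun w => sq_nonneg _)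
      ((memLp_linear_gauss2 _ _).integrable_sq.const_mul 4) (ae_of_all _ fun w => ?_)
    have e2 := abs_sechSq_sub_le (p * w.1 + 0 * w.2) (r * w.1 + s * w.2)
    have e3 : p * w.1 + 0 * w.2 - (r * w.1 + s * w.2) = (p - r) * w.1 + (-s) * w.2 := by ring
    rw [e3] at e2
    calc (X w - Y w) ^ 2 = |X w - Y w| ^ 2 := (sq_abs _).symm
      _ ≤ (2 * |(p - r) * w.1 + (-s) * w.2|) ^ 2 := by gcongr
      _ = 4 * ((p - r) * w.1 + (-s) * w.2) ^ 2 := by rw [mul_pow, sq_abs]; norm_num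
  have ma := abs_le.1 (hmarg a ha haε)
  have md := abs_le.1 (hmarg d hd hdε)
  have ha2 := abs_le.1 haε
  have hb2 := abs_le.1 hbε
  have hd2 := abs_le.1 hdε
  rw [abs_le]
  constructor
  · linarith [ma.1, md.1, ha2.2, hb2.1, hd2.2]
  · have : 0 ≤ ε := (abs_nonneg _).trans haε
    linarith [ma.2, md.2]

/-! ### The `tanh` recursion at the edge of chaos -/

/-- The edge of chaos of `tanh` at the variance `q`. -/
structure TanhCritical (q σw σb : ℝ) : Prop where
  pos : 0 < q
  variance_eq : σw ^ 2 * pairExp tanh q q q + σb ^ 2 = q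
  slope_eq : σw ^ 2 * tanhSlope q = 1

theorem edgeOfChaos_tanh {σw σb : ℝ} (h : EdgeOfChaos tanh σw σb) :
    ∃ q, TanhCritical q σw σb := by
  obtain ⟨q, hq, h1, h2⟩ := h
  refine ⟨q, hq, ?_, ?_⟩
  · rw [pairExp_self continuous_tanh.measurable hq.le]; exact h1
  · rw [deriv_tanh] at h2; exact h2

theorem pairExp_tanh_zero {q : ℝ} (hq : 0 ≤ q) : pairExp tanh q 0 q = 0 := by
  rw [pairExp_tanh_eq (p := √q) (r := 0) (s := √q) (Real.sq_sqrt hq).symm (by simp)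
    (by simp [Real.sq_sqrt hq]) hq hq (by simpa using mul_nonneg hq hq)]
  simp

theorem pairExp_tanh_diag_nonneg {a : ℝ} (ha : 0 ≤ a) : 0 ≤ pairExp tanh a a a :=
  pairExp_tanh_nonneg ha ha (by rw [sq]) ha

/-- This parametrization of equal-variance pairs is continuous on the whole plane, since the real
square root is continuous with value `0` on negative numbers; no domain restriction is needed in the
compactness argument. -/
theorem continuous_pairExp_tanh_param : Continuous fun z : ℝ × ℝ =>
    ∫ w, tanh (√((z.1 + z.2) / 2) * w.1 + √((z.1 - z.2) / 2) * w.2) *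
      tanh (√((z.1 + z.2) / 2) * w.1 - √((z.1 - z.2) / 2) * w.2) ∂gauss2 := by
  have c := continuous_tanh
  refine continuous_of_dominated (bound := fun _ => 1)
    (fun z => Continuous.aestronglyMeasurable (by fun_prop))
    (fun z => ae_of_all _ fun w => abs_mul_le_one (abs_tanh_le_one _) (abs_tanh_le_one _))
    (integrable_const _) (ae_of_all _ fun w => by fun_prop)

theorem pairExp_tanh_param {Q b : ℝ} (hb : 0 ≤ b) (hbQ : b ≤ Q) :
    pairExp tanh Q b Q = ∫ w, tanh (√((Q + b) / 2) * w.1 + √((Q - b) / 2) * w.2) *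
      tanh (√((Q + b) / 2) * w.1 - √((Q - b) / 2) * w.2) ∂gauss2 := by
  have h1 : √((Q + b) / 2) ^ 2 = (Q + b) / 2 := Real.sq_sqrt (by linarith)
  have h2 : √((Q - b) / 2) ^ 2 = (Q - b) / 2 := Real.sq_sqrt (by linarith)
  rw [pairExp_eq_integral_prod continuous_tanh.measurable (√((Q + b) / 2)) (√((Q - b) / 2))
    (√((Q + b) / 2)) (-√((Q - b) / 2)) (by rw [h1, h2]; ring) (by linear_combination h2 - h1)
    (by rw [neg_sq, h1, h2]; ring)]
  simp only [neg_mul, ← sub_eq_add_neg]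

namespace TanhCritical

variable {q σw σb : ℝ}

/-- The strict gap at `b = 0` reads σ_w² 𝔼[tanh²] < `q` at slope one, so the bias must supply the
remainder of the variance. -/
theorem sq_bias_pos (hc : TanhCritical q σw σb) : 0 < σb ^ 2 := by
  have h1 := pairExp_tanh_gap_strict hc.pos le_rfl hc.pos
  rw [pairExp_tanh_zero hc.pos.le] at h1
  have hw : 0 < σw ^ 2 := by
    refine (sq_nonneg σw).lt_of_ne' fun h => ?_
    have := hc.slope_eq
    rw [h] at this; simp at this
  have h2 := mul_lt_mul_of_pos_left h1 hw
  have h3 : σw ^ 2 * (tanhSlope q * (q - 0)) = q := by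
    rw [← mul_assoc, hc.slope_eq]; ring
  have := hc.variance_eq
  rw [h3] at h2
  linarith

theorem sq_bias_le (hc : TanhCritical q σw σb) : σb ^ 2 ≤ q := by
  have := hc.variance_eq
  nlinarith [mul_nonneg (sq_nonneg σw) (pairExp_tanh_diag_nonneg hc.pos.le)]

/-- The contraction factor of the variance recursion. -/
theorem ratio_mem (hc : TanhCritical q σw σb) : 0 ≤ 1 - σb ^ 2 / q ∧ 1 - σb ^ 2 / q < 1 := by
  have h1 : σb ^ 2 / q ≤ 1 := (div_le_one hc.pos).2 hc.sq_bias_le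
  have h2 : 0 < σb ^ 2 / q := div_pos hc.sq_bias_pos hc.pos
  constructor <;> linarith

/-- By sublinearity the variance map lies, beyond `q`, below the chord through `(0, σb ^ 2)` and the
fixed point; that chord has slope `1 - σb ^ 2 / q`. -/
theorem variance_le (hc : TanhCritical q σw σb) {x : ℝ} (hx : q ≤ x) :
    σw ^ 2 * pairExp tanh x x x + σb ^ 2 ≤ q + (1 - σb ^ 2 / q) * (x - q) := by
  have hq := hc.pos
  have h1 := mul_le_mul_of_nonneg_left (pairExp_tanh_diag_sublinear hq hx) (sq_nonneg σw)
  have h2 : σw ^ 2 * pairExp tanh q q q = q - σb ^ 2 := by linarith [hc.variance_eq]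
  have h3 : q * (σw ^ 2 * pairExp tanh x x x) ≤ x * (q - σb ^ 2) := by
    rw [← h2]; linarith
  have h4 : σw ^ 2 * pairExp tanh x x x ≤ x * (q - σb ^ 2) / q := by
    rw [le_div_iff₀ hq]; linarith
  have h5 : x * (q - σb ^ 2) / q + σb ^ 2 = q + (1 - σb ^ 2 / q) * (x - q) := by
    field_simp; ring
  linarith

theorem le_variance (hc : TanhCritical q σw σb) {a : ℝ} (ha : 0 ≤ a) (haq : a ≤ q) :
    q - (1 - σb ^ 2 / q) * (q - a) ≤ σw ^ 2 * pairExp tanh a a a + σb ^ 2 := by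
  have hq := hc.pos
  have hsub : a * pairExp tanh q q q ≤ q * pairExp tanh a a a := by
    rcases ha.eq_or_lt with rfl | ha'
    · rw [zero_mul]; exact mul_nonneg hq.le (pairExp_tanh_diag_nonneg le_rfl)
    · exact pairExp_tanh_diag_sublinear ha' haq
  have h1 := mul_le_mul_of_nonneg_left hsub (sq_nonneg σw)
  have h2 : σw ^ 2 * pairExp tanh q q q = q - σb ^ 2 := by linarith [hc.variance_eq]
  have h3 : a * (q - σb ^ 2) ≤ q * (σw ^ 2 * pairExp tanh a a a) := by
    rw [← h2]; linarith
  have h4 : a * (q - σb ^ 2) / q ≤ σw ^ 2 * pairExp tanh a a a := by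
    rw [div_le_iff₀ hq]; linarith
  have h5 : a * (q - σb ^ 2) / q + σb ^ 2 = q - (1 - σb ^ 2 / q) * (q - a) := by
    field_simp; ring
  linarith

theorem le_variance_of_ge (hc : TanhCritical q σw σb) {x : ℝ} (hx : q ≤ x) :
    q ≤ σw ^ 2 * pairExp tanh x x x + σb ^ 2 := by
  have := mul_le_mul_of_nonneg_left (pairExp_tanh_diag_mono hc.pos.le hx) (sq_nonneg σw)
  linarith [hc.variance_eq]

theorem cov_le (hc : TanhCritical q σw σb) {a b d M : ℝ} (ha : 0 ≤ a) (hd : 0 ≤ d)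
    (h : b ^ 2 ≤ a * d) (haM : a ≤ M) (hdM : d ≤ M) (hM : q ≤ M) :
    σw ^ 2 * pairExp tanh a b d + σb ^ 2 ≤ q + (1 - σb ^ 2 / q) * (M - q) := by
  have h1 := pairExp_tanh_le_half ha hd h
  have h2 := pairExp_tanh_diag_mono ha haM
  have h3 := pairExp_tanh_diag_mono hd hdM
  have h4 : σw ^ 2 * pairExp tanh a b d ≤ σw ^ 2 * pairExp tanh M M M :=
    mul_le_mul_of_nonneg_left (by linarith) (sq_nonneg σw)
  linarith [hc.variance_le hM]

/-- Replace both variances by `Q`, where the gap inequality has slope at most that at `q`, which is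
one after multiplication by σ_w²; the variance map keeps `Q` above `q`. -/
theorem le_cov (hc : TanhCritical q σw σb) {a b d Q : ℝ} (ha : 0 ≤ a) (hd : 0 ≤ d)
    (h : b ^ 2 ≤ a * d) (haQ : a ≤ Q) (hdQ : d ≤ Q) (hQ : q ≤ Q) (hb : 0 ≤ b) :
    b - (Q - q) ≤ σw ^ 2 * pairExp tanh a b d + σb ^ 2 := by
  have hQ0 : 0 < Q := hc.pos.trans_le hQ
  have hbQ : b ≤ Q := by
    refine le_of_sq_le_sq ?_ hQ0.le
    rw [sq Q]; exact h.trans (mul_le_mul haQ hdQ hd hQ0.le)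
  have h1 := pairExp_tanh_antitone ha haQ hd hdQ h hb
  have h2 := pairExp_tanh_gap hQ0 hb hbQ
  have h3 : tanhSlope Q * (Q - b) ≤ tanhSlope q * (Q - b) :=
    mul_le_mul_of_nonneg_right (tanhSlope_antitone hQ) (by linarith)
  have h4 : σw ^ 2 * (pairExp tanh Q Q Q - tanhSlope q * (Q - b)) ≤ σw ^ 2 * pairExp tanh a b d :=
    mul_le_mul_of_nonneg_left (by linarith) (sq_nonneg σw)
  have h5 : σw ^ 2 * (tanhSlope q * (Q - b)) = Q - b := by
    rw [← mul_assoc, hc.slope_eq, one_mul]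
  have h6 := hc.le_variance_of_ge hQ
  rw [mul_sub, h5] at h4
  linarith

/-- Away from full correlation the covariance map strictly increases correlations, uniformly for
variances slightly above the critical one. -/
theorem exists_uniform_gap (hc : TanhCritical q σw σb) :
    ∃ ε γ : ℝ, 0 < ε ∧ ε ≤ q / 8 ∧ 0 < γ ∧ ∀ Q b, q ≤ Q → Q ≤ q + ε → 0 ≤ b → b ≤ 3 / 4 * q →
      b + γ ≤ σw ^ 2 * pairExp tanh Q b Q + σb ^ 2 := by
  have hq := hc.pos
  set f : ℝ × ℝ → ℝ := fun z =>
    σw ^ 2 * (∫ w, tanh (√((z.1 + z.2) / 2) * w.1 + √((z.1 - z.2) / 2) * w.2) *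
      tanh (√((z.1 + z.2) / 2) * w.1 - √((z.1 - z.2) / 2) * w.2) ∂gauss2) + σb ^ 2 - z.2
  have hf : Continuous f := by
    have := continuous_pairExp_tanh_param
    simp only [f]; fun_prop
  have hfpos : ∀ b ∈ Set.Icc 0 (3 / 4 * q), 0 < f (q, b) := by
    intro b ⟨hb0, hb1⟩
    have hbq : b < q := by linarith
    have h1 := pairExp_tanh_gap_strict hq hb0 hbq
    have hw : 0 < σw ^ 2 := by
      refine (sq_nonneg σw).lt_of_ne' fun h => ?_
      have := hc.slope_eq
      rw [h] at this; simp at this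
    have h2 := mul_lt_mul_of_pos_left h1 hw
    rw [mul_sub, ← mul_assoc, hc.slope_eq] at h2
    have := hc.variance_eq
    simp only [f]
    rw [← pairExp_tanh_param hb0 hbq.le]
    linarith
  obtain ⟨b₀, hb₀, hmin⟩ := (isCompact_Icc (a := (0 : ℝ)) (b := 3 / 4 * q)).exists_isMinOn
    ⟨0, le_rfl, by positivity⟩
    (hf.comp (Continuous.prodMk_right q)).continuousOn
  set γ := f (q, b₀) / 2
  have hγ : 0 < γ := half_pos (hfpos b₀ hb₀)
  -- Half of the minimal gain at `Q = q` persists for nearby `Q`, uniformly over the compact range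
  -- of `b`.
  obtain ⟨U, W, hU, -, hqU, hW, hsub⟩ := generalized_tube_lemma (isCompact_singleton (x := q))
    (isCompact_Icc (a := (0 : ℝ)) (b := 3 / 4 * q)) (isOpen_lt continuous_const hf)
    (n := {z | γ < f z}) (by
      rintro ⟨Q, b⟩ ⟨hQ, hb⟩
      have hQ' : Q = q := hQ
      have := hmin hb
      simp only [Set.mem_ofPred_eq, Function.comp_apply] at this ⊢
      rw [hQ']
      have h0 := hfpos b₀ hb₀
      simp only [γ]
      linarith)
  obtain ⟨r, hr, hball⟩ := Metric.isOpen_iff.1 hU q (hqU rfl)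
  refine ⟨min (r / 2) (q / 8), γ, lt_min (half_pos hr) (by positivity), min_le_right _ _, hγ,
    fun Q b hQ hQε hb0 hb1 => ?_⟩
  have hQU : Q ∈ U := hball (by
    rw [Metric.mem_ball, Real.dist_eq, abs_of_nonneg (by linarith)]
    have := min_le_left (r / 2) (q / 8)
    linarith)
  have h1 : γ < f (Q, b) := hsub ⟨hQU, hW ⟨hb0, hb1⟩⟩
  simp only [f] at h1
  rw [← pairExp_tanh_param hb0 (by linarith)] at h1
  linarith

end TanhCritical

/-! ### A coupled pair of kernels -/

section Block

variable {V : Type*}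

/-- The kernel on two copies of `V` given by `S` within each copy and by `N` across. -/
def blockKernel (S N : V → V → ℝ) (p p' : V × Bool) : ℝ :=
  if p.2 = p'.2 then S p.1 p'.1 else N p.1 p'.1

variable {S N : V → V → ℝ}

theorem blockKernel_cross_symm (h : (Matrix.of (blockKernel S N)).PosSemidef) (u v : V) :
    N v u = N u v := by
  have := psd_symm h (u, true) (v, false)
  simpa [blockKernel] using this

/-- For copies `X`, `X'` with joint kernel `blockKernel S N`, this is nonnegativity of the variance
of `(X_u - X'_u) + (X_v - X'_v)`. -/
theorem le_of_posSemidef_blockKernel (h : (Matrix.of (blockKernel S N)).PosSemidef) (u v : V) :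
    N u v - ((S u u - N u u) + (S v v - N v v)) / 2 ≤ S u v := by
  have h1 := (h.submatrix ![(u, true), (u, false), (v, true), (v, false)]).dotProduct_mulVec_nonneg
    ![1, -1, 1, -1]
  have hS : S v u = S u v := by
    have := psd_symm h (u, true) (v, true)
    simpa [blockKernel] using this
  have hN := blockKernel_cross_symm h u v
  simp [Matrix.mulVec, dotProduct, Fin.sum_univ_four, blockKernel, hS, hN] at h1
  linarith

variable [Fintype V]

theorem blockKernel_cross_sq_le (h : (Matrix.of (blockKernel S N)).PosSemidef) (u v : V) :
    N u v ^ 2 ≤ S u u * S v v := by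
  have := psd_sq_le h (u, true) (v, false)
  simpa [blockKernel] using this

/-- Both copies have the same variances, so the layer map applied to the block kernel is again a
block kernel. -/
theorem posSemidef_blockKernel_covStep {φ : ℝ → ℝ} (hφ : Measurable φ) (hle : ∀ x, |φ x| ≤ |x|)
    (σw σb : ℝ) (h : (Matrix.of (blockKernel S N)).PosSemidef) :
    (Matrix.of (blockKernel (covStep φ σw σb S)
      fun u v => σw ^ 2 * pairExp φ (S u u) (N u v) (S v v) + σb ^ 2)).PosSemidef := by
  convert posSemidef_covStep hφ hle σw σb h using 2
  ext p p'
  rw [covStep_eq_pairExp _ _ _ (psd_symm h p p')]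
  by_cases hp : p.2 = p'.2
  · have hS : S p'.1 p.1 = S p.1 p'.1 := by
      have := psd_symm h p p'
      simpa [blockKernel, hp] using this
    simp [blockKernel, hp, covStep_eq_pairExp _ _ _ hS]
  · simp [blockKernel, hp]

theorem posSemidef_blockKernel_aggregate [DecidableEq V] (G : SimpleGraph V) [DecidableRel G.Adj]
    (h : (Matrix.of (blockKernel S N)).PosSemidef) :
    (Matrix.of (blockKernel (aggregate G S) (aggregate G N))).PosSemidef := by
  have : Matrix.of (blockKernel (aggregate G S) (aggregate G N)) =
      (avgMatrix G ⊗ₖ (1 : Matrix Bool Bool ℝ)) * Matrix.of (blockKernel S N) *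
        (avgMatrix G ⊗ₖ (1 : Matrix Bool Bool ℝ))ᴴ := by
    ext ⟨u, i⟩ ⟨u', j⟩
    have hsum : ∀ K : V → V → ℝ, aggregate G K u u' =
        ∑ v', (∑ v, avgMatrix G u v * K v v') * avgMatrix G u' v' := fun K => by
      rw [aggregate_eq_sum, Finset.sum_comm]
      refine Finset.sum_congr rfl fun v' _ => ?_
      rw [Finset.sum_mul]
      exact Finset.sum_congr rfl fun v _ => by ring
    simp only [Matrix.of_apply, Matrix.mul_apply, Matrix.conjTranspose_apply, star_trivial,
      Matrix.kroneckerMap_apply, Fintype.sum_prod_type, Matrix.one_apply, Fintype.sum_bool,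
      blockKernel]
    cases i <;> cases j <;> simp [hsum]
  rw [this]
  exact h.mul_mul_conjTranspose_same _

theorem posSemidef_blockKernel_zero (h : (Matrix.of S).PosSemidef) :
    (Matrix.of (blockKernel S fun _ _ => 0)).PosSemidef := by
  have : Matrix.of (blockKernel S fun _ _ => 0) = Matrix.of S ⊗ₖ (1 : Matrix Bool Bool ℝ) := by
    ext ⟨u, i⟩ ⟨u', j⟩
    simp [blockKernel, Matrix.kroneckerMap_apply, Matrix.one_apply]
  rw [this]
  exact h.kronecker Matrix.PosSemidef.one

end Block

/-! ### tanh kernels on the graph, their convergence and their tangent kernel -/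

section TanhKernel

variable {V : Type*} [Fintype V] [DecidableEq V] (G : SimpleGraph V) [DecidableRel G.Adj]
  {d : ℕ} (h : V → EuclideanSpace ℝ (Fin d)) (σw σb : ℝ) (R : ℕ)

/-- The covariance between two copies of the network that share only their biases. -/
noncomputable def crossKernel : ℕ → ℕ → V → V → ℝ
  | 0, 0 => fun _ _ => 0
  | l + 1, 0 => aggregate G (crossKernel l R)
  | l, r + 1 => fun u v => σw ^ 2 * pairExp tanh (gpk G h tanh σw σb R l r u u)
      (crossKernel l r u v) (gpk G h tanh σw σb R l r v v) + σb ^ 2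

variable {G h σw σb R}

theorem crossKernel_succ_zero (l : ℕ) :
    crossKernel G h σw σb R (l + 1) 0 = aggregate G (crossKernel G h σw σb R l R) := by
  simp only [crossKernel]

theorem crossKernel_succ (l r : ℕ) :
    crossKernel G h σw σb R l (r + 1) = fun u v =>
      σw ^ 2 * pairExp tanh (gpk G h tanh σw σb R l r u u)
      (crossKernel G h σw σb R l r u v) (gpk G h tanh σw σb R l r v v) + σb ^ 2 := by
  cases l <;> simp only [crossKernel]

theorem posSemidef_gpk_tanh (l r : ℕ) : (Matrix.of (gpk G h tanh σw σb R l r)).PosSemidef :=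
  posSemidef_gpk continuous_tanh.measurable abs_tanh_le_abs l r

theorem posSemidef_block_crossKernel (l r : ℕ) :
    (Matrix.of (blockKernel (gpk G h tanh σw σb R l r)
      (crossKernel G h σw σb R l r))).PosSemidef := by
  have hrow : ∀ l, (Matrix.of (blockKernel (gpk G h tanh σw σb R l 0)
      (crossKernel G h σw σb R l 0))).PosSemidef → ∀ r, (Matrix.of (blockKernel
      (gpk G h tanh σw σb R l r) (crossKernel G h σw σb R l r))).PosSemidef := by
    intro l h0 r
    induction r with
    | zero => exact h0
    | succ r ih =>
      rw [gpk_succ, crossKernel_succ]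
      exact posSemidef_blockKernel_covStep continuous_tanh.measurable abs_tanh_le_abs σw σb ih
  refine hrow l ?_ r
  induction l with
  | zero =>
    have : crossKernel G h σw σb R 0 0 = fun _ _ => 0 := by simp only [crossKernel]
    rw [this]
    exact posSemidef_blockKernel_zero (posSemidef_gpk_tanh 0 0)
  | succ l ih =>
    rw [gpk_succ_zero, crossKernel_succ_zero]
    exact posSemidef_blockKernel_aggregate G (hrow l ih R)

theorem aggregate_le {S : V → V → ℝ} {c : ℝ} (hS : ∀ u v, S u v ≤ c) (u v : V) :
    aggregate G S u v ≤ c := by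
  rw [← aggMatrix_mulVec G S (u, v)]
  exact (isRowStochastic_aggMatrix G).mulVec_le (fun q => hS q.1 q.2) _

theorem le_aggregate {S : V → V → ℝ} {c : ℝ} (hS : ∀ u v, c ≤ S u v) (u v : V) :
    c ≤ aggregate G S u v := by
  rw [← aggMatrix_mulVec G S (u, v)]
  exact (isRowStochastic_aggMatrix G).le_mulVec (fun q => hS q.1 q.2) _

theorem crossKernel_nonneg (l r : ℕ) (u v : V) : 0 ≤ crossKernel G h σw σb R l r u v := by
  have hrow : ∀ l, (∀ u v, 0 ≤ crossKernel G h σw σb R l 0 u v) →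
      ∀ r u v, 0 ≤ crossKernel G h σw σb R l r u v := by
    intro l h0 r
    induction r with
    | zero => exact h0
    | succ r ih =>
      intro u v
      have hS := posSemidef_gpk_tanh (G := G) (h := h) (σw := σw) (σb := σb) (R := R) l r
      have hB := posSemidef_block_crossKernel (G := G) (h := h) (σw := σw) (σb := σb) (R := R) l r
      have := pairExp_tanh_nonneg (psd_diag_nonneg hS u) (psd_diag_nonneg hS v)
        (blockKernel_cross_sq_le hB u v) (ih u v)
      rw [crossKernel_succ]
      positivity
  refine hrow l ?_ r u v
  clear u v r
  induction l with
  | zero => intro u v; simp [crossKernel]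
  | succ l ih =>
    rw [crossKernel_succ_zero]
    exact le_aggregate (hrow l ih R)

theorem gpk_tanh_succ (l r : ℕ) (u v : V) :
    gpk G h tanh σw σb R l (r + 1) u v = σw ^ 2 * pairExp tanh (gpk G h tanh σw σb R l r u u)
      (gpk G h tanh σw σb R l r u v) (gpk G h tanh σw σb R l r v v) + σb ^ 2 := by
  rw [gpk_succ, covStep_eq_pairExp _ _ _ (psd_symm (posSemidef_gpk_tanh l r) u v)]

variable {q : ℝ}

theorem gpk_tanh_succ_le (hc : TanhCritical q σw σb) (l r : ℕ) {M : ℝ} (hM : q ≤ M)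
    (hle : ∀ u v, gpk G h tanh σw σb R l r u v ≤ M) (u v : V) :
    gpk G h tanh σw σb R l (r + 1) u v ≤ q + (1 - σb ^ 2 / q) * (M - q) := by
  have hS := posSemidef_gpk_tanh (G := G) (h := h) (σw := σw) (σb := σb) (R := R) l r
  rw [gpk_tanh_succ]
  exact hc.cov_le (psd_diag_nonneg hS u) (psd_diag_nonneg hS v) (psd_sq_le hS u v) (hle u u)
    (hle v v) hM

/-- An upper bound `M ≥ q` on all entries has its excess over `q` reduced by the variance
contraction at each nonlinear layer, and aggregation preserves it. One such layer per block
suffices, which is where `0 < R` enters. -/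
theorem exists_gpk_tanh_upper (hc : TanhCritical q σw σb) (hR : 0 < R) :
    ∃ E ρ : ℝ, 0 ≤ E ∧ 0 < ρ ∧ ρ < 1 ∧
      ∀ l r (u v : V), gpk G h tanh σw σb R l r u v ≤ q + E * ρ ^ l := by
  obtain ⟨h0, h1⟩ := hc.ratio_mem
  set η := 1 - σb ^ 2 / q
  set ρ := max η (1 / 2)
  have hρ0 : 0 < ρ := lt_max_of_lt_right (by norm_num)
  have hρ1 : ρ < 1 := max_lt h1 (by norm_num)
  set E := ∑ u, ∑ v, |gpk G h tanh σw σb R 0 0 u v|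
  have hE : 0 ≤ E := Finset.sum_nonneg fun u _ => Finset.sum_nonneg fun v _ => abs_nonneg _
  have hstep : ∀ l r, (∀ u v, gpk G h tanh σw σb R l r u v ≤ q + E * ρ ^ l) →
      ∀ u v, gpk G h tanh σw σb R l (r + 1) u v ≤ q + E * ρ ^ (l + 1) := by
    intro l r hle u v
    have hp : 0 ≤ E * ρ ^ l := by positivity
    refine (gpk_tanh_succ_le hc l r (by linarith) hle u v).trans ?_
    have : η * (E * ρ ^ l) ≤ ρ * (E * ρ ^ l) :=
      mul_le_mul_of_nonneg_right (le_max_left _ _) hp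
    have e : E * ρ ^ (l + 1) = ρ * (E * ρ ^ l) := by ring
    rw [add_sub_cancel_left, e]
    linarith
  have hrow : ∀ l, (∀ u v, gpk G h tanh σw σb R l 0 u v ≤ q + E * ρ ^ l) →
      ∀ r u v, gpk G h tanh σw σb R l r u v ≤ q + E * ρ ^ l := by
    intro l hl r
    induction r with
    | zero => exact hl
    | succ r ih =>
      intro u v
      refine (hstep l r ih u v).trans ?_
      exact (add_le_add_iff_left q).2 (mul_le_mul_of_nonneg_left
        (pow_le_pow_of_le_one hρ0.le hρ1.le (Nat.le_succ l)) hE)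
  refine ⟨E, ρ, hE, hρ0, hρ1, fun l => hrow l ?_⟩
  induction l with
  | zero =>
    intro u v
    have e1 : |gpk G h tanh σw σb R 0 0 u v| ≤ ∑ v, |gpk G h tanh σw σb R 0 0 u v| :=
      Finset.single_le_sum (f := fun v => |gpk G h tanh σw σb R 0 0 u v|)
        (fun _ _ => abs_nonneg _) (Finset.mem_univ v)
    have e2 : ∑ v, |gpk G h tanh σw σb R 0 0 u v| ≤ E :=
      Finset.single_le_sum (f := fun u => ∑ v, |gpk G h tanh σw σb R 0 0 u v|)
        (fun _ _ => Finset.sum_nonneg fun _ _ => abs_nonneg _) (Finset.mem_univ u)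
    rw [pow_zero, mul_one]
    linarith [le_abs_self (gpk G h tanh σw σb R 0 0 u v), hc.pos]
  | succ l ih =>
    rw [gpk_succ_zero]
    obtain ⟨r, rfl⟩ := Nat.exists_eq_succ_of_ne_zero hR.ne'
    exact aggregate_le (hstep l r (hrow l ih r))

theorem exists_gpk_tanh_nonneg (hc : TanhCritical q σw σb) (hR : 0 < R) :
    ∃ l₀ : ℕ, ∀ l ≥ l₀, ∀ r (u v : V), 0 ≤ gpk G h tanh σw σb R l r u v := by
  obtain ⟨E, ρ, hE, hρ0, hρ1, hup⟩ := exists_gpk_tanh_upper (G := G) (h := h) hc hR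
  obtain ⟨ε, γ, hε, hεq, hγ, hgap⟩ := hc.exists_uniform_gap
  obtain ⟨l₁, hl₁⟩ : ∃ l₁ : ℕ, ∀ l ≥ l₁, E * ρ ^ l < ε := by
    have ht : Filter.Tendsto (fun l : ℕ => E * ρ ^ l) Filter.atTop (nhds (E * 0)) :=
      (tendsto_pow_atTop_nhds_zero_of_lt_one hρ0.le hρ1).const_mul E
    rw [mul_zero] at ht
    exact Filter.eventually_atTop.1 (ht.eventually (gt_mem_nhds hε))
  have hq := hc.pos
  -- Below `3q/4` a cross-covariance gains `γ` per layer; above it a layer loses at most `ε`. So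
  -- cross-covariances climb to `T` and never fall below it again.
  set T := 3 / 4 * q - ε
  have hstep : ∀ l ≥ l₁, ∀ r m, (∀ u v : V, m ≤ crossKernel G h σw σb R l r u v) →
      ∀ u v : V, min (m + γ) T ≤ crossKernel G h σw σb R l (r + 1) u v := by
    intro l hl r m hm u v
    have hS := posSemidef_gpk_tanh (G := G) (h := h) (σw := σw) (σb := σb) (R := R) l r
    have hB := posSemidef_block_crossKernel (G := G) (h := h) (σw := σw) (σb := σb) (R := R) l r
    have hN0 := crossKernel_nonneg (G := G) (h := h) (σw := σw) (σb := σb) (R := R) l r u v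
    have hQ : ∀ u : V, gpk G h tanh σw σb R l r u u ≤ q + ε := fun u =>
      (hup l r u u).trans (by linarith [hl₁ l hl])
    rw [crossKernel_succ]
    rcases le_total (crossKernel G h σw σb R l r u v) (3 / 4 * q) with hb | hb
    · have h1 := hgap (q + ε) _ (by linarith) le_rfl hN0 hb
      have h2 := mul_le_mul_of_nonneg_left (pairExp_tanh_antitone (psd_diag_nonneg hS u) (hQ u)
        (psd_diag_nonneg hS v) (hQ v) (blockKernel_cross_sq_le hB u v) hN0) (sq_nonneg σw)
      refine (min_le_left _ _).trans ?_
      dsimp only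
      linarith [hm u v]
    · have h1 := hc.le_cov (psd_diag_nonneg hS u) (psd_diag_nonneg hS v)
        (blockKernel_cross_sq_le hB u v) (hQ u) (hQ v) (by linarith) hN0
      refine (min_le_right _ _).trans ?_
      dsimp only
      simp only [T]
      linarith
  have hrow : ∀ l ≥ l₁, ∀ x : ℝ, (∀ u v : V, min x T ≤ crossKernel G h σw σb R l 0 u v) →
      ∀ r (u v : V), min x T ≤ crossKernel G h σw σb R l r u v := by
    intro l hl x h0 r
    induction r with
    | zero => exact h0
    | succ r ih =>
      intro u v
      refine le_trans ?_ (hstep l hl r _ ih u v)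
      exact le_min (by linarith) (min_le_right _ _)
  have hmain : ∀ (n : ℕ) (r : ℕ) (u v : V),
      min (n * γ) T ≤ crossKernel G h σw σb R (l₁ + n) r u v := by
    intro n
    induction n with
    | zero =>
      intro r u v
      refine (min_le_left _ _).trans ?_
      simpa using crossKernel_nonneg l₁ r u v
    | succ n ih =>
      refine hrow _ (by omega) _ ?_
      rw [← add_assoc, crossKernel_succ_zero]
      obtain ⟨r, rfl⟩ := Nat.exists_eq_succ_of_ne_zero hR.ne'
      refine le_aggregate fun u v => le_trans ?_ (hstep _ (by omega) r _ (ih r) u v)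
      refine le_min ?_ (min_le_right _ _)
      push_cast
      rcases le_total (n * γ) T with h1 | h1
      · rw [min_eq_left h1]
        exact (min_le_left _ _).trans (by linarith)
      · rw [min_eq_right h1]
        exact (min_le_right _ _).trans (by linarith)
  obtain ⟨n₀, hn₀⟩ := exists_nat_ge (T / γ)
  refine ⟨l₁ + n₀, fun l hl r u v => ?_⟩
  obtain ⟨n, rfl⟩ : ∃ n, l = l₁ + n := ⟨l - l₁, by omega⟩
  have hn : T ≤ n * γ := by
    rw [div_le_iff₀ hγ] at hn₀
    have : (n₀ : ℝ) ≤ n := by exact_mod_cast (by omega : n₀ ≤ n)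
    nlinarith
  have hN : ∀ u v : V, T ≤ crossKernel G h σw σb R (l₁ + n) r u v := fun u v => by
    have := hmain n r u v
    rwa [min_eq_right hn] at this
  -- With all cross-covariances at least `T` and variances at most `q + ε`, this gives `S u v ≥ 2T -
  -- (q + ε) = q/2 - 3ε`, which is positive as `ε ≤ q/8`.
  have hB := le_of_posSemidef_blockKernel
    (posSemidef_block_crossKernel (G := G) (h := h) (σw := σw) (σb := σb) (R := R) (l₁ + n) r) u v
  have h1 := hup (l₁ + n) r u u
  have h2 := hup (l₁ + n) r v v
  have h3 := hl₁ (l₁ + n) (by omega)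
  have h4 := hN u v
  have h5 := hN u u
  have h6 := hN v v
  simp only [T] at h4 h5 h6
  linarith

/-- Off-diagonal deficits below `q` are only neutral under a layer, so no contraction is available
there directly. Diagonal deficits shrink by `η`, and since `A ^ k` gives weight at least `δ` to a
diagonal pair, the maximal deficit shrinks by `1 - δ (1 - η)` every `k` blocks, up to errors from
the excess above `q`. -/
theorem expDecay_gpk_tanh (hc : TanhCritical q σw σb) (hR : 0 < R)
    (hirr : (aggMatrix G).IsIrreducible) [Nonempty V] (r : ℕ) :
    ExpDecay fun l (p : V × V) => gpk G h tanh σw σb R l r p.1 p.2 - q := by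
  have hq := hc.pos
  have hA := isRowStochastic_aggMatrix G
  obtain ⟨E, ρ, hE, hρ0, hρ1, hup⟩ := exists_gpk_tanh_upper (G := G) (h := h) hc hR
  obtain ⟨l₀, hl₀⟩ := exists_gpk_tanh_nonneg (G := G) (h := h) hc hR
  obtain ⟨k, hk, δ, hδ0, hδ⟩ := exists_pow_ge_of_irreducible hirr (aggMatrix_diag_pos G)
  obtain ⟨hη0, hη1⟩ := hc.ratio_mem
  set η := 1 - σb ^ 2 / q
  set S := gpk G h tanh σw σb R
  set Y : ℕ → ℕ → V × V → ℝ := fun l r p => max (q - S l r p.1 p.2) 0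
  have hY0 : ∀ l r p, 0 ≤ Y l r p := fun l r p => le_max_right _ _
  have hEl : ∀ l, 0 ≤ E * ρ ^ l := fun l => by positivity
  have hoff : ∀ l ≥ l₀, ∀ r p, Y l (r + 1) p ≤ Y l r p + E * ρ ^ l := by
    intro l hl r p
    have hS : (Matrix.of (S l r)).PosSemidef := posSemidef_gpk_tanh l r
    have h1 := hc.le_cov (psd_diag_nonneg hS p.1) (psd_diag_nonneg hS p.2) (psd_sq_le hS p.1 p.2)
      (hup l r p.1 p.1) (hup l r p.2 p.2) (by linarith [hEl l]) (hl₀ l hl r p.1 p.2)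
    have h2 : S l (r + 1) p.1 p.2 = _ := gpk_tanh_succ l r p.1 p.2
    refine max_le ?_ (add_nonneg (hY0 l r p) (hEl l))
    have h3 : q - S l r p.1 p.2 ≤ Y l r p := le_max_left _ _
    rw [h2]
    linarith
  have hdiag : ∀ l r u, Y l (r + 1) (u, u) ≤ η * Y l r (u, u) := by
    intro l r u
    have hS : (Matrix.of (S l r)).PosSemidef := posSemidef_gpk_tanh l r
    have h2 : S l (r + 1) u u = _ := gpk_tanh_succ l r u u
    refine max_le ?_ (mul_nonneg hη0 (hY0 l r _))
    dsimp only
    rw [h2]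
    rcases le_total (S l r u u) q with h3 | h3
    · have h4 := hc.le_variance (psd_diag_nonneg hS u) h3
      have h5 : η * (q - S l r u u) ≤ η * Y l r (u, u) :=
        mul_le_mul_of_nonneg_left (le_max_left _ _) hη0
      linarith
    · have h4 := hc.le_variance_of_ge h3
      have h5 : 0 ≤ η * Y l r (u, u) := mul_nonneg hη0 (hY0 l r _)
      linarith
  have hoffr : ∀ l ≥ l₀, ∀ r p, Y l r p ≤ Y l 0 p + r * (E * ρ ^ l) := by
    intro l hl r p
    induction r with
    | zero => simp
    | succ r ih => have := hoff l hl r p; push_cast; linarith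
  have hdiagr : ∀ l r u, Y l (r + 1) (u, u) ≤ η * Y l 0 (u, u) := by
    intro l r u
    induction r with
    | zero => exact hdiag l 0 u
    | succ r ih =>
      have h1 := hdiag l (r + 1) u
      have h2 : η * Y l (r + 1) (u, u) ≤ 1 * Y l (r + 1) (u, u) :=
        mul_le_mul_of_nonneg_right hη1.le (hY0 _ _ _)
      linarith
  have hagg : ∀ l p, Y (l + 1) 0 p ≤ (aggMatrix G *ᵥ Y l R) p := by
    intro l p
    refine max_le ?_ (hA.le_mulVec (hY0 l R) p)
    have h1 : S (l + 1) 0 p.1 p.2 = (aggMatrix G *ᵥ fun q => S l R q.1 q.2) p := by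
      rw [aggMatrix_mulVec]
      exact congrFun₂ (gpk_succ_zero l) p.1 p.2
    have h2 : q - S (l + 1) 0 p.1 p.2 = (aggMatrix G *ᵥ fun p => -S l R p.1 p.2 + q) p := by
      rw [hA.mulVec_add_const, h1]
      have : (fun p : V × V => -S l R p.1 p.2) = -fun p : V × V => S l R p.1 p.2 := rfl
      rw [this, Matrix.mulVec_neg, Pi.neg_apply]
      ring
    rw [h2]
    exact hA.mulVec_mono (fun p => (by linarith : -S l R p.1 p.2 + q ≤ q - S l R p.1 p.2).trans
      (le_max_left _ _)) p
  set b : ℕ → ℝ := fun l => ‖Y (l₀ + l) 0‖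
  have hYb : ∀ l p, Y (l₀ + l) 0 p ≤ b l := fun l p =>
    (le_abs_self _).trans (norm_le_pi_norm (Y (l₀ + l) 0) p)
  have hrec : ∀ l, b (l + k) ≤ (1 - δ * (1 - η)) * b l + (k * (R * E)) * ρ ^ l := by
    intro l
    obtain ⟨u₀⟩ := ‹Nonempty V›
    set e := R * (E * ρ ^ (l₀ + l))
    set Z : V × V → ℝ := fun p => if p.1 = p.2 then η * Y (l₀ + l) 0 p else Y (l₀ + l) 0 p
    have hb0 : 0 ≤ b l := norm_nonneg _
    have hZb : ∀ p, Z p ≤ b l := fun p => by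
      have h1 := hYb l p
      have h2 := hY0 (l₀ + l) 0 p
      simp only [Z]
      split_ifs
      · exact (mul_le_of_le_one_left h2 hη1.le).trans h1
      · exact h1
    -- The diagonal gain is built into the starting vector `Z`; it is used only in the first of the
    -- `k` blocks, and later blocks merely average.
    set x : ℕ → V × V → ℝ := fun j => if j = 0 then Z else Y (l₀ + l + j) 0
    have he : 0 ≤ e := mul_nonneg (Nat.cast_nonneg R) (hEl _)
    have hx : ∀ j p, x (j + 1) p ≤ (aggMatrix G *ᵥ x j) p + e := by
      intro j p
      have h1 : x (j + 1) = Y (l₀ + l + j + 1) 0 := by simp [x, add_assoc]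
      rw [h1]
      refine (hagg _ p).trans ?_
      rw [← hA.mulVec_add_const]
      refine hA.mulVec_mono (fun p => ?_) p
      have h2 := hoffr (l₀ + l + j) (by omega) R p
      have h3 : R * (E * ρ ^ (l₀ + l + j)) ≤ e := by
        simp only [e]
        have : ρ ^ (l₀ + l + j) ≤ ρ ^ (l₀ + l) := pow_le_pow_of_le_one hρ0.le hρ1.le (by omega)
        gcongr
      rcases Nat.eq_zero_or_pos j with rfl | hj
      · simp only [x, if_true, add_zero] at h2 h3 ⊢
        simp only [Z]
        split_ifs with hp
        · obtain ⟨u, v⟩ := p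
          dsimp only at hp
          subst hp
          obtain ⟨r, rfl⟩ := Nat.exists_eq_succ_of_ne_zero hR.ne'
          exact (hdiagr (l₀ + l) r u).trans (by linarith)
        · linarith
      · simp only [x, hj.ne', if_false]
        linarith
    have hxk : x k = Y (l₀ + (l + k)) 0 := by simp [x, hk.ne', add_assoc]
    have hlast : ∀ p, Y (l₀ + (l + k)) 0 p ≤ (1 - δ * (1 - η)) * b l + k * e := by
      intro p
      have h1 := hA.le_pow_mulVec_add hx k p
      have h2 := (hA.pow k).mulVec_le_sub hZb p (u₀, u₀) (hδ _ _)
      have h3 : Z (u₀, u₀) ≤ η * b l := by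
        simp only [Z, if_true]
        exact mul_le_mul_of_nonneg_left (hYb l _) hη0
      have h4 : x 0 = Z := by simp [x]
      rw [hxk, h4] at h1
      have h5 : δ * (b l - η * b l) ≤ δ * (b l - Z (u₀, u₀)) :=
        mul_le_mul_of_nonneg_left (by linarith) hδ0.le
      linarith
    have hfin : (1 - δ * (1 - η)) * b l + k * e ≤
        (1 - δ * (1 - η)) * b l + (k * (R * E)) * ρ ^ l := by
      have : ρ ^ (l₀ + l) ≤ ρ ^ l := pow_le_pow_of_le_one hρ0.le hρ1.le (by omega)
      have h6 : k * e ≤ k * (R * (E * ρ ^ l)) := by simp only [e]; gcongr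
      linarith
    have hnn : 0 ≤ (1 - δ * (1 - η)) * b l + k * e := (hY0 _ _ (u₀, u₀)).trans (hlast (u₀, u₀))
    refine le_trans ?_ hfin
    rw [pi_norm_le_iff_of_nonneg hnn]
    intro p
    rw [Real.norm_of_nonneg (hY0 _ _ _)]
    exact hlast p
  have hδ1 : δ ≤ 1 := by
    obtain ⟨u₀⟩ := ‹Nonempty V›
    have := Finset.single_le_sum (f := fun j => (aggMatrix G ^ k) (u₀, u₀) j)
      (fun j _ => (hA.pow k).nonneg _ j) (Finset.mem_univ (u₀, u₀))
    rw [(hA.pow k).sum_row] at this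
    linarith [hδ (u₀, u₀) (u₀, u₀)]
  obtain ⟨K, γ, hK, hγ0, hγ1, hgeo⟩ := exists_geometric_bound (a := b) hk
    (by nlinarith : 0 ≤ 1 - δ * (1 - η)) (by nlinarith [mul_pos hδ0 (sub_pos.2 hη1)])
    hρ0.le hρ1 (by positivity) hrec
  have hbound : ∀ l (p : V × V), |S l r p.1 p.2 - q| ≤ (q + E) + q := by
    intro l p
    have h1 : |S l r p.1 p.2| ≤ q + E := psd_le_max (posSemidef_gpk_tanh l r) (fun u => by
      refine (hup l r u u).trans ?_
      have := mul_le_of_le_one_right hE (pow_le_one₀ hρ0.le hρ1.le (n := l))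
      linarith) p.1 p.2
    refine (abs_sub _ _).trans ?_
    rw [abs_of_pos hq]
    linarith
  -- The deficit estimates need nonnegative covariances, hence `l ≥ l₀`; earlier terms are covered
  -- by the uniform bound.
  refine ExpDecay.of_shift hbound l₀ ?_
  have d1 : ExpDecay fun l (_ : V × V) => b l :=
    ⟨K, γ, hK, hγ0, hγ1, fun l _ => by rw [abs_of_nonneg (norm_nonneg _)]; exact hgeo l⟩
  have d2 : ExpDecay fun l (_ : V × V) => ((r : ℝ) + 1) * (E * ρ ^ l) :=
    ⟨(r + 1) * E, ρ, by positivity, hρ0, hρ1, fun l _ => by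
      rw [abs_of_nonneg (by positivity)]; exact le_of_eq (by ring)⟩
  refine (d1.add d2).mono zero_le_one fun l p => ⟨p, ?_⟩
  have hpow : ρ ^ (l₀ + l) ≤ ρ ^ l := pow_le_pow_of_le_one hρ0.le hρ1.le (by omega)
  have hEp : E * ρ ^ (l₀ + l) ≤ E * ρ ^ l := by gcongr
  have h1 := hup (l₀ + l) r p.1 p.2
  have h2 := hoffr (l₀ + l) (by omega) r p
  have h3 : q - S (l₀ + l) r p.1 p.2 ≤ Y (l₀ + l) r p := le_max_left _ _
  have h4 := hYb l p
  have h5 : (r : ℝ) * (E * ρ ^ (l₀ + l)) ≤ r * (E * ρ ^ l) := by gcongr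
  have h6 : 0 ≤ b l := norm_nonneg _
  have h7 : 0 ≤ (r : ℝ) * (E * ρ ^ l) := by positivity
  rw [one_mul]
  refine le_trans ?_ (le_abs_self _)
  rw [abs_le]
  constructor <;> linarith [hEl l]

theorem gntk_tanh_growth (hc : TanhCritical q σw σb) (hirr : (aggMatrix G).IsIrreducible)
    {π : V × V → ℝ} (hπ : IsStationaryDistribution (aggMatrix G) π) :
    ∃ c κ : ℝ, ∀ r ≤ R, ExpDecay fun l (p : V × V) =>
      gntk G h tanh σw σb R l r p.1 p.2 - (R * l * c + κ + r * c) := by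
  have : Nonempty V := by
    by_contra hne
    have := not_nonempty_iff.1 hne
    simpa using hπ.2.1
  refine ⟨q, gntk_linear_growth hirr hπ (fun r hr => ?_)
    fun r hr => expDecay_gpk_tanh hc (by omega) hirr (r + 1)⟩
  obtain ⟨C, γ, hC, hγ0, hγ1, hle⟩ := expDecay_gpk_tanh (h := h) hc (by omega : 0 < R) hirr r
  refine ⟨σw ^ 2 * ((4 / √q + 8) * C), γ, by positivity, hγ0, hγ1, fun l p => ?_⟩
  have hS := posSemidef_gpk_tanh (G := G) (h := h) (σw := σw) (σb := σb) (R := R) l r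
  beta_reduce
  rw [covDotStep_eq_pairExp _ _ (psd_symm hS p.1 p.2), deriv_tanh, ← hc.slope_eq, ← mul_sub,
    abs_mul, abs_of_nonneg (sq_nonneg σw), mul_assoc, mul_assoc]
  gcongr
  exact abs_pairExp_sechSq_sub_le hc.pos (psd_diag_nonneg hS _) (psd_diag_nonneg hS _)
    (psd_sq_le hS _ _) (hle l (p.1, p.1)) (hle l p) (hle l (p.2, p.2))

end TanhKernel

end GNTK

theorem theorem1 {V : Type*} [Fintype V] [DecidableEq V] (G : SimpleGraph V) [DecidableRel G.Adj]
    {d : ℕ} (h : V → EuclideanSpace ℝ (Fin d)) (R : ℕ)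
    (φ : ℝ → ℝ) (hφ : φ = GNTK.relu ∨ φ = Real.tanh)
    (σw σb : ℝ) (hcrit : GNTK.EdgeOfChaos φ σw σb)
    (hirr : (GNTK.aggMatrix G).IsIrreducible) (haper : GNTK.IsAperiodic (GNTK.aggMatrix G))
    (π : V × V → ℝ) (hπ : GNTK.IsStationaryDistribution (GNTK.aggMatrix G) π) :
    ∃ α C : ℝ, 0 < α ∧ α < 1 ∧ 0 < C ∧
      ∃ (v : V × V → ℝ) (v' : ℕ → V × V → ℝ),
        (∀ r ≤ R, ∀ (l : ℕ) (u u' : V),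
          |GNTK.gntk G h φ σw σb R l r u u' - π ⬝ᵥ (((R : ℝ) * (l : ℝ)) • v + v' r)| ≤ C * α ^ l) ∧
        (∀ r ≤ R, ∀ (l : ℕ) (u u' w w' : V),
          |GNTK.gntk G h φ σw σb R l r u u' - GNTK.gntk G h φ σw σb R l r w w'|
            ≤ 2 * C * α ^ l) := by
  obtain ⟨c, κ, hgrow⟩ : ∃ c κ : ℝ, ∀ r ≤ R, GNTK.ExpDecay fun l (p : V × V) =>
      GNTK.gntk G h φ σw σb R l r p.1 p.2 - (R * l * c + κ + r * c) := by
    rcases hφ with rfl | rfl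
    · obtain ⟨hw, hb⟩ := GNTK.edgeOfChaos_relu hcrit
      exact GNTK.gntk_relu_growth hw hb hirr hπ
    · obtain ⟨q, hq⟩ := GNTK.edgeOfChaos_tanh hcrit
      exact GNTK.gntk_tanh_growth hq hirr hπ
  obtain ⟨C, α, hC, hα0, hα1, hle⟩ := GNTK.ExpDecay.uniform (n := R + 1)
    (F := fun r l (p : V × V) =>
      GNTK.gntk G h φ σw σb R l r p.1 p.2 - (R * l * c + κ + r * c))
    fun r hr => hgrow r (by omega)
  -- Constant vectors suffice, because pairing with a probability vector returns the constant.
  refine ⟨α, C, hα0, hα1, hC, fun _ => c, fun r _ => κ + r * c, fun r hr l u u' => ?_,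
    fun r hr l u u' w w' => ?_⟩
  · have hdot : π ⬝ᵥ (((R : ℝ) * (l : ℝ)) • (fun _ => c) + fun _ => κ + r * c) =
        R * l * c + κ + r * c := by
      simp only [dotProduct, Pi.add_apply, Pi.smul_apply, smul_eq_mul, ← Finset.sum_mul]
      rw [hπ.2.1]
      ring
    rw [hdot]
    exact hle r (by omega) l (u, u')
  · have h1 := abs_le.1 (hle r (by omega) l (u, u'))
    have h2 := abs_le.1 (hle r (by omega) l (w, w'))
    rw [abs_le]
    constructor <;> linarith [h1.1, h1.2, h2.1, h2.2]
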